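/- Consider the controlled pendulum $\dot x=y,\ \dot y=-\sin x+\varepsilon u,\ |u|\le 1$ ($\varepsilon>0$), on the phase space $S^1\times\mathbb R$, $S^1=\mathbb R/2\pi\mathbb Z$, with energy $E(x,y)=\frac12y^2+(1-\cos x)$ and standstill zone $S_{2\varepsilon}=\{|\sin x|<2\varepsilon,\ |y|<2\varepsilon\}$. A \emph{quasioptimal control} $u$ provides, for every sufficiently small $\varepsilon>0$ and every initial point $p$, an admissible motion (with measurable control) from $p$ to the lower equilibrium $(0,0)$ in a finite time $T_\varepsilon(p)(u)$, such that $u=-\operatorname{sign}y$ whenever the state is outside $S_{2\varepsilon}$; inside the zone the control is arbitrary, except that the total time spent in $S_{2\varepsilon}$ and the number of switchings made in its closure are at most $C\log(1/\varepsilon)$, with $C$ independent of $\varepsilon$ and $p$. A switching is a time strictly between the start and the end of the motion at which the control has a non-removable discontinuity. Let $N_\varepsilon(u)$ be the supremum, over all initial points $p$ of the phase space, of the number of switchings of the control along the motion from $p$, and for a compact $K$ let $T_\varepsilon(K)(u)=\sup_{p\in K}T_\varepsilon(p)(u)$. For $E\ge2$ put $$\tau_+(E)=\frac1{2\sqrt2\,\pi}\int_2^E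 de\int_0^{2\pi}\frac{d\phi}{\sqrt{e-1-\cos\phi}},$$ for $0\le E\le 2$ let $\Phi=\Phi(E)\in[0,\pi]$ be the solution of $1-\cos\Phi=E$ and put $$\tau_-(E)=\frac1{\sqrt2}\int_0^{\Phi}\frac{\sin x}{x}\,dx\int_0^x\frac{d\phi}{\sqrt{\cos\phi-\cos x}},$$ and let $\tau(E)=\tau_+(E)+\tau_-(2)$ if $E\ge2$, $\tau(E)=\tau_-(E)$ if $E\le 2$. Theorem. Quasioptimal controls exist, and for every quasioptimal control $u$ $$\lim_{\varepsilon\to0+}\varepsilon\,N_\varepsilon(u)=\int_0^\pi\frac{\sin x}{2x}\,dx .$$ Moreover, if $K$ is a nonempty compact subset of the phase space and $E=\max_{p\in K}E(p)$, then $$\lim_{\varepsilon\to0+}\varepsilon\,T_\varepsilon(K)(u)=\tau(E).$$ -/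

import Mathlib

open Filter Topology MeasureTheory
open scoped ENNReal

noncomputable section

namespace Pendulum

/-- The phase space: the cylinder `S¹ × ℝ` with coordinates (angle, angular velocity). -/
abbrev Phase : Type := Real.Angle × ℝ

/-- The energy `y² / 2 + (1 - cos x)`. -/
def energy (p : Phase) : ℝ := p.2 ^ 2 / 2 + (1 - p.1.cos)

/-- The standstill zone `S_{2ε}`; for `2 ε < 1` it has two components, one around the lower and
one around the upper equilibrium. -/
def standstill (ε : ℝ) : Set Phase := {p | |p.1.sin| < 2 * ε ∧ |p.2| < 2 * ε}

/-- Data of a controlled motion on the time interval `[0, T]`: the angle `x` (lifted to `ℝ`),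
the velocity `y` and the control `u`. -/
structure Motion where
  T : ℝ
  x : ℝ → ℝ
  y : ℝ → ℝ
  u : ℝ → ℝ

/-- The state of a motion at time `t`, as a point of the phase space. -/
def Motion.state (m : Motion) (t : ℝ) : Phase := ((m.x t : Real.Angle), m.y t)

/-- `m` solves `x' = y`, `y' = -sin x + ε u` on `[0, T]` (in the sense of Carathéodory) with a
measurable control `|u| ≤ 1`, and leads from `p` to the lower equilibrium `(0, 0)`. -/
structure Motion.IsDamping (ε : ℝ) (p : Phase) (m : Motion) : Prop where
  duration_nonneg : 0 ≤ m.T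
  measurable_control : Measurable m.u
  control_le : ∀ t ∈ Set.Icc 0 m.T, |m.u t| ≤ 1
  deriv_angle : ∀ t ∈ Set.Icc 0 m.T, HasDerivWithinAt m.x (m.y t) (Set.Icc 0 m.T) t
  continuous_velocity : ContinuousOn m.y (Set.Icc 0 m.T)
  velocity_eq : ∀ t ∈ Set.Icc 0 m.T,
    m.y t = m.y 0 + ∫ s in (0 : ℝ)..t, (-Real.sin (m.x s) + ε * m.u s)
  start : m.state 0 = p
  finish : m.state m.T = (0, 0)

/-- The switching instants of the control: the times in `(0, T)` at which the control has a
discontinuity that cannot be removed by changing its value at that time. -/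
def Motion.switchings (m : Motion) : Set ℝ :=
  {t ∈ Set.Ioo 0 m.T | ¬ ∃ c : ℝ, Tendsto m.u (𝓝[≠] t) (𝓝 c)}

/-- The number of switchings of the control (`⊤` if there are infinitely many). -/
def Motion.numSwitchings (m : Motion) : ℝ≥0∞ := (m.switchings.encard : ℝ≥0∞)

/-- The control is the dry friction `u = -sign y` outside the standstill zone. -/
def Motion.DryFriction (ε : ℝ) (m : Motion) : Prop :=
  ∀ t ∈ Set.Icc 0 m.T, m.state t ∉ standstill ε → m.u t = -Real.sign (m.y t)

/-- A quasioptimal control: for every small `ε > 0` and every initial point `p` a motion `m ε p`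
damping the pendulum from `p`, with `u = -sign y` outside the standstill zone, such that the time
spent in the zone and the number of switchings made in its closure are at most `C log (1 / ε)`,
where `C` does not depend on `ε` and `p`. -/
structure IsQuasioptimal (m : ℝ → Phase → Motion) : Prop where
  isDamping : ∀ᶠ ε in 𝓝[>] (0 : ℝ), ∀ p, (m ε p).IsDamping ε p
  dryFriction : ∀ᶠ ε in 𝓝[>] (0 : ℝ), ∀ p, (m ε p).DryFriction ε
  zone : ∃ C : ℝ, ∀ᶠ ε in 𝓝[>] (0 : ℝ), ∀ p,
    volume {t ∈ Set.Icc 0 (m ε p).T | (m ε p).state t ∈ standstill ε}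
        ≤ ENNReal.ofReal (C * Real.log (1 / ε)) ∧
      (({t ∈ (m ε p).switchings | (m ε p).state t ∈ closure (standstill ε)}.encard : ℕ∞) : ℝ≥0∞)
        ≤ ENNReal.ofReal (C * Real.log (1 / ε))

/-- The switching number `N_ε(u)`: the supremum of the numbers of switchings over all initial
points of the phase space. -/
def switchingNumber (m : ℝ → Phase → Motion) (ε : ℝ) : ℝ≥0∞ :=
  ⨆ p : Phase, (m ε p).numSwitchings

/-- The damping time `T_ε(K)(u)`: the supremum of the durations over the initial points in `K`. -/
def dampingTime (m : ℝ → Phase → Motion) (K : Set Phase) (ε : ℝ) : ℝ≥0∞ :=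
  ⨆ p ∈ K, ENNReal.ofReal (m ε p).T

/-- The contribution of the high energies, for `E ≥ 2`. -/
def tauPlus (E : ℝ) : ℝ :=
  1 / (2 * √2 * Real.pi) *
    ∫ e in (2 : ℝ)..E, ∫ φ in (0 : ℝ)..(2 * Real.pi), 1 / √(e - 1 - Real.cos φ)

/-- The contribution of the low energies, for `0 ≤ E ≤ 2`; here `Φ = arccos (1 - E)` is the
solution of `1 - cos Φ = E` in `[0, π]`. -/
def tauMinus (E : ℝ) : ℝ :=
  1 / √2 * ∫ x in (0 : ℝ)..(Real.arccos (1 - E)),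
    Real.sin x / x * ∫ φ in (0 : ℝ)..x, 1 / √(Real.cos φ - Real.cos x)

/-- The limit function `τ`. -/
def tau (E : ℝ) : ℝ := if 2 ≤ E then tauPlus E + tauMinus 2 else tauMinus E

end Pendulum

end

open Filter Topology MeasureTheory
open scoped ENNReal

noncomputable section

namespace Pendulum

open Set intervalIntegral

/-! ### Absolutely continuous functions -/

/-! The `clock` of a motion is its initial energy minus `ε` times the path length, that is, the
energy that pure dry friction would leave. The true energy exceeds it only by work done in the
standstill zone, at most `4 ε² Λ` if the zone time is at most `Λ` (`Braked.en_mem`). For a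
quasioptimal control `ε Λ → 0`, so what happens in the zone is invisible in the limit, and both
durations and switchings can be counted along the decreasing clock.

Damping time. On the orbit of a fixed energy `e`, different from `0` and `2`, time and path length
have the ratio `rate e`; hence a loss `de` of energy takes about the time `rate e * de / ε`. This is
averaging. On a window where the energy stays near `β`, time minus `rate β` times path length is, up
to small terms, the increment of a function of the phase. The derivative of that function with
respect to the phase has zero mean over a period, so the function is bounded (`window_low` in a
polar angle, `window_high` in the angle itself), and `regular_of_window` adds up the windows. The
change of variable `e = 1 - cos x` and an elliptic substitution identify the integral of `rate` with
`tau` (`tau_eq`).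

Averaging is not uniform near the critical energies `0` and `2`. There the bounded function `arctan
(y / r) * arctan (sin x / r)` decreases at a definite rate wherever `|y| < r ≤ |sin x|`. So time is
bounded by path length at scale `r` plus the time spent within `r` of an equilibrium
(`Controlled.residence_le`). With `r` proportional to the square root of the distance of the clock
from the critical value, a `δ`-neighbourhood costs a time of order `√δ / ε`
(`Controlled.time_le_near_critical`); with `r = 2 ε`, the remaining core costs a time of order `1 +
Λ` (`Controlled.time_le_core`). Both are negligible after multiplication by `ε`, and
`Braked.time_estimate` collects everything.

Switchings. Outside the closed zone the control switches only at turning points, where `y = 0`.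
Between two of them the angle runs through both amplitudes, up to `2 arcsin ε`
(`Controlled.spacing`), so the clock loses about `ε` times the sum of the amplitudes. The function
`swing` has derivative `1 / (2 * amplitude)`; in this scale each turning point costs about `ε`.
Turning points need a clock value at most `2`, so there are about `swing 2 / ε` of them
(`Braked.encard_turnings_le`), and a motion of initial energy at least `2` makes that many
(`Braked.le_encard_turnings`).

Existence. A continuous feedback equal to `-1`, but to `1` close to the upper equilibrium, moves the
pendulum forward until it stops or passes the top (`exists_run`). By reflection and translation the
next run starts from a similar state (`Node`), with an energy smaller by at least `4 / 5 * ε ^ 2`. A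
run meets the zone only at energies within `O(ε²)` of `0` or `2`, which happens a bounded number of
times, and then for a time at most `27`. A final arc inside the zone leads to the lower equilibrium
(`Damps.of_near`). -/

theorem _root_.AbsolutelyContinuousOnInterval.comp_lipschitzOnWith {f φ : ℝ → ℝ} {a b : ℝ}
    {s : Set ℝ} {K : NNReal} (hf : AbsolutelyContinuousOnInterval f a b)
    (hφ : LipschitzOnWith K φ s) (hs : ∀ t ∈ uIcc a b, f t ∈ s) :
    AbsolutelyContinuousOnInterval (fun t => φ (f t)) a b := by
  rw [absolutelyContinuousOnInterval_iff] at hf ⊢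
  intro e he
  obtain ⟨d, hd, h⟩ := hf (e / (K + 1)) (by positivity)
  refine ⟨d, hd, fun E hE hEd => ?_⟩
  have h1 := h E hE hEd
  calc _ ≤ ∑ i ∈ Finset.range E.1, K * dist (f (E.2 i).1) (f (E.2 i).2) := by
        refine Finset.sum_le_sum fun i hi => ?_
        exact hφ.dist_le_mul _ (hs _ (hE.1 i hi).1) _ (hs _ (hE.1 i hi).2)
    _ = K * ∑ i ∈ Finset.range E.1, dist (f (E.2 i).1) (f (E.2 i).2) := by rw [Finset.mul_sum]
    _ ≤ (K + 1) * ∑ i ∈ Finset.range E.1, dist (f (E.2 i).1) (f (E.2 i).2) := by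
        refine mul_le_mul_of_nonneg_right (by linarith)
          (Finset.sum_nonneg fun _ _ => dist_nonneg)
    _ < (K + 1) * (e / (K + 1)) := by gcongr
    _ = e := by field_simp

theorem _root_.AbsolutelyContinuousOnInterval.comp_contDiff {f φ : ℝ → ℝ} {a b : ℝ}
    (hf : AbsolutelyContinuousOnInterval f a b) (hφ : ContDiff ℝ 1 φ) :
    AbsolutelyContinuousOnInterval (fun t => φ (f t)) a b := by
  obtain ⟨C, hC⟩ := hf.exists_bound
  obtain ⟨K, hK⟩ := (hφ.contDiffOn (s := Icc (-C) C)).exists_lipschitzOnWith (by decide)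
    (convex_Icc _ _) isCompact_Icc
  exact hf.comp_lipschitzOnWith hK fun t ht => abs_le.1 (hC t ht)

theorem _root_.AbsolutelyContinuousOnInterval.comp_contDiffOn_Ioi {f φ : ℝ → ℝ} {a b : ℝ}
    (hf : AbsolutelyContinuousOnInterval f a b) (h0 : ∀ t ∈ uIcc a b, 0 < f t)
    (hφ : ContDiffOn ℝ 1 φ (Ioi 0)) :
    AbsolutelyContinuousOnInterval (fun t => φ (f t)) a b := by
  obtain ⟨C, hC⟩ := hf.exists_bound
  obtain ⟨t₀, ht₀, hmin⟩ := isCompact_uIcc.exists_isMinOn nonempty_uIcc hf.continuousOn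
  obtain ⟨K, hK⟩ := (hφ.mono fun r (hr : r ∈ Icc (f t₀) C) =>
    (h0 _ ht₀).trans_le hr.1).exists_lipschitzOnWith (by decide) (convex_Icc _ _) isCompact_Icc
  exact hf.comp_lipschitzOnWith hK fun t ht => ⟨hmin ht, (le_abs_self _).trans (hC t ht)⟩

theorem _root_.AbsolutelyContinuousOnInterval.inv₀ {f : ℝ → ℝ} {a b : ℝ}
    (hf : AbsolutelyContinuousOnInterval f a b) (h0 : ∀ t ∈ uIcc a b, 0 < f t) :
    AbsolutelyContinuousOnInterval (fun t => (f t)⁻¹) a b :=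
  hf.comp_contDiffOn_Ioi h0 fun _ hr => (contDiffAt_inv ℝ (ne_of_gt hr)).contDiffWithinAt

theorem _root_.AbsolutelyContinuousOnInterval.sqrt {f : ℝ → ℝ} {a b : ℝ}
    (hf : AbsolutelyContinuousOnInterval f a b) (h0 : ∀ t ∈ uIcc a b, 0 < f t) :
    AbsolutelyContinuousOnInterval (fun t => √(f t)) a b :=
  hf.comp_contDiffOn_Ioi h0 fun _ hr => (Real.contDiffAt_sqrt (ne_of_gt hr)).contDiffWithinAt

/-- The control is only measurable, so the velocity is differentiable only almost everywhere;
absolute continuity is what allows such differential inequalities to be integrated. -/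
theorem _root_.AbsolutelyContinuousOnInterval.sub_le_integral {f φ : ℝ → ℝ} {a b : ℝ}
    (hab : a ≤ b) (hf : AbsolutelyContinuousOnInterval f a b)
    (hφ : IntervalIntegrable φ volume a b)
    (h : ∀ᵐ t, t ∈ Icc a b → ∃ d, HasDerivAt f d t ∧ d ≤ φ t) :
    f b - f a ≤ ∫ t in a..b, φ t := by
  rw [← hf.integral_deriv_eq_sub]
  refine integral_mono_ae_restrict hab hf.intervalIntegrable_deriv hφ ?_
  rw [EventuallyLE, ae_restrict_iff' measurableSet_Icc]
  filter_upwards [h] with t ht hm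
  obtain ⟨d, hd, hle⟩ := ht hm
  rwa [hd.deriv]

theorem _root_.AbsolutelyContinuousOnInterval.integral_eq_sub {f φ : ℝ → ℝ} {a b : ℝ}
    (hf : AbsolutelyContinuousOnInterval f a b)
    (h : ∀ᵐ t, t ∈ uIcc a b → HasDerivAt f (φ t) t) :
    ∫ t in a..b, φ t = f b - f a := by
  rw [← hf.integral_deriv_eq_sub]
  refine integral_congr_ae ?_
  filter_upwards [h] with t ht hm
  exact (ht (uIoc_subset_uIcc hm)).deriv.symm

theorem ae_mem_Icc_of_Ioo {P : ℝ → Prop} {a b : ℝ} (h : ∀ᵐ t, t ∈ Ioo a b → P t) :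
    ∀ᵐ t, t ∈ Icc a b → P t := by
  have h₁ : ∀ᵐ t : ℝ, t ≠ a := by simp [ae_iff, measure_singleton]
  have h₂ : ∀ᵐ t : ℝ, t ≠ b := by simp [ae_iff, measure_singleton]
  filter_upwards [h, h₁, h₂] with t h h₁ h₂ hm
  exact h ⟨lt_of_le_of_ne hm.1 h₁.symm, lt_of_le_of_ne hm.2 h₂⟩

/-! ### The controlled system -/

/-- `x, y` solve the controlled pendulum equation on `[a, b]` with the control `u`. -/
structure Controlled (ε a b : ℝ) (x y u : ℝ → ℝ) : Prop where
  le : a ≤ b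
  eps_pos : 0 < ε
  meas : Measurable u
  bound : ∀ t ∈ Icc a b, |u t| ≤ 1
  cont_angle : ContinuousOn x (Icc a b)
  cont_vel : ContinuousOn y (Icc a b)
  angle : ∀ s ∈ Icc a b, ∀ t ∈ Icc a b, x t - x s = ∫ r in s..t, y r
  vel : ∀ s ∈ Icc a b, ∀ t ∈ Icc a b, y t - y s = ∫ r in s..t, (-Real.sin (x r) + ε * u r)

namespace Controlled

variable {ε a b : ℝ} {x y u : ℝ → ℝ}

theorem mono (h : Controlled ε a b x y u) {c d : ℝ} (hcd : c ≤ d) (hac : a ≤ c) (hdb : d ≤ b) :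
    Controlled ε c d x y u := by
  have hs : Icc c d ⊆ Icc a b := Icc_subset_Icc hac hdb
  exact ⟨hcd, h.eps_pos, h.meas, fun t ht => h.bound t (hs ht), h.cont_angle.mono hs,
    h.cont_vel.mono hs, fun s hs' t ht => h.angle s (hs hs') t (hs ht),
    fun s hs' t ht => h.vel s (hs hs') t (hs ht)⟩

theorem neg (h : Controlled ε a b x y u) :
    Controlled ε a b (fun t => -x t) (fun t => -y t) (fun t => -u t) := by
  refine ⟨h.le, h.eps_pos, h.meas.neg, fun t ht => by simpa using h.bound t ht,
    h.cont_angle.neg, h.cont_vel.neg, fun s hs t ht => ?_, fun s hs t ht => ?_⟩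
  · rw [intervalIntegral.integral_neg, ← h.angle s hs t ht]; ring
  · have := h.vel s hs t ht
    have h2 : (fun r => -Real.sin (-x r) + ε * -u r) = fun r => -(-Real.sin (x r) + ε * u r) := by
      ext r; rw [Real.sin_neg]; ring
    rw [h2, intervalIntegral.integral_neg, ← this]; ring

theorem shift (h : Controlled ε a b x y u) {c : ℝ} (hc : ∀ r, Real.sin (r + c) = Real.sin r) :
    Controlled ε a b (fun t => x t + c) y u := by
  refine ⟨h.le, h.eps_pos, h.meas, h.bound, h.cont_angle.add continuousOn_const, h.cont_vel,
    fun s hs t ht => ?_, fun s hs t ht => ?_⟩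
  · rw [← h.angle s hs t ht]; ring
  · simp only [hc]; exact h.vel s hs t ht

/-- The equation is invariant under time reversal with `y ↦ -y`. In `spacing` this lets a swing be
followed backwards from the later turning point. -/
theorem reverse (h : Controlled ε a b x y u) (c : ℝ) :
    Controlled ε (c - b) (c - a) (fun t => x (c - t)) (fun t => -y (c - t)) (fun t => u (c - t)) := by
  have hm : ∀ t ∈ Icc (c - b) (c - a), c - t ∈ Icc a b := fun t ht =>
    ⟨by linarith [ht.2], by linarith [ht.1]⟩
  refine ⟨by linarith [h.le], h.eps_pos, h.meas.comp (measurable_const.sub measurable_id),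
    fun t ht => h.bound _ (hm t ht), h.cont_angle.comp (by fun_prop) hm,
    (h.cont_vel.comp (by fun_prop) hm).neg, fun s hs t ht => ?_, fun s hs t ht => ?_⟩
  · rw [intervalIntegral.integral_neg, integral_comp_sub_left (fun r => y r) c, ← h.angle _ (hm t ht) _ (hm s hs)]
    ring
  · rw [integral_comp_sub_left (fun r => -Real.sin (x r) + ε * u r) c,
      ← h.vel _ (hm t ht) _ (hm s hs)]
    ring

theorem uIcc_eq (h : Controlled ε a b x y u) : uIcc a b = Icc a b := uIcc_of_le h.le

theorem left_mem (h : Controlled ε a b x y u) : a ∈ Icc a b := left_mem_Icc.2 h.le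
theorem right_mem (h : Controlled ε a b x y u) : b ∈ Icc a b := right_mem_Icc.2 h.le

theorem integrable_control (h : Controlled ε a b x y u) : IntervalIntegrable u volume a b := by
  rw [intervalIntegrable_iff_integrableOn_Icc_of_le h.le]
  refine Measure.integrableOn_of_bounded (M := 1) (by simp) h.meas.aestronglyMeasurable ?_
  rw [ae_restrict_iff' measurableSet_Icc]
  exact ae_of_all _ fun t ht => h.bound t ht

theorem integrable_vel (h : Controlled ε a b x y u) : IntervalIntegrable y volume a b :=
  (h.uIcc_eq ▸ h.cont_vel).intervalIntegrable

theorem integrable_abs_vel (h : Controlled ε a b x y u) :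
    IntervalIntegrable (fun t => |y t|) volume a b := h.integrable_vel.abs

theorem integrable_force (h : Controlled ε a b x y u) :
    IntervalIntegrable (fun r => -Real.sin (x r) + ε * u r) volume a b := by
  refine IntervalIntegrable.add ?_ (h.integrable_control.const_mul ε)
  refine ContinuousOn.intervalIntegrable ?_
  rw [h.uIcc_eq]
  exact (Real.continuous_sin.comp_continuousOn h.cont_angle).neg

theorem ac_angle (h : Controlled ε a b x y u) : AbsolutelyContinuousOnInterval x a b := by
  have h1 := h.integrable_vel.absolutelyContinuousOnInterval_intervalIntegral (c := a)
    left_mem_uIcc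
  have h2 : AbsolutelyContinuousOnInterval (fun _ : ℝ => x a) a b :=
    (contDiff_const (n := 1)).contDiffOn.absolutelyContinuousOnInterval
  rw [absolutelyContinuousOnInterval_iff] at h1 ⊢
  intro e he
  obtain ⟨d, hd, H⟩ := h1 e he
  refine ⟨d, hd, fun E hE hEd => ?_⟩
  refine (Finset.sum_le_sum fun i hi => le_of_eq ?_).trans_lt (H E hE hEd)
  have m1 := (hE.1 i hi).1
  have m2 := (hE.1 i hi).2
  rw [h.uIcc_eq] at m1 m2
  rw [← h.angle a h.left_mem _ m1, ← h.angle a h.left_mem _ m2, dist_sub_right]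

theorem ac_vel (h : Controlled ε a b x y u) : AbsolutelyContinuousOnInterval y a b := by
  have h1 := h.integrable_force.absolutelyContinuousOnInterval_intervalIntegral (c := a)
    left_mem_uIcc
  rw [absolutelyContinuousOnInterval_iff] at h1 ⊢
  intro e he
  obtain ⟨d, hd, H⟩ := h1 e he
  refine ⟨d, hd, fun E hE hEd => ?_⟩
  refine (Finset.sum_le_sum fun i hi => le_of_eq ?_).trans_lt (H E hE hEd)
  have m1 := (hE.1 i hi).1
  have m2 := (hE.1 i hi).2
  rw [h.uIcc_eq] at m1 m2
  rw [← h.vel a h.left_mem _ m1, ← h.vel a h.left_mem _ m2, dist_sub_right]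

theorem hasDerivAt_angle (h : Controlled ε a b x y u) {t : ℝ} (ht : t ∈ Ioo a b) :
    HasDerivAt x (y t) t := by
  have h1 : HasDerivAt (fun s => ∫ r in a..s, y r) (y t) t :=
    integral_hasDerivAt_right (h.integrable_vel.mono_set (by
        rw [h.uIcc_eq, uIcc_of_le ht.1.le]; exact Icc_subset_Icc le_rfl ht.2.le))
      (h.cont_vel.mono Ioo_subset_Icc_self |>.stronglyMeasurableAtFilter isOpen_Ioo t ht)
      (h.cont_vel.continuousAt (Icc_mem_nhds ht.1 ht.2))
  refine (h1.const_add (x a)).congr_of_eventuallyEq ?_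
  filter_upwards [Icc_mem_nhds ht.1 ht.2] with s hs
  rw [← h.angle a h.left_mem s hs]; ring

theorem ae_hasDerivAt (h : Controlled ε a b x y u) :
    ∀ᵐ t, t ∈ Icc a b → HasDerivAt x (y t) t ∧ HasDerivAt y (-Real.sin (x t) + ε * u t) t := by
  refine ae_mem_Icc_of_Ioo ?_
  filter_upwards [h.integrable_force.ae_hasDerivAt_integral] with t ht hm
  refine ⟨h.hasDerivAt_angle hm, ?_⟩
  have h1 := ht (h.uIcc_eq ▸ Ioo_subset_Icc_self hm) a left_mem_uIcc
  refine (h1.const_add (y a)).congr_of_eventuallyEq ?_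
  filter_upwards [Icc_mem_nhds hm.1 hm.2] with s hs
  rw [← h.vel a h.left_mem s hs]; ring

theorem uIcc_subset (_h : Controlled ε a b x y u) {s t : ℝ} (hs : s ∈ Icc a b) (ht : t ∈ Icc a b) :
    uIcc s t ⊆ uIcc a b := uIcc_subset_uIcc (Icc_subset_uIcc hs) (Icc_subset_uIcc ht)

/-- Upper bounds of the force bound the growth of the velocity. -/
theorem vel_sub_le (h : Controlled ε a b x y u) {s t c : ℝ} (hs : s ∈ Icc a b) (ht : t ∈ Icc a b)
    (hst : s ≤ t) (hc : ∀ r ∈ Ioo s t, -Real.sin (x r) + ε * u r ≤ c) :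
    y t - y s ≤ c * (t - s) := by
  rw [h.vel s hs t ht]
  have h1 : ∫ _ in s..t, c = c * (t - s) := by simp [mul_comm]
  rw [← h1]
  refine integral_mono_on_of_le_Ioo hst 
    (h.integrable_force.mono_set (h.uIcc_subset hs ht)) intervalIntegrable_const hc

/-- The energy balance. -/
theorem energy_sub (h : Controlled ε a b x y u) {s t : ℝ} (hs : s ∈ Icc a b) (ht : t ∈ Icc a b) :
    (y t ^ 2 / 2 + (1 - Real.cos (x t))) - (y s ^ 2 / 2 + (1 - Real.cos (x s)))
      = ∫ r in s..t, ε * (u r * y r) := by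
  have hx := h.ac_angle.mono (h.uIcc_subset hs ht)
  have hy := h.ac_vel.mono (h.uIcc_subset hs ht)
  have hac : AbsolutelyContinuousOnInterval
      (fun t => y t ^ 2 / 2 + (1 - Real.cos (x t))) s t :=
    (hy.comp_contDiff (φ := fun v => v ^ 2 / 2) (by fun_prop)).add
      (hx.comp_contDiff (φ := fun v => 1 - Real.cos v)
        (contDiff_const.sub Real.contDiff_cos))
  rw [hac.integral_eq_sub (φ := fun r => ε * (u r * y r))]
  filter_upwards [h.ae_hasDerivAt] with r hr hm
  obtain ⟨h1, h2⟩ := hr (h.uIcc_eq ▸ h.uIcc_subset hs ht hm)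
  refine (((h2.fun_pow 2).div_const 2).add ((h1.cos).const_sub 1)).congr_deriv ?_
  push_cast
  ring

end Controlled

/-! ### Residence times -/

theorem abs_arctan_lt_two (s : ℝ) : |Real.arctan s| < 2 := by
  have h1 := Real.arctan_lt_pi_div_two s
  have h2 := Real.neg_pi_div_two_lt_arctan s
  have := Real.pi_lt_four
  rw [abs_lt]; constructor <;> linarith

theorem mul_arctan_nonneg (s : ℝ) : 0 ≤ s * Real.arctan s := by
  rcases le_total 0 s with h | h
  · exact mul_nonneg h (Real.arctan_nonneg.2 h)
  · exact mul_nonneg_of_nonpos_of_nonpos h (by simpa using Real.arctan_mono h)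

theorem mul_arctan_eq_abs (s : ℝ) : s * Real.arctan s = |s| * Real.arctan |s| := by
  rcases le_total 0 s with h | h
  · rw [abs_of_nonneg h]
  · rw [abs_of_nonpos h, Real.arctan_neg]; ring

theorem three_quarters_le_arctan {s : ℝ} (hs : 1 ≤ s) : 3 / 4 ≤ Real.arctan s := by
  have h1 := Real.arctan_mono hs
  rw [Real.arctan_one] at h1
  linarith [Real.pi_gt_three]

theorem abs_div_one_add_sq_le (Y : ℝ) : |Y / (1 + Y ^ 2)| ≤ 1 / 2 := by
  rw [abs_div, abs_of_pos (by positivity : (0 : ℝ) < 1 + Y ^ 2), div_le_iff₀ (by positivity)]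
  nlinarith [sq_abs Y, sq_nonneg (|Y| - 1)]

/-- The pointwise inequality behind `Controlled.residence_le`. -/
theorem residence_pointwise {Y S e v ρ c i : ℝ} (he0 : 0 ≤ e) (he : e ≤ 1 / 2) (hv : |v| ≤ 1)
    (hc : |c| ≤ 1) (hρ : |ρ| ≤ |Y|) (hi : 0 ≤ i) (hi1 : |Y| < 1 → |S| < 1 → i = 1) :
    1 ≤ 6 * ((S - e * v) * (Real.arctan S / (1 + Y ^ 2)) + ρ * (Y / (1 + Y ^ 2)) * Real.arctan S
      - Real.arctan Y * (c * Y) * (1 / (1 + S ^ 2)) + Real.arctan Y * (S / (1 + S ^ 2)) * ρ)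
      + 31 * |Y| + 7 * i := by
  have aS := (abs_arctan_lt_two S).le
  have aY := (abs_arctan_lt_two Y).le
  have hY0 := abs_nonneg Y
  have t2 : |ρ * (Y / (1 + Y ^ 2)) * Real.arctan S| ≤ |Y| := by
    rw [abs_mul, abs_mul]
    calc _ ≤ |Y| * (1 / 2) * 2 := by
          gcongr
          exact abs_div_one_add_sq_le Y
      _ = |Y| := by ring
  have t4 : |Real.arctan Y * (S / (1 + S ^ 2)) * ρ| ≤ |Y| := by
    rw [abs_mul, abs_mul]
    calc _ ≤ 2 * (1 / 2) * |Y| := by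
          gcongr
          exact abs_div_one_add_sq_le S
      _ = |Y| := by ring
  have t3 : |Real.arctan Y * (c * Y) * (1 / (1 + S ^ 2))| ≤ 2 * |Y| := by
    rw [abs_mul, abs_mul, abs_mul]
    have h1 : |1 / (1 + S ^ 2)| ≤ 1 := by
      rw [abs_of_pos (by positivity), div_le_one (by positivity)]; nlinarith
    calc _ ≤ 2 * (1 * |Y|) * 1 := by gcongr
      _ = 2 * |Y| := by ring
  have hev : |e * v * Real.arctan S| ≤ 1 / 2 * |Real.arctan S| := by
    rw [abs_mul, abs_mul, abs_of_nonneg he0]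
    gcongr
    nlinarith
  have hev' := (abs_le.1 hev).2
  have hS := mul_arctan_nonneg S
  have hq : (S - e * v) * (Real.arctan S / (1 + Y ^ 2))
      = (S * Real.arctan S - e * v * Real.arctan S) / (1 + Y ^ 2) := by ring
  have hd : (0 : ℝ) < 1 + Y ^ 2 := by positivity
  have t1 : -1 ≤ (S - e * v) * (Real.arctan S / (1 + Y ^ 2)) := by
    rw [hq, le_div_iff₀ hd]
    nlinarith [sq_nonneg Y]
  have b2 := (abs_le.1 t2).1
  have b3 := (abs_le.1 t3).2
  have b4 := (abs_le.1 t4).1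
  -- After the factor 6 the last three terms cost at most `24 |Y|`. If `|Y| ≥ 1`, the remaining `7
  -- |Y|` pays for `t1` and for the 1. If `|Y| < 1 ≤ |S|`, the first term is at least `3 / 16`, and
  -- `6 * 3 / 16 > 1`. If both are below 1, the indicator pays, `7 = 6 + 1`.
  rcases le_or_gt 1 |Y| with h1 | h1
  · linarith
  rcases le_or_gt 1 |S| with h2 | h2
  · have t1' : 3 / 16 ≤ (S - e * v) * (Real.arctan S / (1 + Y ^ 2)) := by
      rw [hq, le_div_iff₀ hd]
      have hYsq : Y ^ 2 ≤ 1 := by rw [← sq_abs]; nlinarith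
      have h3 := three_quarters_le_arctan h2
      have h4 : |Real.arctan S| = Real.arctan |S| := by
        rcases le_total 0 S with h | h
        · rw [abs_of_nonneg h, abs_of_nonneg (Real.arctan_nonneg.2 h)]
        · rw [abs_of_nonpos h, Real.arctan_neg,
            abs_of_nonpos (by simpa using Real.arctan_mono h)]
      rw [h4] at hev'
      rw [mul_arctan_eq_abs]
      nlinarith
    linarith
  · have := hi1 h1 h2
    linarith

namespace Controlled

variable {ε a b : ℝ} {x y u : ℝ → ℝ}

/-- The time spent on `[a, b]` is controlled by the length of the path at scale `r` and the time
spent in the `r`-neighbourhood of the equilibria. -/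
theorem residence_le (h : Controlled ε a b x y u) {r r' : ℝ → ℝ} {Z : Set ℝ} {Λ : ℝ}
    (hr : ∀ t ∈ Icc a b, 2 * ε ≤ r t) (hac : AbsolutelyContinuousOnInterval r a b)
    (hder : ∀ t ∈ Ioo a b, HasDerivAt r (r' t) t) (hr' : ∀ t ∈ Ioo a b, |r' t| ≤ |y t|)
    (hZm : MeasurableSet Z)
    (hZ : ∀ t ∈ Ioo a b, |y t| < r t → |Real.sin (x t)| < r t → t ∈ Z)
    (hΛ : 0 ≤ Λ) (hvol : volume (Z ∩ Icc a b) ≤ ENNReal.ofReal Λ) :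
    b - a ≤ 30 + 31 * (∫ t in a..b, |y t| / r t) + 7 * Λ := by
  have hε := h.eps_pos
  have hr0 : ∀ t ∈ Icc a b, 0 < r t := fun t ht => by linarith [hr t ht]
  have hrc : ContinuousOn r (Icc a b) := h.uIcc_eq ▸ hac.continuousOn
  have hinv := hac.inv₀ (by rw [h.uIcc_eq]; exact hr0)
  have hY := h.ac_vel.fun_mul hinv
  have hS := (h.ac_angle.comp_contDiff (Real.contDiff_sin (n := 1))).fun_mul hinv
  have hg := (hY.comp_contDiff (Real.contDiff_arctan (n := 1))).fun_mul
    (hS.comp_contDiff (Real.contDiff_arctan (n := 1)))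
  -- As `y'` is nearly `-sin x`, this product decreases where `|y|` is small and `|sin x|` is large
  -- at scale `r`. Its bound `2.5` produces the constant `30 = 6 * 2 * 2.5`.
  set g : ℝ → ℝ := fun t => Real.arctan (y t * (r t)⁻¹) *
    Real.arctan (Real.sin (x t) * (r t)⁻¹) with hgdef
  have hgb : ∀ t, |g t| ≤ 2.5 := fun t => by
    have key : ∀ s, |Real.arctan s| ≤ 1.575 := fun s => by
      have h1 := Real.arctan_lt_pi_div_two s
      have h2 := Real.neg_pi_div_two_lt_arctan s
      have := Real.pi_lt_d2
      rw [abs_le]; constructor <;> linarith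
    rw [hgdef, abs_mul]
    calc _ ≤ (1.575 : ℝ) * 1.575 := by
          gcongr
          · exact key _
          · exact key _
      _ ≤ 2.5 := by norm_num
  have hcont : ContinuousOn (fun t => |y t| / r t) (Icc a b) :=
    h.cont_vel.abs.div hrc fun t ht => (hr0 t ht).ne'
  have hint1 : IntervalIntegrable (fun t => |y t| / r t) volume a b :=
    (h.uIcc_eq ▸ hcont).intervalIntegrable
  have hint2 : IntervalIntegrable (Z.indicator fun _ => (1 : ℝ)) volume a b := by
    rw [intervalIntegrable_iff_integrableOn_Icc_of_le h.le]
    exact (integrableOn_const (by simp)).indicator hZm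
  have hZint : ∫ t in a..b, Z.indicator (fun _ => (1 : ℝ)) t ≤ Λ := by
    rw [integral_of_le h.le, MeasureTheory.integral_indicator hZm,
      Measure.restrict_restrict hZm]
    simp only [MeasureTheory.integral_const, smul_eq_mul, mul_one, measureReal_restrict_apply_univ]
    refine ENNReal.toReal_le_of_le_ofReal hΛ (le_trans (measure_mono ?_) hvol)
    exact inter_subset_inter_right _ Ioc_subset_Icc_self
  have key := AbsolutelyContinuousOnInterval.sub_le_integral h.le
    (f := fun t => t + 6 * g t)
    (φ := fun t => 31 * (|y t| / r t) + 7 * Z.indicator (fun _ => (1 : ℝ)) t)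
    ((contDiff_id.contDiffOn.absolutelyContinuousOnInterval).add (hg.const_mul 6))
    ((hint1.const_mul 31).add (hint2.const_mul 7)) (ae_mem_Icc_of_Ioo (by
      filter_upwards [h.ae_hasDerivAt] with t ht hm
      have hm' := Ioo_subset_Icc_self hm
      obtain ⟨d1, d2⟩ := ht hm'
      have d3 := hder t hm
      have r0 := hr0 t hm'
      have d4 := d3.fun_inv r0.ne'
      have d5 := (d2.fun_mul d4).arctan
      have d6 := (d1.sin.fun_mul d4).arctan
      refine ⟨_, (hasDerivAt_id t).add ((d5.fun_mul d6).const_mul 6), ?_⟩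
      have hp := residence_pointwise (Y := y t * (r t)⁻¹) (S := Real.sin (x t) * (r t)⁻¹)
        (e := ε * (r t)⁻¹) (v := u t) (ρ := r' t * (r t)⁻¹) (c := Real.cos (x t))
        (i := Z.indicator (fun _ => (1 : ℝ)) t) (by positivity)
        (by rw [← div_eq_mul_inv, div_le_iff₀ r0]; linarith [hr t hm'])
        (h.bound t hm') (Real.abs_cos_le_one _)
        (by rw [abs_mul, abs_mul]; exact mul_le_mul_of_nonneg_right (hr' t hm) (abs_nonneg _))
        (indicator_nonneg (fun _ _ => zero_le_one) _)
        (fun hY1 hS1 => by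
          rw [← div_eq_mul_inv, abs_div, abs_of_pos r0, div_lt_one r0] at hY1 hS1
          exact indicator_of_mem (hZ t hm hY1 hS1) _)
      have e1 : |y t * (r t)⁻¹| = |y t| / r t := by
        rw [← div_eq_mul_inv, abs_div, abs_of_pos r0]
      rw [e1] at hp
      rw [← sub_nonneg]
      rw [← sub_nonneg] at hp
      refine hp.trans (le_of_eq ?_)
      field_simp
      ring))
  rw [intervalIntegral.integral_add (hint1.const_mul 31) (hint2.const_mul 7),
    intervalIntegral.integral_const_mul, intervalIntegral.integral_const_mul] at key
  have g1 := abs_le.1 (hgb a)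
  have g2 := abs_le.1 (hgb b)
  linarith

end Controlled

/-- Near the equilibria the energy is close to `0` or to `2`. -/
theorem energy_near_of_small {x y r : ℝ} (hy : |y| < r) (hs : |Real.sin x| < r) :
    y ^ 2 / 2 + (1 - Real.cos x) ≤ 3 / 2 * r ^ 2 ∨
      |y ^ 2 / 2 + (1 - Real.cos x) - 2| ≤ r ^ 2 := by
  have h1 : y ^ 2 ≤ r ^ 2 := by rw [← sq_abs y]; gcongr
  have h2 : Real.sin x ^ 2 ≤ r ^ 2 := by rw [← sq_abs (Real.sin x)]; gcongr
  have h3 := Real.sin_sq_add_cos_sq x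
  have h4 := Real.cos_le_one x
  have h5 := Real.neg_one_le_cos x
  rcases le_total 0 (Real.cos x) with hc | hc
  · left; nlinarith
  · right; rw [abs_le]; constructor <;> nlinarith [sq_nonneg y]

/-- A clock along a motion: it decreases at the rate `ε |y|` of the energy loss by friction. -/
def IsClock (ε a b : ℝ) (y k : ℝ → ℝ) : Prop :=
  ∀ s ∈ Icc a b, ∀ t ∈ Icc a b, k s - k t = ε * ∫ r in s..t, |y r|

namespace IsClock

variable {ε a b : ℝ} {x y u k : ℝ → ℝ}

theorem mono (hk : IsClock ε a b y k) {c d : ℝ} (hac : a ≤ c) (hdb : d ≤ b) :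
    IsClock ε c d y k :=
  fun s hs t ht => hk s (Icc_subset_Icc hac hdb hs) t (Icc_subset_Icc hac hdb ht)

theorem antitone (hk : IsClock ε a b y k) (hε : 0 < ε) {s t : ℝ} (hs : s ∈ Icc a b)
    (ht : t ∈ Icc a b) (hst : s ≤ t) : k t ≤ k s := by
  have h1 := hk s hs t ht
  have h2 : 0 ≤ ∫ r in s..t, |y r| := integral_nonneg hst fun _ _ => abs_nonneg _
  nlinarith

theorem ac (hk : IsClock ε a b y k) (h : Controlled ε a b x y u) :
    AbsolutelyContinuousOnInterval k a b := by
  have h1 := (h.integrable_abs_vel.absolutelyContinuousOnInterval_intervalIntegral (c := a)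
    left_mem_uIcc).const_mul ε
  rw [absolutelyContinuousOnInterval_iff] at h1 ⊢
  intro e he
  obtain ⟨d, hd, H⟩ := h1 e he
  refine ⟨d, hd, fun E hE hEd => ?_⟩
  refine (Finset.sum_le_sum fun i hi => le_of_eq ?_).trans_lt (H E hE hEd)
  have m1 := (hE.1 i hi).1
  have m2 := (hE.1 i hi).2
  rw [h.uIcc_eq] at m1 m2
  rw [← hk a h.left_mem _ m1, ← hk a h.left_mem _ m2, dist_sub_left]

theorem continuousOn (hk : IsClock ε a b y k) (h : Controlled ε a b x y u) :
    ContinuousOn k (Icc a b) := h.uIcc_eq ▸ (hk.ac h).continuousOn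

theorem hasDerivAt (hk : IsClock ε a b y k) (h : Controlled ε a b x y u) {t : ℝ}
    (ht : t ∈ Ioo a b) : HasDerivAt k (-(ε * |y t|)) t := by
  have h1 : HasDerivAt (fun s => ∫ r in a..s, |y r|) (|y t|) t :=
    integral_hasDerivAt_right (h.integrable_abs_vel.mono_set (by
        rw [h.uIcc_eq, uIcc_of_le ht.1.le]; exact Icc_subset_Icc le_rfl ht.2.le))
      (h.cont_vel.abs.mono Ioo_subset_Icc_self |>.stronglyMeasurableAtFilter isOpen_Ioo t ht)
      (h.cont_vel.abs.continuousAt (Icc_mem_nhds ht.1 ht.2))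
  refine ((h1.const_mul ε).const_sub (k a)).congr_of_eventuallyEq ?_
  filter_upwards [Icc_mem_nhds ht.1 ht.2] with s hs
  rw [← hk a h.left_mem s hs]; ring

end IsClock

namespace Controlled

variable {ε a b : ℝ} {x y u k : ℝ → ℝ}

/-- Time spent at energies close to, but not too close to, a critical value `c`, on the side
given by the sign `σ`. -/
theorem time_le_near_critical (h : Controlled ε a b x y u) (hk : IsClock ε a b y k) {c σ δ : ℝ}
    (hσ : |σ| = 1) (hlow : ∀ t ∈ Icc a b, 16 * ε ^ 2 ≤ σ * (k t - c))
    (hup : ∀ t ∈ Icc a b, σ * (k t - c) ≤ δ)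
    (hE1 : ∀ t ∈ Icc a b, 3 / 8 * (σ * (k t - c)) < y t ^ 2 / 2 + (1 - Real.cos (x t)))
    (hE2 : ∀ t ∈ Icc a b,
      1 / 4 * (σ * (k t - c)) < |y t ^ 2 / 2 + (1 - Real.cos (x t)) - 2|) :
    b - a ≤ 30 + 124 * (√δ / ε) := by
  have hε := h.eps_pos
  have hε2 : 0 < 16 * ε ^ 2 := by positivity
  have hpos : ∀ t ∈ Icc a b, 0 < σ * (k t - c) := fun t ht => hε2.trans_le (hlow t ht)
  have hkac := hk.ac h
  have hcst : AbsolutelyContinuousOnInterval (fun _ : ℝ => c) a b :=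
    (contDiff_const (n := 1)).contDiffOn.absolutelyContinuousOnInterval
  have hsac : AbsolutelyContinuousOnInterval (fun t => √(σ * (k t - c))) a b :=
    ((hkac.fun_sub hcst).const_mul σ).sqrt (by rw [h.uIcc_eq]; exact hpos)
  have hsq : ∀ t ∈ Icc a b, √(σ * (k t - c)) ^ 2 = σ * (k t - c) := fun t ht =>
    Real.sq_sqrt (hpos t ht).le
  have hspos : ∀ t ∈ Icc a b, 0 < √(σ * (k t - c)) := fun t ht => Real.sqrt_pos.2 (hpos t ht)
  have hs4 : ∀ t ∈ Icc a b, 4 * ε ≤ √(σ * (k t - c)) := fun t ht =>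
    Real.le_sqrt_of_sq_le (by linarith [hlow t ht])
  have hsder : ∀ t ∈ Ioo a b, HasDerivAt (fun t => √(σ * (k t - c)))
      (σ * (-(ε * |y t|)) / (2 * √(σ * (k t - c)))) t := fun t ht =>
    (((hk.hasDerivAt h ht).sub_const c).const_mul σ).sqrt (hpos t (Ioo_subset_Icc_self ht)).ne'
  -- Within this `r` of an equilibrium the energy would violate `hE1` or `hE2`, by
  -- `energy_near_of_small`; so `Z` can be empty. The bound `σ * (k t - c) ≥ 16 ε²` gives both `2 ε
  -- ≤ r` and `|r'| ≤ |y|`.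
  have hres := h.residence_le (r := fun t => 1 / 2 * √(σ * (k t - c)))
    (r' := fun t => 1 / 2 * (σ * (-(ε * |y t|)) / (2 * √(σ * (k t - c))))) (Z := ∅) (Λ := 0)
    (fun t ht => by linarith [hs4 t ht]) (hsac.const_mul _)
    (fun t ht => (hsder t ht).const_mul _)
    (fun t ht => by
      have h1 := hs4 t (Ioo_subset_Icc_self ht)
      have h2 := hspos t (Ioo_subset_Icc_self ht)
      rw [show 1 / 2 * (σ * (-(ε * |y t|)) / (2 * √(σ * (k t - c))))
          = σ * (-(ε * |y t| / (4 * √(σ * (k t - c))))) by field_simp; ring, abs_mul, hσ, one_mul,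
        abs_neg, abs_of_nonneg (by positivity), div_le_iff₀ (by positivity)]
      nlinarith [abs_nonneg (y t)])
    MeasurableSet.empty
    (fun t ht hy hs => by
      exfalso
      have hm := Ioo_subset_Icc_self ht
      have e1 : (1 / 2 * √(σ * (k t - c))) ^ 2 = 1 / 4 * (σ * (k t - c)) := by
        rw [mul_pow, hsq t hm]; norm_num
      rcases energy_near_of_small hy hs with h1 | h1 <;> rw [e1] at h1
      · linarith [hE1 t hm]
      · linarith [hE2 t hm])
    le_rfl (by simp)
  -- Since the clock has derivative `-ε |y|`, the integrand is a constant multiple of the derivative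
  -- of `√(σ * (k - c))`.
  have hint : ∫ t in a..b, |y t| / (1 / 2 * √(σ * (k t - c)))
      = -4 * (σ / ε) * (√(σ * (k b - c)) - √(σ * (k a - c))) := by
    rw [← (hsac.integral_eq_sub (φ := fun t => σ * (-(ε * |y t|)) / (2 * √(σ * (k t - c)))) (by
      rw [h.uIcc_eq]
      exact ae_mem_Icc_of_Ioo (ae_of_all _ hsder))), ← intervalIntegral.integral_const_mul]
    refine integral_congr fun t ht => ?_
    rw [h.uIcc_eq] at ht
    have h2 := hspos t ht
    have h3 : σ * σ = 1 := by rw [← abs_mul_abs_self, hσ]; norm_num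
    field_simp
    linear_combination (-4 * |y t|) * h3
  have hb : |√(σ * (k b - c)) - √(σ * (k a - c))| ≤ √δ := by
    have h1 := Real.sqrt_nonneg (σ * (k a - c))
    have h2 := Real.sqrt_nonneg (σ * (k b - c))
    have h3 := Real.sqrt_le_sqrt (hup a h.left_mem)
    have h4 := Real.sqrt_le_sqrt (hup b h.right_mem)
    rw [abs_le]; constructor <;> linarith
  have hfin : ∫ t in a..b, |y t| / (1 / 2 * √(σ * (k t - c))) ≤ 4 * (√δ / ε) := by
    rw [hint]
    refine (le_abs_self _).trans ?_
    rw [abs_mul, abs_mul, abs_div, hσ, abs_of_pos hε, abs_neg, abs_of_pos (by norm_num : (0:ℝ) < 4)]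
    calc _ ≤ 4 * (1 / ε) * √δ := by gcongr
      _ = _ := by ring
  linarith

/-- Time spent while the clock runs only a little. -/
theorem time_le_core (h : Controlled ε a b x y u) (hk : IsClock ε a b y k) {Z : Set ℝ} {Λ ω : ℝ}
    (hZm : MeasurableSet Z)
    (hZ : ∀ t ∈ Ioo a b, |y t| < 2 * ε → |Real.sin (x t)| < 2 * ε → t ∈ Z)
    (hΛ : 0 ≤ Λ) (hvol : volume (Z ∩ Icc a b) ≤ ENNReal.ofReal Λ) (hω : k a - k b ≤ ω) :
    b - a ≤ 30 + 16 * (ω / ε ^ 2) + 7 * Λ := by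
  have hε := h.eps_pos
  -- At the smallest admissible scale the neighbourhood is the standstill zone itself.
  have hres := h.residence_le (r := fun _ => 2 * ε) (r' := fun _ => 0) (fun _ _ => le_rfl)
    (contDiff_const (n := 1)).contDiffOn.absolutelyContinuousOnInterval
    (fun t _ => hasDerivAt_const t _) (fun t _ => by simp) hZm hZ hΛ hvol
  have h1 := hk a h.left_mem b h.right_mem
  rw [intervalIntegral.integral_div] at hres
  have h2 : ∫ t in a..b, |y t| ≤ ω / ε := by rw [le_div_iff₀ hε]; linarith
  have h3 : (∫ t in a..b, |y t|) / (2 * ε) ≤ 1 / 2 * (ω / ε ^ 2) := by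
    calc _ ≤ (ω / ε) / (2 * ε) := by gcongr
      _ = _ := by field_simp
  have h4 : 0 ≤ ω / ε ^ 2 := div_nonneg (le_trans (by
    linarith [hk.antitone hε h.left_mem h.right_mem h.le]) hω) (by positivity)
  linarith

end Controlled

/-! ### Averaging tools -/

/-- At most `(b - a) / S + 1` windows of length `S` are needed. A bounded error per window thus
becomes a relative error `C / S`, small for long windows. -/
theorem abs_sub_le_of_windows {f : ℝ → ℝ} {a b C κ S : ℝ} (hS : 0 < S) (hC : 0 ≤ C) (hab : a ≤ b)
    (h : ∀ s t, a ≤ s → s ≤ t → t ≤ b → t - s ≤ S → |f t - f s| ≤ C + κ * (t - s)) :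
    |f b - f a| ≤ (C / S + κ) * (b - a) + C := by
  have key : ∀ n : ℕ, ∀ t, a ≤ t → t ≤ b → t - a ≤ n * S → |f t - f a| ≤ n * C + κ * (t - a) := by
    intro n
    induction n with
    | zero =>
      intro t h1 _ h3
      have : t = a := by push_cast at h3; linarith
      simp [this]
    | succ n ih =>
      intro t h1 h2 h3
      push_cast at h3 ⊢
      rcases le_total (t - a) S with h4 | h4
      · have := h a t le_rfl h1 h2 h4
        have : 0 ≤ (n : ℝ) * C := by positivity
        linarith
      · have e1 := ih (t - S) (by linarith) (by linarith) (by linarith)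
        have e2 := h (t - S) t (by linarith) (by linarith) h2 (by linarith)
        have e3 := abs_sub_le (f t) (f (t - S)) (f a)
        linarith
  have h1 := key ⌈(b - a) / S⌉₊ b hab le_rfl (by
    rw [← div_le_iff₀ hS]; exact Nat.le_ceil _)
  have h2 := (Nat.ceil_lt_add_one (div_nonneg (sub_nonneg.2 hab) hS.le)).le
  calc _ ≤ _ := h1
    _ ≤ ((b - a) / S + 1) * C + κ * (b - a) := by gcongr
    _ = _ := by ring

theorem _root_.AbsolutelyContinuousOnInterval.abs_sub_le {f : ℝ → ℝ} {a b c : ℝ} (hab : a ≤ b)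
    (hf : AbsolutelyContinuousOnInterval f a b)
    (h : ∀ᵐ t, t ∈ Icc a b → ∃ d, HasDerivAt f d t ∧ |d| ≤ c) : |f b - f a| ≤ c * (b - a) := by
  have h1 := hf.sub_le_integral hab (φ := fun _ => c) intervalIntegrable_const (by
    filter_upwards [h] with t ht hm
    obtain ⟨d, hd, hc⟩ := ht hm
    exact ⟨d, hd, (le_abs_self d).trans hc⟩)
  have h2 := hf.fun_neg.sub_le_integral hab (φ := fun _ => c) intervalIntegrable_const (by
    filter_upwards [h] with t ht hm
    obtain ⟨d, hd, hc⟩ := ht hm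
    exact ⟨-d, hd.fun_neg, (neg_le_abs d).trans hc⟩)
  simp only [intervalIntegral.integral_const, smul_eq_mul] at h1 h2
  rw [abs_le]; constructor <;> linarith

theorem contDiff_integral {g : ℝ → ℝ} (hg : Continuous g) (c : ℝ) :
    ContDiff ℝ 1 (fun t => ∫ r in c..t, g r) := by
  have hd : ∀ t, HasDerivAt (fun t => ∫ r in c..t, g r) (g t) t := fun t =>
    hg.integral_hasStrictDerivAt c t |>.hasDerivAt
  rw [contDiff_one_iff_deriv]
  refine ⟨fun t => (hd t).differentiableAt, ?_⟩
  rwa [show deriv (fun t => ∫ r in c..t, g r) = g from funext fun t => (hd t).deriv]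

/-- Zero mean makes the primitive periodic, so one period bounds it. This primitive is the corrector
of the averaging arguments. -/
theorem abs_integral_le_of_periodic {g : ℝ → ℝ} {P M : ℝ} (hP : 0 < P) (hg : Continuous g)
    (hper : Function.Periodic g P) (h0 : ∫ r in (0 : ℝ)..P, g r = 0) (hM : ∀ r, |g r| ≤ M) (t : ℝ) :
    |∫ r in (0 : ℝ)..t, g r| ≤ M * P := by
  have hG : Function.Periodic (fun t => ∫ r in (0 : ℝ)..t, g r) P := fun t => by
    beta_reduce
    rw [← intervalIntegral.integral_add_adjacent_intervals (b := t)
      (hg.intervalIntegrable _ _) (hg.intervalIntegrable _ _), hper.intervalIntegral_add_eq t 0,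
      zero_add, h0, add_zero]
  obtain ⟨s, hs, hst⟩ := hG.exists_mem_Ico₀ hP t
  rw [hst]
  have h1 : ‖∫ r in (0 : ℝ)..s, g r‖ ≤ M * |s - 0| :=
    intervalIntegral.norm_integral_le_of_norm_le_const fun r _ => hM r
  rw [Real.norm_eq_abs, sub_zero, abs_of_nonneg hs.1] at h1
  have hM0 : 0 ≤ M := (abs_nonneg _).trans (hM 0)
  exact h1.trans (by gcongr; exact hs.2.le)

/-! ### The angular variable below the separatrix -/

/-- The energy as a function of the coordinates. -/
def en (x y : ℝ) : ℝ := y ^ 2 / 2 + (1 - Real.cos x)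

theorem two_mul_en (x y : ℝ) : 2 * en x y = (2 * Real.sin (x / 2)) ^ 2 + y ^ 2 := by
  have h1 := Real.cos_sq' (x / 2)
  have h2 := Real.cos_sq (x / 2)
  rw [mul_div_cancel₀ x two_ne_zero] at h2
  unfold en; nlinarith

theorem en_nonneg (x y : ℝ) : 0 ≤ en x y := by
  have := two_mul_en x y
  nlinarith [sq_nonneg (2 * Real.sin (x / 2)), sq_nonneg y]

namespace Controlled

variable {ε a b : ℝ} {x y u : ℝ → ℝ}

theorem ac_en (h : Controlled ε a b x y u) :
    AbsolutelyContinuousOnInterval (fun t => en (x t) (y t)) a b :=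
  (h.ac_vel.comp_contDiff (φ := fun v => v ^ 2 / 2) (by fun_prop)).add
    (h.ac_angle.comp_contDiff (φ := fun v => 1 - Real.cos v) (contDiff_const.sub Real.contDiff_cos))

theorem hasDerivAt_en {t v : ℝ} (h1 : HasDerivAt x (y t) t)
    (h2 : HasDerivAt y (-Real.sin (x t) + ε * v) t) :
    HasDerivAt (fun t => en (x t) (y t)) (ε * (v * y t)) t := by
  refine (((h2.fun_pow 2).div_const 2).add ((h1.cos).const_sub 1)).congr_deriv ?_
  push_cast
  ring

theorem cont_en (h : Controlled ε a b x y u) :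
    ContinuousOn (fun t => en (x t) (y t)) (Icc a b) := h.uIcc_eq ▸ h.ac_en.continuousOn

/-- Below the separatrix the motion stays in one potential well. -/
theorem exists_well (h : Controlled ε a b x y u) (hE : ∀ t ∈ Icc a b, en (x t) (y t) < 2) :
    ∃ n : ℤ, ∀ t ∈ Icc a b, |x t + n * (2 * Real.pi)| < Real.pi := by
  -- A well can only be left through an odd multiple of `π`, where the potential energy alone is
  -- `2`.
  have hcos : ∀ t ∈ Icc a b, ∀ n : ℤ, |x t + n * (2 * Real.pi)| ≠ Real.pi := by
    intro t ht n hn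
    have h1 := hE t ht
    have h2 : Real.cos (x t) = -1 := by
      rw [← Real.cos_add_int_mul_two_pi (x t) n, ← Real.cos_abs, hn, Real.cos_pi]
    unfold en at h1
    rw [h2] at h1
    nlinarith [sq_nonneg (y t)]
  refine ⟨-toIocDiv Real.two_pi_pos (-Real.pi) (x a), fun t ht => ?_⟩
  set n : ℤ := -toIocDiv Real.two_pi_pos (-Real.pi) (x a)
  have ha : |x a + n * (2 * Real.pi)| < Real.pi := by
    have h1 := toIocMod_mem_Ioc Real.two_pi_pos (-Real.pi) (x a)
    have h2 : x a + n * (2 * Real.pi) = toIocMod Real.two_pi_pos (-Real.pi) (x a) := by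
      rw [← self_sub_toIocDiv_zsmul Real.two_pi_pos (-Real.pi) (x a), zsmul_eq_mul]
      simp only [n]
      push_cast
      ring
    refine lt_of_le_of_ne ?_ (hcos a h.left_mem n)
    rw [h2, abs_le]
    exact ⟨h1.1.le, by linarith [h1.2]⟩
  by_contra! hc
  have hcont : ContinuousOn (fun t => |x t + n * (2 * Real.pi)|) (Icc a t) :=
    ((h.cont_angle.mono (Icc_subset_Icc le_rfl ht.2)).add continuousOn_const).abs
  obtain ⟨s, hs, hs'⟩ := intermediate_value_Icc ht.1 hcont ⟨ha.le, hc⟩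
  exact hcos s ⟨hs.1, hs.2.trans ht.2⟩ n hs'

/-- A continuous choice of the polar angle of `(y, 2 sin (x / 2))`. -/
theorem exists_polar (h : Controlled ε a b x y u) (hE : ∀ t ∈ Icc a b, 0 < en (x t) (y t)) :
    ∃ θ : ℝ → ℝ, AbsolutelyContinuousOnInterval θ a b ∧
      (∀ t ∈ Icc a b, 2 * Real.sin (x t / 2) = √(2 * en (x t) (y t)) * Real.sin (θ t) ∧
        y t = √(2 * en (x t) (y t)) * Real.cos (θ t)) ∧
      ∀ᵐ t, t ∈ Icc a b → HasDerivAt θ (Real.cos (x t / 2)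
        - ε * u t * (2 * Real.sin (x t / 2)) / (2 * en (x t) (y t))) t := by
  set X : ℝ → ℝ := fun t => 2 * Real.sin (x t / 2) with hX
  set w : ℝ → ℝ := fun t => Real.cos (x t / 2) - ε * u t * X t / (2 * en (x t) (y t)) with hw
  have hXc : ContinuousOn X (Icc a b) :=
    continuousOn_const.mul (Real.continuous_sin.comp_continuousOn (h.cont_angle.div_const 2))
  have hwint : IntervalIntegrable w volume a b := by
    refine IntervalIntegrable.sub ?_ ?_
    · refine ContinuousOn.intervalIntegrable ?_
      rw [h.uIcc_eq]
      exact Real.continuous_cos.comp_continuousOn (h.cont_angle.div_const 2)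
    · have h1 := (h.integrable_control.const_mul ε).mul_continuousOn
        (g := fun t => X t / (2 * en (x t) (y t))) (by
          rw [h.uIcc_eq]
          exact hXc.div (continuousOn_const.mul h.cont_en) fun t ht => by
            have := hE t ht; positivity)
      exact h1.congr (fun t _ => by ring)
  set z : ℂ := ⟨y a, X a⟩ with hz
  -- Instead of lifting the argument continuously, its expected derivative is integrated from the
  -- initial argument. The expressions in `hVac` and `hWac` are the sine and cosine of the
  -- discrepancy from the true polar angle; they have derivative zero, hence stay `0` and `1`.
  set θ : ℝ → ℝ := fun t => z.arg + ∫ r in a..t, w r with hθ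
  have hcst : AbsolutelyContinuousOnInterval (fun _ : ℝ => z.arg) a b :=
    (contDiff_const (n := 1)).contDiffOn.absolutelyContinuousOnInterval
  have hθac : AbsolutelyContinuousOnInterval θ a b :=
    hcst.fun_add (hwint.absolutelyContinuousOnInterval_intervalIntegral left_mem_uIcc)
  have hθd : ∀ᵐ t, t ∈ Icc a b → HasDerivAt θ (w t) t := by
    filter_upwards [hwint.ae_hasDerivAt_integral] with t ht hm
    exact (ht (h.uIcc_eq ▸ hm) a left_mem_uIcc).const_add _
  have hD : ∀ t, 2 * en (x t) (y t) = X t ^ 2 + y t ^ 2 := fun t => two_mul_en _ _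
  have hEac : AbsolutelyContinuousOnInterval (fun t => (√(2 * en (x t) (y t)))⁻¹) a b :=
    ((h.ac_en.const_mul 2).sqrt (by
      rw [h.uIcc_eq]; intro t ht; have := hE t ht; positivity)).inv₀ (by
      rw [h.uIcc_eq]; intro t ht; have := hE t ht; positivity)
  have hXac : AbsolutelyContinuousOnInterval X a b :=
    h.ac_angle.comp_contDiff (φ := fun v => 2 * Real.sin (v / 2)) (by
      exact contDiff_const.mul (Real.contDiff_sin.comp (contDiff_id.div_const 2)))
  have hsin := hθac.comp_contDiff (Real.contDiff_sin (n := 1))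
  have hcos := hθac.comp_contDiff (Real.contDiff_cos (n := 1))
  have hVac := ((hXac.fun_mul hcos).fun_sub (h.ac_vel.fun_mul hsin)).fun_mul hEac
  have hWac := ((h.ac_vel.fun_mul hcos).fun_add (hXac.fun_mul hsin)).fun_mul hEac
  have hder : ∀ᵐ t, t ∈ uIcc a b →
      HasDerivAt (fun t => (X t * Real.cos (θ t) - y t * Real.sin (θ t)) *
        (√(2 * en (x t) (y t)))⁻¹) 0 t ∧
      HasDerivAt (fun t => (y t * Real.cos (θ t) + X t * Real.sin (θ t)) *
        (√(2 * en (x t) (y t)))⁻¹) 0 t := by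
    rw [h.uIcc_eq]
    filter_upwards [hθd, h.ae_hasDerivAt] with t h1 h2 hm
    replace h1 := h1 hm
    obtain ⟨h2, h3⟩ := h2 hm
    have hE0 := hE t hm
    have h4 : HasDerivAt X (Real.cos (x t / 2) * y t) t :=
      ((h2.div_const 2).sin.const_mul 2).congr_deriv (by ring)
    have hs0 : 0 < √(2 * en (x t) (y t)) := by positivity
    have h5 : HasDerivAt (fun t => (√(2 * en (x t) (y t)))⁻¹)
        (-(ε * u t * y t / (2 * en (x t) (y t))) * (√(2 * en (x t) (y t)))⁻¹) t := by
      refine ((((hasDerivAt_en h2 h3).const_mul 2).sqrt (by positivity)).fun_inv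
        hs0.ne').congr_deriv ?_
      rw [Real.sq_sqrt (by positivity)]
      field_simp
    have h6 : Real.sin (x t) = X t * Real.cos (x t / 2) := by
      rw [hX]; simp only
      rw [← Real.sin_two_mul]; congr 1; ring
    have hD0 : X t ^ 2 + y t ^ 2 ≠ 0 := by rw [← hD]; positivity
    constructor
    · refine ((((h4.fun_mul h1.cos).fun_sub (h3.fun_mul h1.sin)).fun_mul h5)).congr_deriv ?_
      rw [hw, h6]; simp only
      generalize (√(2 * en (x t) (y t)))⁻¹ = q
      rw [hD]
      field_simp
      ring
    · refine ((((h3.fun_mul h1.cos).fun_add (h4.fun_mul h1.sin)).fun_mul h5)).congr_deriv ?_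
      rw [hw, h6]; simp only
      generalize (√(2 * en (x t) (y t)))⁻¹ = q
      rw [hD]
      field_simp
      ring
  obtain ⟨c1, hc1⟩ := hVac.const_of_ae_hasDerivAt_zero (by
    filter_upwards [hder] with t ht hm using (ht hm).1)
  obtain ⟨c2, hc2⟩ := hWac.const_of_ae_hasDerivAt_zero (by
    filter_upwards [hder] with t ht hm using (ht hm).2)
  rw [h.uIcc_eq] at hc1 hc2
  have hza : ‖z‖ = √(2 * en (x a) (y a)) := by
    rw [hD, Complex.norm_eq_sqrt_sq_add_sq, add_comm]
  have hθa : θ a = z.arg := by simp [hθ]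
  have hXa : X a = √(2 * en (x a) (y a)) * Real.sin (θ a) := by
    rw [← hza, hθa, Complex.norm_mul_sin_arg]
  have hya : y a = √(2 * en (x a) (y a)) * Real.cos (θ a) := by
    rw [← hza, hθa, Complex.norm_mul_cos_arg]
  have hsa : 0 < √(2 * en (x a) (y a)) := by have := hE a h.left_mem; positivity
  have e1 : c1 = 0 := by
    rw [← hc1 a h.left_mem]
    have : X a * Real.cos (θ a) - y a * Real.sin (θ a) = 0 := by
      linear_combination Real.cos (θ a) * hXa - Real.sin (θ a) * hya
    rw [this, zero_mul]
  have e2 : c2 = 1 := by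
    rw [← hc2 a h.left_mem]
    have : y a * Real.cos (θ a) + X a * Real.sin (θ a) = √(2 * en (x a) (y a)) := by
      have hcs := Real.sin_sq_add_cos_sq (θ a)
      calc _ = √(2 * en (x a) (y a)) * Real.cos (θ a) * Real.cos (θ a)
            + √(2 * en (x a) (y a)) * Real.sin (θ a) * Real.sin (θ a) := by rw [← hXa, ← hya]
        _ = √(2 * en (x a) (y a)) := by linear_combination √(2 * en (x a) (y a)) * hcs
    rw [this, mul_inv_cancel₀ hsa.ne']
  refine ⟨θ, hθac, fun t ht => ?_, hθd⟩
  have hst : 0 < √(2 * en (x t) (y t)) := by have := hE t ht; positivity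
  have f1 := hc1 t ht
  have f2 := hc2 t ht
  rw [e1, mul_inv_eq_iff_eq_mul₀ hst.ne', zero_mul] at f1
  rw [e2, mul_inv_eq_iff_eq_mul₀ hst.ne', one_mul] at f2
  have hcs := Real.sin_sq_add_cos_sq (θ t)
  constructor
  · change X t = _
    linear_combination (-X t) * hcs + Real.cos (θ t) * f1 + Real.sin (θ t) * f2
  · linear_combination (-y t) * hcs - Real.sin (θ t) * f1 + Real.cos (θ t) * f2

end Controlled

/-! ### Averaging below the separatrix -/

/-- The time density with respect to the polar angle on the orbit of energy `b < 2`. -/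
def kernelLow (b φ : ℝ) : ℝ := 1 / √(1 - b / 2 * Real.sin φ ^ 2)

/-- The quotient of time and path length on the orbit of energy `b < 2`. -/
def rateLow (b : ℝ) : ℝ := (∫ φ in (0 : ℝ)..Real.pi, kernelLow b φ) / (2 * Real.arccos (1 - b))

theorem abs_sqrt_sub_sqrt_le {p q : ℝ} (hp : 0 < p) (hq : 0 ≤ q) :
    |√p - √q| ≤ |p - q| / √p := by
  have h1 : 0 < √p := Real.sqrt_pos.2 hp
  have h2 := Real.sqrt_nonneg q
  rw [le_div_iff₀ h1]
  have h3 : p - q = (√p - √q) * (√p + √q) := by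
    have e1 := Real.sq_sqrt hp.le
    have e2 := Real.sq_sqrt hq
    linear_combination -e1 + e2
  rw [h3, abs_mul, abs_of_pos (by linarith : 0 < √p + √q)]
  gcongr
  linarith

section

variable {b : ℝ}

theorem radicand_pos (hb : b ∈ Ioo (0 : ℝ) 2) (φ : ℝ) : 1 - b / 2 ≤ 1 - b / 2 * Real.sin φ ^ 2 := by
  have := Real.sin_sq_le_one φ
  nlinarith [hb.1]

theorem radicand_pos' (hb : b ∈ Ioo (0 : ℝ) 2) (φ : ℝ) : 0 < 1 - b / 2 * Real.sin φ ^ 2 :=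
  lt_of_lt_of_le (by linarith [hb.2]) (radicand_pos hb φ)

theorem continuous_kernelLow (hb : b ∈ Ioo (0 : ℝ) 2) : Continuous (kernelLow b) := by
  refine continuous_const.div (by fun_prop) fun φ => ?_
  have := radicand_pos' hb φ
  positivity

theorem kernelLow_pos (hb : b ∈ Ioo (0 : ℝ) 2) (φ : ℝ) : 0 < kernelLow b φ := by
  have := radicand_pos' hb φ
  unfold kernelLow; positivity

theorem kernelLow_le (hb : b ∈ Ioo (0 : ℝ) 2) (φ : ℝ) : kernelLow b φ ≤ 1 / √(1 - b / 2) := by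
  have h1 := radicand_pos hb φ
  have h2 : 0 < 1 - b / 2 := by linarith [hb.2]
  unfold kernelLow
  gcongr

theorem sin_half_arccos (hb : b ∈ Icc (0 : ℝ) 2) :
    Real.sin (Real.arccos (1 - b) / 2) = √(b / 2) := by
  rw [Real.sin_half_eq_sqrt (Real.arccos_nonneg _)
    (by linarith [Real.arccos_le_pi (1 - b), Real.pi_pos]),
    Real.cos_arccos (by linarith [hb.2]) (by linarith [hb.1])]
  congr 1; ring

/-- This is `sin s ≤ s` at half the amplitude. -/
theorem sqrt_le_arccos (hb : b ∈ Icc (0 : ℝ) 2) : √(2 * b) ≤ Real.arccos (1 - b) := by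
  have h1 := sin_half_arccos hb
  have h2 := Real.sin_le (div_nonneg (Real.arccos_nonneg (1 - b)) zero_le_two)
  rw [h1] at h2
  have h3 : √(2 * b) = 2 * √(b / 2) := by
    rw [show 2 * b = 2 ^ 2 * (b / 2) by ring, Real.sqrt_mul (by positivity),
      Real.sqrt_sq (by positivity)]
  linarith

theorem arcsin_sqrt_half (hb : b ∈ Icc (0 : ℝ) 2) :
    2 * Real.arcsin √(b / 2) = Real.arccos (1 - b) := by
  rw [← sin_half_arccos hb, Real.arcsin_sin]
  · ring
  · linarith [Real.arccos_nonneg (1 - b), Real.pi_pos]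
  · linarith [Real.arccos_le_pi (1 - b)]

/-- The primitive `2 arcsin (√(b / 2) sin φ)` is the angle of the pendulum as a function of the
polar angle. The integral is therefore the path length of half an oscillation, twice the amplitude.
-/
theorem integral_abs_cos_mul_kernelLow (hb : b ∈ Ioo (0 : ℝ) 2) :
    ∫ φ in (0 : ℝ)..Real.pi, √(2 * b) * |Real.cos φ| * kernelLow b φ
      = 2 * Real.arccos (1 - b) := by
  have hb' : b ∈ Icc (0 : ℝ) 2 := Ioo_subset_Icc_self hb
  have hcont : Continuous fun φ => √(2 * b) * |Real.cos φ| * kernelLow b φ :=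
    (continuous_const.mul Real.continuous_cos.abs).mul (continuous_kernelLow hb)
  have hder : ∀ φ, HasDerivAt (fun φ => 2 * Real.arcsin (√(b / 2) * Real.sin φ))
      (√(2 * b) * Real.cos φ * kernelLow b φ) φ := by
    intro φ
    have hr := radicand_pos' hb φ
    have e1 : (√(b / 2) * Real.sin φ) ^ 2 = b / 2 * Real.sin φ ^ 2 := by
      rw [mul_pow, Real.sq_sqrt (by linarith [hb.1])]
    have habs : |√(b / 2) * Real.sin φ| < 1 := by
      rw [← sq_lt_one_iff_abs_lt_one, e1]; linarith
    rw [abs_lt] at habs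
    have h1 := (Real.hasDerivAt_arcsin habs.1.ne' habs.2.ne).comp φ
      ((Real.hasDerivAt_sin φ).const_mul √(b / 2))
    refine (h1.const_mul 2).congr_deriv ?_
    have h3 : √(2 * b) = 2 * √(b / 2) := by
      rw [show 2 * b = 2 ^ 2 * (b / 2) by ring, Real.sqrt_mul (by positivity),
        Real.sqrt_sq (by positivity)]
    rw [e1, h3, kernelLow]
    ring
  have hpi := Real.pi_pos
  rw [← intervalIntegral.integral_add_adjacent_intervals (b := Real.pi / 2)
    (hcont.intervalIntegrable _ _) (hcont.intervalIntegrable _ _)]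
  have hcont2 : Continuous fun φ => √(2 * b) * Real.cos φ * kernelLow b φ :=
    (continuous_const.mul Real.continuous_cos).mul (continuous_kernelLow hb)
  have i1 : ∫ φ in (0 : ℝ)..Real.pi / 2, √(2 * b) * |Real.cos φ| * kernelLow b φ
      = Real.arccos (1 - b) := by
    rw [← arcsin_sqrt_half hb']
    have := integral_eq_sub_of_hasDerivAt (a := 0) (b := Real.pi / 2) (fun φ _ => hder φ)
      (hcont2.intervalIntegrable _ _)
    simp only [Real.sin_pi_div_two, Real.sin_zero, mul_zero, mul_one, Real.arcsin_zero,
      sub_zero] at this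
    rw [← this]
    refine integral_congr fun φ hφ => ?_
    rw [uIcc_of_le (by linarith)] at hφ
    rw [abs_of_nonneg (Real.cos_nonneg_of_mem_Icc ⟨by linarith [hφ.1], hφ.2⟩)]
  have i2 : ∫ φ in Real.pi / 2..Real.pi, √(2 * b) * |Real.cos φ| * kernelLow b φ
      = Real.arccos (1 - b) := by
    rw [← arcsin_sqrt_half hb']
    have := integral_eq_sub_of_hasDerivAt (a := Real.pi / 2) (b := Real.pi) (fun φ _ => hder φ)
      (hcont2.intervalIntegrable _ _)
    simp only [Real.sin_pi_div_two, Real.sin_pi, mul_zero, mul_one, Real.arcsin_zero,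
      zero_sub] at this
    rw [← neg_eq_iff_eq_neg, ← intervalIntegral.integral_neg] at this
    rw [← this]
    refine integral_congr fun φ hφ => ?_
    rw [uIcc_of_le (by linarith)] at hφ
    rw [abs_of_nonpos (Real.cos_nonpos_of_pi_div_two_le_of_le hφ.1 (by linarith [hφ.2]))]
    ring
  rw [i1, i2]; ring

theorem arccos_pos_of_mem (hb : b ∈ Ioo (0 : ℝ) 2) : 0 < Real.arccos (1 - b) :=
  Real.arccos_pos.2 (by linarith [hb.1])

theorem integral_kernelLow_le (hb : b ∈ Ioo (0 : ℝ) 2) :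
    ∫ φ in (0 : ℝ)..Real.pi, kernelLow b φ ≤ Real.pi * (1 / √(1 - b / 2)) := by
  have h1 : ∫ φ in (0 : ℝ)..Real.pi, kernelLow b φ
      ≤ ∫ φ in (0 : ℝ)..Real.pi, 1 / √(1 - b / 2) :=
    integral_mono_on Real.pi_pos.le ((continuous_kernelLow hb).intervalIntegrable _ _)
      intervalIntegrable_const fun φ _ => kernelLow_le hb φ
  simpa using h1

theorem integral_kernelLow_nonneg (hb : b ∈ Ioo (0 : ℝ) 2) :
    0 ≤ ∫ φ in (0 : ℝ)..Real.pi, kernelLow b φ :=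
  integral_nonneg Real.pi_pos.le fun φ _ => (kernelLow_pos hb φ).le

theorem rateLow_nonneg (hb : b ∈ Ioo (0 : ℝ) 2) : 0 ≤ rateLow b :=
  div_nonneg (integral_kernelLow_nonneg hb) (by linarith [arccos_pos_of_mem hb])

theorem rateLow_mul_sqrt_le (hb : b ∈ Ioo (0 : ℝ) 2) :
    rateLow b * √(2 * b) ≤ Real.pi * (1 / √(1 - b / 2)) / 2 := by
  have h0 := arccos_pos_of_mem hb
  have h1 := sqrt_le_arccos (Ioo_subset_Icc_self hb)
  have h2 := integral_kernelLow_le hb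
  have h3 := integral_kernelLow_nonneg hb
  rw [rateLow, div_mul_eq_mul_div, div_le_div_iff₀ (by linarith) two_pos]
  have h4 : 0 ≤ √(2 * b) := Real.sqrt_nonneg _
  have h5 : 0 ≤ Real.pi * (1 / √(1 - b / 2)) := h3.trans h2
  nlinarith [mul_le_mul h2 h1 h4 h5]

end

/-- On a time interval on which the energy stays close to `β < 2`, the time is `rateLow β` times
the length of the path, up to a bounded error and a small relative error. -/
theorem window_low {δ : ℝ} (hδ : 0 < δ) : ∃ C, 0 ≤ C ∧
    ∀ {ε a b β ω : ℝ} {x y u : ℝ → ℝ}, Controlled ε a b x y u → β ∈ Icc δ (2 - δ) →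
      (∀ t ∈ Icc a b, en (x t) (y t) ∈ Icc δ (2 - δ) ∧ |en (x t) (y t) - β| ≤ ω) →
      |(b - a) - rateLow β * (∫ t in a..b, |y t|)| ≤ C + C * (ω + ε) * (b - a) := by
  set K : ℝ := 1 / √(δ / 2) with hK
  set M : ℝ := 1 + Real.pi * K / 2 with hM
  have hK0 : 0 < K := by positivity
  have hpi := Real.pi_pos
  have hM0 : 0 < M := by positivity
  refine ⟨(K ^ 2 / 2 + K / δ) * M + Real.pi * K / (2 * δ) + 2 * (K * M * Real.pi),
    by positivity, ?_⟩
  intro ε a b β ω x y u h hβ hE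
  have hε := h.eps_pos
  have hβ' : β ∈ Ioo (0 : ℝ) 2 := ⟨by linarith [hβ.1], by linarith [hβ.2]⟩
  have hKβ : 1 / √(1 - β / 2) ≤ K := by
    rw [hK]; gcongr; linarith [hβ.2]
  have hker : ∀ φ, kernelLow β φ ≤ K := fun φ => (kernelLow_le hβ' φ).trans hKβ
  have hr0 := rateLow_nonneg hβ'
  have hs0 : 0 < √(2 * β) := by have := hβ'.1; positivity
  have hrs : rateLow β * √(2 * β) ≤ Real.pi * K / 2 :=
    (rateLow_mul_sqrt_le hβ').trans (by gcongr)
  obtain ⟨n, hn⟩ := h.exists_well fun t ht => by linarith [(hE t ht).1.2]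
  set x' : ℝ → ℝ := fun t => x t + n * (2 * Real.pi)
  have h' : Controlled ε a b x' y u := h.shift fun r => Real.sin_add_int_mul_two_pi r n
  have hen : ∀ t, en (x' t) (y t) = en (x t) (y t) := fun t => by
    simp only [en, x', Real.cos_add_int_mul_two_pi]
  simp only [← hen] at hE
  obtain ⟨θ, hθac, hθ, hθd⟩ := h'.exists_polar fun t ht => by linarith [(hE t ht).1.1]
  -- Time minus `rateLow β` times path length, per unit of polar angle on the orbit of energy `β`.
  -- The definition of `rateLow` is exactly what makes its mean vanish.
  set g : ℝ → ℝ := fun φ => kernelLow β φ * (1 - rateLow β * √(2 * β) * |Real.cos φ|) with hg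
  have hgc : Continuous g :=
    (continuous_kernelLow hβ').mul (continuous_const.sub (continuous_const.mul
      Real.continuous_cos.abs))
  have hfac : ∀ φ, |1 - rateLow β * √(2 * β) * (|Real.cos φ|)| ≤ M := fun φ => by
    have h1 := Real.abs_cos_le_one φ
    have h2 := abs_nonneg (Real.cos φ)
    have h3 : 0 ≤ rateLow β * √(2 * β) := by positivity
    rw [abs_le]; constructor <;> nlinarith
  have hgM : ∀ φ, |g φ| ≤ K * M := fun φ => by
    rw [hg, abs_mul, abs_of_pos (kernelLow_pos hβ' φ)]
    exact mul_le_mul (hker φ) (hfac φ) (abs_nonneg _) hK0.le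
  have hgper : Function.Periodic g Real.pi := fun φ => by
    simp only [hg, kernelLow, Real.sin_add_pi, Real.cos_add_pi, abs_neg, neg_sq]
  have hg0 : ∫ φ in (0 : ℝ)..Real.pi, g φ = 0 := by
    have h1 : ∀ φ, g φ = kernelLow β φ
        - rateLow β * (√(2 * β) * |Real.cos φ| * kernelLow β φ) := fun φ => by
      simp only [hg]; ring
    simp_rw [h1]
    have hc2 : Continuous fun φ => √(2 * β) * |Real.cos φ| * kernelLow β φ :=
      (continuous_const.mul Real.continuous_cos.abs).mul (continuous_kernelLow hβ')
    rw [intervalIntegral.integral_sub ((continuous_kernelLow hβ').intervalIntegrable _ _)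
      ((hc2.intervalIntegrable _ _).const_mul _),
      intervalIntegral.integral_const_mul, integral_abs_cos_mul_kernelLow hβ', rateLow]
    have := arccos_pos_of_mem hβ'
    field_simp
    ring
  have hG := abs_integral_le_of_periodic hpi hgc hgper hg0 hgM
  have hGac := hθac.comp_contDiff (contDiff_integral hgc 0)
  have hAac := h.integrable_abs_vel.absolutelyContinuousOnInterval_intervalIntegral (c := a)
    left_mem_uIcc
  have hA' : ∀ᵐ t, t ∈ Icc a b → HasDerivAt (fun t => ∫ r in a..t, |y r|) (|y t|) t := by
    filter_upwards [h.integrable_abs_vel.ae_hasDerivAt_integral] with t ht hm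
    exact ht (h.uIcc_eq ▸ hm) a left_mem_uIcc
  have hfin := AbsolutelyContinuousOnInterval.abs_sub_le h.le
    (((contDiff_id.contDiffOn.absolutelyContinuousOnInterval).fun_sub
      (hAac.const_mul (rateLow β))).fun_sub hGac)
    (c := ((K ^ 2 / 2 + K / δ) * M + Real.pi * K / (2 * δ)) * (ω + ε)) (by
      filter_upwards [hθd, hA'] with t h1 h2 hm
      obtain ⟨⟨hE1, hE2⟩, hE3⟩ := hE t hm
      refine ⟨_, ((hasDerivAt_id t).sub ((h2 hm).const_mul _)).sub
        ((hgc.integral_hasStrictDerivAt 0 (θ t)).hasDerivAt.comp t (h1 hm)), ?_⟩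
      obtain ⟨e1, e2⟩ := hθ t hm
      rw [e1]
      set E := en (x' t) (y t)
      have hE0 : 0 < E := hδ.trans_le hE1
      have hω : 0 ≤ ω := (abs_nonneg _).trans hE3
      have hq : 0 ≤ 1 - E / 2 * Real.sin (θ t) ^ 2 := by
        have := Real.sin_sq_le_one (θ t)
        nlinarith
      -- The translation into the well `|x'| < π` is needed here: it makes the cosine positive,
      -- hence determined by its square.
      have hcosx : Real.cos (x' t / 2) = √(1 - E / 2 * Real.sin (θ t) ^ 2) := by
        have hx := abs_lt.1 (hn t hm)
        have h3 := Real.sin_sq_add_cos_sq (x' t / 2)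
        have h4 : Real.sin (x' t / 2) ^ 2 = E / 2 * Real.sin (θ t) ^ 2 := by
          have : (2 * Real.sin (x' t / 2)) ^ 2 = 2 * E * Real.sin (θ t) ^ 2 := by
            rw [e1, mul_pow, Real.sq_sqrt (by positivity)]
          linarith
        rw [← Real.sqrt_sq (Real.cos_pos_of_mem_Ioo ⟨by linarith [hx.1], by linarith [hx.2]⟩).le]
        congr 1
        linarith
      have hyabs : |y t| = √(2 * E) * |Real.cos (θ t)| := by
        rw [e2, abs_mul, abs_of_nonneg (Real.sqrt_nonneg _)]
      have hp := radicand_pos' hβ' (θ t)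
      have hk := kernelLow_pos hβ' (θ t)
      have hk1 : kernelLow β (θ t) * √(1 - β / 2 * Real.sin (θ t) ^ 2) = 1 := by
        rw [kernelLow, one_div, inv_mul_cancel₀ (Real.sqrt_pos.2 hp).ne']
      have t1 : |√(1 - β / 2 * Real.sin (θ t) ^ 2) - √(1 - E / 2 * Real.sin (θ t) ^ 2)|
          ≤ K * (ω / 2) := by
        refine (abs_sqrt_sub_sqrt_le hp hq).trans ?_
        rw [div_eq_mul_one_div, mul_comm]
        refine mul_le_mul (hker _) ?_ (abs_nonneg _) hK0.le
        rw [show 1 - β / 2 * Real.sin (θ t) ^ 2 - (1 - E / 2 * Real.sin (θ t) ^ 2)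
          = (E - β) / 2 * Real.sin (θ t) ^ 2 by ring, abs_mul, abs_div, abs_two,
          abs_of_nonneg (sq_nonneg (Real.sin (θ t)))]
        have := Real.sin_sq_le_one (θ t)
        calc _ ≤ ω / 2 * 1 := by gcongr
          _ = _ := by ring
      have t2 : |ε * u t * (√(2 * E) * Real.sin (θ t)) / (2 * E)| ≤ ε / δ := by
        have h5 : |√(2 * E) * Real.sin (θ t)| ≤ 2 := by
          rw [← e1, abs_mul, abs_two]
          linarith [Real.abs_sin_le_one (x' t / 2)]
        rw [abs_div, abs_mul, abs_mul, abs_of_pos hε, abs_of_pos (by positivity : 0 < 2 * E)]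
        calc _ ≤ ε * 1 * 2 / (2 * δ) := by
              gcongr
              exact h.bound t hm
          _ = _ := by field_simp
      have t3 : |√(2 * β) - √(2 * E)| ≤ 2 * ω / √(2 * β) := by
        refine (abs_sqrt_sub_sqrt_le (by linarith [hβ'.1]) (by positivity)).trans ?_
        gcongr
        rw [show 2 * β - 2 * E = -(2 * (E - β)) by ring, abs_neg, abs_mul, abs_two]
        gcongr
      have t4 : rateLow β * |√(2 * β) - √(2 * E)| ≤ Real.pi * K / (2 * δ) * ω := by
        have h6 : rateLow β ≤ Real.pi * K / 2 / √(2 * β) := by rwa [le_div_iff₀ hs0]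
        calc _ ≤ (Real.pi * K / 2 / √(2 * β)) * (2 * ω / √(2 * β)) := by gcongr
          _ = Real.pi * K * ω / (√(2 * β) ^ 2) := by field_simp
          _ = Real.pi * K * ω / (2 * β) := by rw [Real.sq_sqrt (by linarith [hβ'.1])]
          _ ≤ Real.pi * K * ω / (2 * δ) := by gcongr; exact hβ.1
          _ = _ := by ring
      set c := |Real.cos (θ t)|
      have hc0 : 0 ≤ c := abs_nonneg _
      have hc1 : c ≤ 1 := Real.abs_cos_le_one _
      rw [hyabs, hcosx]
      set v := ε * u t * (√(2 * E) * Real.sin (θ t)) / (2 * E)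
      -- The main terms cancel through `hk1`. What remains is due to the mismatch of `E` and `β` and
      -- to the term `v` caused by the control.
      have hsplit : 1 - rateLow β * (√(2 * E) * c)
          - g (θ t) * (√(1 - E / 2 * Real.sin (θ t) ^ 2) - v)
          = kernelLow β (θ t) * ((√(1 - β / 2 * Real.sin (θ t) ^ 2)
            - √(1 - E / 2 * Real.sin (θ t) ^ 2)) + v) * (1 - rateLow β * √(2 * β) * c)
            + rateLow β * (√(2 * β) - √(2 * E)) * c := by
        simp only [hg, c]
        linear_combination (-(1 - rateLow β * √(2 * β) * |Real.cos (θ t)|)) * hk1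
      rw [hsplit]
      refine (abs_add_le _ _).trans ?_
      rw [abs_mul, abs_mul, abs_mul, abs_mul, abs_of_pos hk, abs_of_nonneg hr0, abs_of_nonneg hc0]
      have t5 := abs_add_le (√(1 - β / 2 * Real.sin (θ t) ^ 2)
            - √(1 - E / 2 * Real.sin (θ t) ^ 2)) v
      calc _ ≤ K * (K * (ω / 2) + ε / δ) * M + Real.pi * K / (2 * δ) * ω * 1 := by
            gcongr
            · exact hker _
            · exact t5.trans (add_le_add t1 t2)
            · exact hfac _
        -- Nonnegative terms are added so that `ω` and `ε` get one common coefficient.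
        _ ≤ K * (K * (ω / 2) + ε / δ) * M + Real.pi * K / (2 * δ) * ω * 1
            + (K * (K * (ε / 2) + ω / δ) * M + Real.pi * K / (2 * δ) * ε) :=
          le_add_of_nonneg_right (by positivity)
        _ = _ := by ring)
  simp only [id, intervalIntegral.integral_same, mul_zero, sub_zero] at hfin
  have g1 := hG (θ a)
  have g2 := hG (θ b)
  have hab : 0 ≤ b - a := sub_nonneg.2 h.le
  have hω : 0 ≤ ω := (abs_nonneg _).trans (hE a h.left_mem).2
  rw [abs_le] at g1 g2 hfin ⊢
  have p1 : 0 ≤ ((K ^ 2 / 2 + K / δ) * M + Real.pi * K / (2 * δ)) := by positivity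
  have p2 : 0 ≤ 2 * (K * M * Real.pi) * (ω + ε) * (b - a) := by positivity
  constructor <;> nlinarith

/-! ### Averaging above the separatrix -/

/-- The time density with respect to the angle on the orbit of energy `b > 2`. -/
def kernelHigh (b φ : ℝ) : ℝ := 1 / √(2 * (b - 1 + Real.cos φ))

/-- The quotient of time and path length on the orbit of energy `b > 2`. -/
def rateHigh (b : ℝ) : ℝ := 1 / (2 * Real.pi) * ∫ φ in (0 : ℝ)..2 * Real.pi, kernelHigh b φ

section

variable {b : ℝ}

theorem radicandHigh_le (φ : ℝ) : 2 * (b - 2) ≤ 2 * (b - 1 + Real.cos φ) := by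
  linarith [Real.neg_one_le_cos φ]

theorem continuous_kernelHigh (hb : 2 < b) : Continuous (kernelHigh b) := by
  refine continuous_const.div (by fun_prop) fun φ => ?_
  have h1 := radicandHigh_le (b := b) φ
  have : 0 < 2 * (b - 1 + Real.cos φ) := by linarith
  positivity

theorem kernelHigh_pos (hb : 2 < b) (φ : ℝ) : 0 < kernelHigh b φ := by
  have h1 := radicandHigh_le (b := b) φ
  have : 0 < 2 * (b - 1 + Real.cos φ) := by linarith
  unfold kernelHigh; positivity

theorem kernelHigh_le (hb : 2 < b) (φ : ℝ) : kernelHigh b φ ≤ 1 / √(2 * (b - 2)) := by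
  have h1 := radicandHigh_le (b := b) φ
  have h2 : 0 < 2 * (b - 2) := by linarith
  unfold kernelHigh
  gcongr

theorem rateHigh_nonneg (hb : 2 < b) : 0 ≤ rateHigh b := by
  have hpi := Real.pi_pos
  have : 0 ≤ ∫ φ in (0 : ℝ)..2 * Real.pi, kernelHigh b φ :=
    integral_nonneg (by positivity) fun φ _ => (kernelHigh_pos hb φ).le
  unfold rateHigh; positivity

theorem rateHigh_le (hb : 2 < b) : rateHigh b ≤ 1 / √(2 * (b - 2)) := by
  have hpi := Real.pi_pos
  have h1 : ∫ φ in (0 : ℝ)..2 * Real.pi, kernelHigh b φ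
      ≤ ∫ φ in (0 : ℝ)..2 * Real.pi, 1 / √(2 * (b - 2)) :=
    integral_mono_on (by positivity) ((continuous_kernelHigh hb).intervalIntegrable _ _)
      intervalIntegrable_const fun φ _ => kernelHigh_le hb φ
  rw [intervalIntegral.integral_const, sub_zero, smul_eq_mul] at h1
  rw [rateHigh, one_div, inv_mul_le_iff₀ (by positivity)]
  exact h1

end

theorem exists_sign_of_ne_zero {y : ℝ → ℝ} {S : Set ℝ} (hS : IsPreconnected S)
    (hc : ContinuousOn y S) (h0 : ∀ t ∈ S, y t ≠ 0) :
    ∃ σ : ℝ, |σ| = 1 ∧ ∀ t ∈ S, |y t| = σ * y t := by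
  by_cases hp : ∃ s ∈ S, 0 < y s
  · obtain ⟨s, hs, hs0⟩ := hp
    refine ⟨1, by simp, fun t ht => ?_⟩
    rw [one_mul, abs_of_pos]
    by_contra! hn
    obtain ⟨r, hr, hr0⟩ := hS.intermediate_value ht hs hc ⟨hn, hs0.le⟩
    exact h0 r hr hr0
  · push Not at hp
    exact ⟨-1, by simp, fun t ht => by rw [abs_of_nonpos (hp t ht)]; ring⟩

/-- On a time interval on which the energy stays close to `β > 2`, the time is `rateHigh β` times
the length of the path, up to a bounded error and a small relative error. -/
theorem window_high {δ : ℝ} (hδ : 0 < δ) : ∃ C, 0 ≤ C ∧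
    ∀ {ε a b β ω : ℝ} {x y u : ℝ → ℝ}, Controlled ε a b x y u → 2 + δ ≤ β →
      (∀ t ∈ Icc a b, 2 + δ ≤ en (x t) (y t) ∧ |en (x t) (y t) - β| ≤ ω) →
      |(b - a) - rateHigh β * (∫ t in a..b, |y t|)| ≤ C + C * (ω + ε) * (b - a) := by
  set K : ℝ := 1 / √(2 * δ) with hK
  have hK0 : 0 < K := by positivity
  have hpi := Real.pi_pos
  refine ⟨2 * K ^ 2 + 2 * (2 * K * (2 * Real.pi)), by positivity, ?_⟩
  intro ε a b β ω x y u h hβ hE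
  have hε := h.eps_pos
  have hβ' : 2 < β := by linarith
  have hKβ : 1 / √(2 * (β - 2)) ≤ K := by
    rw [hK]; gcongr; linarith
  have hker : ∀ φ, kernelHigh β φ ≤ K := fun φ => (kernelHigh_le hβ' φ).trans hKβ
  have hr0 := rateHigh_nonneg hβ'
  have hrK := (rateHigh_le hβ').trans hKβ
  have hyE : ∀ t, y t ^ 2 = 2 * (en (x t) (y t) - 1 + Real.cos (x t)) := fun t => by
    unfold en; ring
  obtain ⟨σ, hσ, hσy⟩ := exists_sign_of_ne_zero isPreconnected_Icc h.cont_vel fun t ht h0 => by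
    have h1 := hyE t
    rw [h0] at h1
    have := (hE t ht).1
    rw [h0] at this
    linarith [Real.neg_one_le_cos (x t)]
  -- Above the separatrix the velocity keeps a sign, so the angle itself serves as the phase and
  -- path length is its increment up to sign. It remains to subtract the mean of the time density.
  set g : ℝ → ℝ := fun φ => kernelHigh β φ - rateHigh β with hg
  have hgc : Continuous g := (continuous_kernelHigh hβ').sub continuous_const
  have hgM : ∀ φ, |g φ| ≤ 2 * K := fun φ => by
    have := kernelHigh_pos hβ' φ
    have := hker φ
    simp only [hg]
    rw [abs_le]; constructor <;> linarith
  have hgper : Function.Periodic g (2 * Real.pi) := fun φ => by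
    simp only [hg, kernelHigh, Real.cos_add_two_pi]
  have hg0 : ∫ φ in (0 : ℝ)..2 * Real.pi, g φ = 0 := by
    simp only [hg]
    rw [intervalIntegral.integral_sub ((continuous_kernelHigh hβ').intervalIntegrable _ _)
      intervalIntegrable_const, intervalIntegral.integral_const, rateHigh]
    simp only [sub_zero, smul_eq_mul]
    field_simp
    ring
  have hG := abs_integral_le_of_periodic (by positivity) hgc hgper hg0 hgM
  have hGac := h.ac_angle.comp_contDiff (contDiff_integral hgc 0)
  have hAac := h.integrable_abs_vel.absolutelyContinuousOnInterval_intervalIntegral (c := a)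
    left_mem_uIcc
  have hA' : ∀ᵐ t, t ∈ Icc a b → HasDerivAt (fun t => ∫ r in a..t, |y r|) (|y t|) t := by
    filter_upwards [h.integrable_abs_vel.ae_hasDerivAt_integral] with t ht hm
    exact ht (h.uIcc_eq ▸ hm) a left_mem_uIcc
  have hfin := AbsolutelyContinuousOnInterval.abs_sub_le h.le
    (((contDiff_id.contDiffOn.absolutelyContinuousOnInterval).fun_sub
      (hAac.const_mul (rateHigh β))).fun_sub (hGac.const_mul σ))
    (c := 2 * K ^ 2 * ω) (by
      filter_upwards [h.ae_hasDerivAt, hA'] with t h1 h2 hm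
      obtain ⟨hE1, hE3⟩ := hE t hm
      refine ⟨_, ((hasDerivAt_id t).sub ((h2 hm).const_mul _)).sub
        (((hgc.integral_hasStrictDerivAt 0 (x t)).hasDerivAt.comp t (h1 hm).1).const_mul σ), ?_⟩
      have hcos := Real.neg_one_le_cos (x t)
      have hp : 0 < 2 * (β - 1 + Real.cos (x t)) := by linarith
      have hq : 0 ≤ 2 * (en (x t) (y t) - 1 + Real.cos (x t)) := by linarith
      have hyabs : |y t| = √(2 * (en (x t) (y t) - 1 + Real.cos (x t))) := by
        rw [← hyE, Real.sqrt_sq_eq_abs]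
      have hk := kernelHigh_pos hβ' (x t)
      have hk1 : kernelHigh β (x t) * √(2 * (β - 1 + Real.cos (x t))) = 1 := by
        rw [kernelHigh, one_div, inv_mul_cancel₀ (Real.sqrt_pos.2 hp).ne']
      have hsplit : 1 - rateHigh β * |y t| - σ * (g (x t) * y t) =
          kernelHigh β (x t) * (√(2 * (β - 1 + Real.cos (x t))) - |y t|) := by
        simp only [hg]
        linear_combination (-1) * hk1 + (kernelHigh β (x t) - rateHigh β) * hσy t hm
      rw [hsplit, abs_mul, abs_of_pos hk, hyabs]
      have t1 := abs_sqrt_sub_sqrt_le hp hq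
      have t2 : |2 * (β - 1 + Real.cos (x t)) - 2 * (en (x t) (y t) - 1 + Real.cos (x t))|
          ≤ 2 * ω := by
        rw [show 2 * (β - 1 + Real.cos (x t)) - 2 * (en (x t) (y t) - 1 + Real.cos (x t))
          = -(2 * (en (x t) (y t) - β)) by ring, abs_neg, abs_mul, abs_two]
        gcongr
      rw [div_eq_mul_one_div] at t1
      calc _ ≤ K * (2 * ω * K) := by
            gcongr
            · exact hker _
            · exact t1.trans (mul_le_mul t2 (hker _) hk.le ((abs_nonneg _).trans t2))
        _ = _ := by ring)
  simp only [id, intervalIntegral.integral_same, mul_zero, sub_zero] at hfin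
  have g1 : |σ * ∫ r in (0 : ℝ)..x a, g r| ≤ 2 * K * (2 * Real.pi) := by
    rw [abs_mul, hσ, one_mul]; exact hG _
  have g2 : |σ * ∫ r in (0 : ℝ)..x b, g r| ≤ 2 * K * (2 * Real.pi) := by
    rw [abs_mul, hσ, one_mul]; exact hG _
  have hab : 0 ≤ b - a := sub_nonneg.2 h.le
  have hω : 0 ≤ ω := (abs_nonneg _).trans (hE a h.left_mem).2
  rw [abs_le] at g1 g2 hfin ⊢
  have p1 : 0 ≤ 2 * K ^ 2 * ε * (b - a) := by positivity
  have p2 : 0 ≤ 2 * (2 * K * (2 * Real.pi)) * (ω + ε) * (b - a) := by positivity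
  have p3 : 0 ≤ K ^ 2 := sq_nonneg K
  constructor <;> nlinarith

/-! ### From windows to long time intervals -/

/-- Windows of length `S = 2 (C + 1) / κ` make the error `C` per window cost at most `κ / 2`. During
a window the clock moves by at most `ε Y S`; hence for small `ε` and `η` the oscillation of `p` and
the error proportional to the window length cost at most `κ / 4` each. -/
theorem regular_of_window {p : ℝ → ℝ} {j₁ j₂ Y C κ : ℝ} (hp : ContinuousOn p (Icc j₁ j₂))
    (hC : 0 ≤ C) (hY : 0 ≤ Y) (hκ : 0 < κ) : ∃ ε₀ > 0, ∃ C' ≥ 0,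
    ∀ {ε a b η : ℝ} {x y u k : ℝ → ℝ}, Controlled ε a b x y u → ε < ε₀ → η < ε₀ →
      IsClock ε a b y k → (∀ t ∈ Icc a b, k t ∈ Icc j₁ j₂) → (∀ t ∈ Icc a b, |y t| ≤ Y) →
      (∀ s ∈ Icc a b, ∀ t ∈ Icc a b, s ≤ t →
        |(t - s) - p (k s) * (∫ r in s..t, |y r|)| ≤ C + C * (k s - k t + η + ε) * (t - s)) →
      |(b - a) - (∫ e in k b..k a, p e) / ε| ≤ κ * (b - a) + C' := by
  have hu := isCompact_Icc.uniformContinuousOn_of_continuous hp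
  rw [Metric.uniformContinuousOn_iff] at hu
  set κ₁ : ℝ := κ / (4 * (Y + 1)) with hκ₁
  obtain ⟨ν, hν, hun⟩ := hu κ₁ (by positivity)
  set S : ℝ := 2 * (C + 1) / κ with hS
  have hS0 : 0 < S := by positivity
  refine ⟨min (ν / ((Y + 1) * S)) (κ / (4 * (C + 1) * (Y * S + 2))), by positivity, C, hC, ?_⟩
  intro ε a b η x y u k h hεν hην hk hkJ hyY hwin
  have hε := h.eps_pos
  have e1 := (lt_min_iff.1 hεν).1
  have e2 := (lt_min_iff.1 hεν).2
  have e3 := (lt_min_iff.1 hην).2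
  rw [lt_div_iff₀ (by positivity)] at e1 e2 e3
  have hint : ∀ s ∈ Icc a b, ∀ t ∈ Icc a b, IntervalIntegrable p volume (k s) (k t) :=
    fun s hs t ht => (hp.mono (ordConnected_Icc.uIcc_subset (hkJ s hs) (hkJ t ht))).intervalIntegrable
  have key := abs_sub_le_of_windows (f := fun t => t - (∫ e in k t..k a, p e) / ε) (C := C)
    (κ := κ / 2) hS0 hC h.le (by
      intro s t has hst htb hlen
      have hs : s ∈ Icc a b := ⟨has, hst.trans htb⟩
      have ht : t ∈ Icc a b := ⟨has.trans hst, htb⟩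
      have hts : 0 ≤ t - s := sub_nonneg.2 hst
      have hadd := intervalIntegral.integral_add_adjacent_intervals (hint t ht s hs)
        (hint s hs a h.left_mem)
      have hkst := hk s hs t ht
      have hanti := hk.antitone hε hs ht hst
      have hA0 : 0 ≤ ∫ r in s..t, |y r| := integral_nonneg hst fun _ _ => abs_nonneg _
      have hA1 : ∫ r in s..t, |y r| ≤ Y * (t - s) := by
        have := integral_mono_on hst (h.integrable_abs_vel.mono_set (h.uIcc_subset hs ht))
          intervalIntegrable_const fun r hr => hyY r ⟨has.trans hr.1, hr.2.trans htb⟩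
        simpa [mul_comm] using this
      have hYts : Y * (t - s) ≤ Y * S := by gcongr
      have hsmall : k s - k t < ν := by
        rw [hkst]
        calc ε * ∫ r in s..t, |y r| ≤ ε * (Y * S) := by gcongr; exact hA1.trans hYts
          _ ≤ ε * ((Y + 1) * S) := by gcongr; linarith
          _ < ν := e1
      have hosc : |(∫ e in k t..k s, p e) - p (k s) * (k s - k t)| ≤ κ₁ * (k s - k t) := by
        have h1 : (∫ e in k t..k s, p e) - p (k s) * (k s - k t)
            = ∫ e in k t..k s, (p e - p (k s)) := by
          rw [intervalIntegral.integral_sub (hint t ht s hs) intervalIntegrable_const,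
            intervalIntegral.integral_const, smul_eq_mul, mul_comm]
        rw [h1, ← abs_of_nonneg (sub_nonneg.2 hanti), ← Real.norm_eq_abs]
        refine intervalIntegral.norm_integral_le_of_norm_le_const fun e he => ?_
        rw [uIoc_of_le hanti] at he
        have heJ : e ∈ Icc j₁ j₂ := ⟨(hkJ t ht).1.trans he.1.le, he.2.trans (hkJ s hs).2⟩
        refine (hun e heJ (k s) (hkJ s hs) ?_).le
        rw [Real.dist_eq, abs_lt]
        constructor <;> linarith [he.1, he.2]
      have hw := hwin s hs t ht hst
      have hosc' : |(∫ e in k t..k s, p e) / ε - p (k s) * (∫ r in s..t, |y r|)|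
          ≤ κ / 4 * (t - s) := by
        have h2 : (∫ e in k t..k s, p e) / ε - p (k s) * (∫ r in s..t, |y r|)
            = ((∫ e in k t..k s, p e) - p (k s) * (k s - k t)) / ε := by
          rw [hkst]; field_simp
        rw [h2, abs_div, abs_of_pos hε, div_le_iff₀ hε]
        refine hosc.trans ?_
        rw [hkst, hκ₁]
        have h3 : κ / (4 * (Y + 1)) * Y ≤ κ / 4 := by
          rw [div_mul_eq_mul_div, div_le_div_iff₀ (by positivity) (by norm_num)]
          nlinarith
        calc _ ≤ κ / (4 * (Y + 1)) * (ε * (Y * (t - s))) := by gcongr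
          _ = κ / (4 * (Y + 1)) * Y * (ε * (t - s)) := by ring
          _ ≤ κ / 4 * (ε * (t - s)) := by gcongr
          _ = _ := by ring
      have hw2 : C * (k s - k t + η + ε) ≤ κ / 4 := by
        have h4 : k s - k t ≤ ε * (Y * S) := by
          rw [hkst]; gcongr; exact hA1.trans hYts
        set m := κ / (4 * (C + 1) * (Y * S + 2)) with hm
        have hεm : ε ≤ m := by rw [hm, le_div_iff₀ (by positivity)]; exact e2.le
        have hηm : η ≤ m := by rw [hm, le_div_iff₀ (by positivity)]; exact e3.le
        have hm0 : 0 < m := hε.trans_le hεm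
        have h5 : k s - k t + η + ε ≤ m * (Y * S + 2) := by
          have : ε * (Y * S) ≤ m * (Y * S) := by gcongr
          linarith
        have h6 : m * (Y * S + 2) = κ / (4 * (C + 1)) := by rw [hm]; field_simp
        rw [h6] at h5
        calc _ ≤ C * (κ / (4 * (C + 1))) := by gcongr
          _ ≤ (C + 1) * (κ / (4 * (C + 1))) := by gcongr; linarith
          _ = _ := by field_simp
      have hdiff : (fun t => t - (∫ e in k t..k a, p e) / ε) t
          - (fun t => t - (∫ e in k t..k a, p e) / ε) s
          = ((t - s) - p (k s) * (∫ r in s..t, |y r|))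
            - ((∫ e in k t..k s, p e) / ε - p (k s) * (∫ r in s..t, |y r|)) := by
        simp only
        rw [← hadd]; ring
      rw [hdiff]
      refine (abs_sub _ _).trans ?_
      have : C * (k s - k t + η + ε) * (t - s) ≤ κ / 4 * (t - s) := by gcongr
      linarith)
  simp only [intervalIntegral.integral_same, zero_div, sub_zero] at key
  have hSC : C / S ≤ κ / 2 := by
    rw [hS, div_le_div_iff₀ (by positivity) (by norm_num), mul_div_cancel₀ _ hκ.ne']
    nlinarith
  have hba : 0 ≤ b - a := sub_nonneg.2 h.le
  calc _ = |b - (∫ e in k b..k a, p e) / ε - a| := by congr 1; ring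
    _ ≤ (C / S + κ / 2) * (b - a) + C := key
    _ ≤ (κ / 2 + κ / 2) * (b - a) + C := by gcongr
    _ = _ := by ring

/-! ### The function `tau` as a primitive -/

/-- The limit, as `ε → 0`, of the quotient of time and energy loss (multiplied by `ε`). -/
def rate (b : ℝ) : ℝ := if b < 2 then rateLow b else rateHigh b

theorem intervalIntegral_eq_Ioo {f : ℝ → ℝ} {a b : ℝ} (hab : a ≤ b) :
    ∫ x in a..b, f x = ∫ x in Ioo a b, f x := by
  rw [integral_of_le hab, integral_Ioc_eq_integral_Ioo]

theorem cos_eq_one_sub_two_mul (x : ℝ) : Real.cos x = 1 - 2 * Real.sin (x / 2) ^ 2 := by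
  have h1 := Real.cos_sq' (x / 2)
  have h2 := Real.cos_sq (x / 2)
  rw [mul_div_cancel₀ x two_ne_zero] at h2
  linarith

/-- The substitution `sin (φ / 2) = sin (x / 2) sin θ` in the period integral. -/
theorem integral_period_eq {x : ℝ} (hx : x ∈ Ioo (0 : ℝ) Real.pi) :
    ∫ φ in (0 : ℝ)..x, 1 / √(Real.cos φ - Real.cos x)
      = √2 * ∫ θ in (0 : ℝ)..Real.pi / 2, kernelLow (1 - Real.cos x) θ := by
  have hpi := Real.pi_pos
  set κ : ℝ := Real.sin (x / 2) with hκ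
  have hκ0 : 0 < κ := Real.sin_pos_of_pos_of_lt_pi (by linarith [hx.1]) (by linarith [hx.2])
  have hκ1 : κ < 1 := by
    rw [← Real.sin_pi_div_two]
    exact Real.sin_lt_sin_of_lt_of_le_pi_div_two (by linarith [hx.1]) le_rfl (by linarith [hx.2])
  have hsinθ : ∀ θ ∈ Ioo (0 : ℝ) (Real.pi / 2), 0 < Real.sin θ ∧ Real.sin θ < 1 := fun θ hθ =>
    ⟨Real.sin_pos_of_pos_of_lt_pi hθ.1 (by linarith [hθ.2]), by
      rw [← Real.sin_pi_div_two]
      exact Real.sin_lt_sin_of_lt_of_le_pi_div_two (by linarith [hθ.1]) le_rfl hθ.2⟩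
  have hκθ : ∀ θ ∈ Ioo (0 : ℝ) (Real.pi / 2), 0 < κ * Real.sin θ ∧ κ * Real.sin θ < κ :=
    fun θ hθ => ⟨mul_pos hκ0 (hsinθ θ hθ).1, by nlinarith [(hsinθ θ hθ).2]⟩
  have hsinf : ∀ θ ∈ Ioo (0 : ℝ) (Real.pi / 2),
      Real.sin (2 * Real.arcsin (κ * Real.sin θ) / 2) = κ * Real.sin θ := fun θ hθ => by
    rw [mul_div_cancel_left₀ _ (two_ne_zero), Real.sin_arcsin
      (by linarith [(hκθ θ hθ).1]) (by linarith [(hκθ θ hθ).2])]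
  have hxhalf : Real.arcsin κ = x / 2 :=
    Real.arcsin_sin (by linarith [hx.1]) (by linarith [hx.2])
  have himage : (fun θ => 2 * Real.arcsin (κ * Real.sin θ)) '' Ioo 0 (Real.pi / 2) = Ioo 0 x := by
    ext φ
    constructor
    · rintro ⟨θ, hθ, rfl⟩
      obtain ⟨h1, h2⟩ := hκθ θ hθ
      have h3 := Real.arcsin_pos.2 h1
      have h4 : Real.arcsin (κ * Real.sin θ) < Real.arcsin κ :=
        Real.strictMonoOn_arcsin ⟨by linarith, by linarith⟩ ⟨by linarith, hκ1.le⟩ h2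
      rw [hxhalf] at h4
      exact ⟨by simpa using h3, by simp only; linarith⟩
    · rintro ⟨h1, h2⟩
      have h3 : 0 < Real.sin (φ / 2) :=
        Real.sin_pos_of_pos_of_lt_pi (by linarith) (by linarith [hx.2])
      have h4 : Real.sin (φ / 2) < κ :=
        Real.sin_lt_sin_of_lt_of_le_pi_div_two (by linarith) (by linarith [hx.2]) (by linarith)
      have h5 : Real.sin (φ / 2) / κ < 1 := (div_lt_one hκ0).2 h4
      have h6 : 0 < Real.sin (φ / 2) / κ := by positivity
      refine ⟨Real.arcsin (Real.sin (φ / 2) / κ),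
        ⟨Real.arcsin_pos.2 h6, Real.arcsin_lt_pi_div_two.2 h5⟩, ?_⟩
      simp only
      rw [Real.sin_arcsin (by linarith) h5.le, mul_div_cancel₀ _ hκ0.ne', Real.arcsin_sin
        (by linarith) (by linarith [hx.2])]
      ring
  have hinj : InjOn (fun θ => 2 * Real.arcsin (κ * Real.sin θ)) (Ioo 0 (Real.pi / 2)) := by
    intro θ₁ h1 θ₂ h2 he
    have e1 := hsinf θ₁ h1
    rw [show 2 * Real.arcsin (κ * Real.sin θ₁) = 2 * Real.arcsin (κ * Real.sin θ₂) from he,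
      hsinf θ₂ h2] at e1
    exact Real.injOn_sin ⟨by linarith [h1.1], h1.2.le⟩ ⟨by linarith [h2.1], h2.2.le⟩
      (mul_left_cancel₀ hκ0.ne' e1).symm
  have hder : ∀ θ ∈ Ioo (0 : ℝ) (Real.pi / 2),
      HasDerivWithinAt (fun θ => 2 * Real.arcsin (κ * Real.sin θ))
        (2 * (1 / √(1 - (κ * Real.sin θ) ^ 2) * (κ * Real.cos θ))) (Ioo 0 (Real.pi / 2)) θ := by
    intro θ hθ
    obtain ⟨h1, h2⟩ := hκθ θ hθ
    exact (((Real.hasDerivAt_arcsin (by linarith : -1 < κ * Real.sin θ).ne'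
      (by linarith : κ * Real.sin θ < 1).ne).comp θ
      ((Real.hasDerivAt_sin θ).const_mul κ)).const_mul 2).hasDerivWithinAt
  rw [intervalIntegral_eq_Ioo hx.1.le, ← himage,
    integral_image_eq_integral_abs_deriv_smul measurableSet_Ioo hder hinj,
    ← intervalIntegral.integral_const_mul, intervalIntegral_eq_Ioo (by positivity)]
  refine setIntegral_congr_fun measurableSet_Ioo fun θ hθ => ?_
  have hcos : 0 < Real.cos θ := Real.cos_pos_of_mem_Ioo ⟨by linarith [hθ.1], hθ.2⟩
  have e1 : Real.cos (2 * Real.arcsin (κ * Real.sin θ)) - Real.cos x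
      = 2 * (κ * Real.cos θ) ^ 2 := by
    rw [cos_eq_one_sub_two_mul (2 * _), hsinf θ hθ, cos_eq_one_sub_two_mul x, ← hκ]
    have := Real.sin_sq_add_cos_sq θ
    linear_combination (-(2 * κ ^ 2)) * this
  have e2 : √(2 * (κ * Real.cos θ) ^ 2) = √2 * (κ * Real.cos θ) := by
    rw [Real.sqrt_mul zero_le_two, Real.sqrt_sq (by positivity)]
  have e3 : 1 - (1 - Real.cos x) / 2 * Real.sin θ ^ 2 = 1 - (κ * Real.sin θ) ^ 2 := by
    rw [cos_eq_one_sub_two_mul x, ← hκ]; ring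
  have hs2 : (√2 : ℝ) * √2 = 2 := Real.mul_self_sqrt zero_le_two
  have hpos : 0 < 1 - (κ * Real.sin θ) ^ 2 := by
    obtain ⟨h1, h2⟩ := hκθ θ hθ
    nlinarith
  simp only [smul_eq_mul]
  rw [e1, e2, kernelLow, e3, abs_of_nonneg (by positivity)]
  have h20 : (0 : ℝ) < √2 := by positivity
  field_simp
  rw [Real.sq_sqrt zero_le_two]

theorem integral_kernelLow_eq_two_mul {b : ℝ} (hb : b ∈ Ioo (0 : ℝ) 2) :
    ∫ θ in (0 : ℝ)..Real.pi, kernelLow b θ = 2 * ∫ θ in (0 : ℝ)..Real.pi / 2, kernelLow b θ := by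
  have hc := continuous_kernelLow hb
  rw [← intervalIntegral.integral_add_adjacent_intervals (b := Real.pi / 2)
    (hc.intervalIntegrable _ _) (hc.intervalIntegrable _ _)]
  have h1 : ∫ θ in Real.pi / 2..Real.pi, kernelLow b θ
      = ∫ θ in (0 : ℝ)..Real.pi / 2, kernelLow b (Real.pi - θ) := by
    rw [integral_comp_sub_left (kernelLow b) Real.pi]
    congr 1 <;> ring
  rw [h1]
  simp only [kernelLow, Real.sin_pi_sub]
  ring

theorem one_sub_cos_mem {x : ℝ} (hx : x ∈ Ioo (0 : ℝ) Real.pi) :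
    1 - Real.cos x ∈ Ioo (0 : ℝ) 2 := by
  have h1 := Real.strictAntiOn_cos ⟨le_rfl, Real.pi_pos.le⟩ (Ioo_subset_Icc_self hx) hx.1
  have h2 := Real.strictAntiOn_cos (Ioo_subset_Icc_self hx) ⟨Real.pi_pos.le, le_rfl⟩ hx.2
  rw [Real.cos_zero] at h1
  rw [Real.cos_pi] at h2
  constructor <;> linarith

/-- In the variable `x` with `e = 1 - cos x` the amplitude `arccos (1 - e)` is `x`. The `√2` of the
elliptic substitution cancels the prefactor, and the 2 from the symmetry `θ ↦ π - θ` cancels the 2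
in `rateLow`. -/
theorem tauMinus_integrand_eq {x : ℝ} (hx : x ∈ Ioo (0 : ℝ) Real.pi) :
    1 / √2 * (Real.sin x / x * ∫ φ in (0 : ℝ)..x, 1 / √(Real.cos φ - Real.cos x))
      = |Real.sin x| • rateLow (1 - Real.cos x) := by
  have hs := Real.sin_pos_of_mem_Ioo hx
  rw [integral_period_eq hx, rateLow, integral_kernelLow_eq_two_mul (one_sub_cos_mem hx),
    sub_sub_cancel, Real.arccos_cos hx.1.le hx.2.le, abs_of_pos hs, smul_eq_mul]
  have hx0 := hx.1
  field_simp

/-! ### The change of variable from energy to amplitude. -/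

theorem hasDerivWithinAt_one_sub_cos (s : Set ℝ) (x : ℝ) :
    HasDerivWithinAt (fun x => 1 - Real.cos x) (Real.sin x) s x :=
  (((Real.hasDerivAt_cos x).const_sub 1).congr_deriv (by simp)).hasDerivWithinAt

theorem injOn_one_sub_cos {E : ℝ} : InjOn (fun x => 1 - Real.cos x)
    (Ioo 0 (Real.arccos (1 - E))) := by
  intro x hx y hy he
  have := Real.arccos_le_pi (1 - E)
  refine Real.injOn_cos ⟨hx.1.le, by linarith [hx.2]⟩ ⟨hy.1.le, by linarith [hy.2]⟩ ?_
  simpa using he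

theorem image_one_sub_cos {E : ℝ} (hE : E ∈ Icc (0 : ℝ) 2) :
    (fun x => 1 - Real.cos x) '' Ioo 0 (Real.arccos (1 - E)) = Ioo 0 E := by
  have hpi := Real.arccos_le_pi (1 - E)
  have hcE : Real.cos (Real.arccos (1 - E)) = 1 - E :=
    Real.cos_arccos (by linarith [hE.2]) (by linarith [hE.1])
  ext e
  constructor
  · rintro ⟨x, hx, rfl⟩
    have h1 := Real.strictAntiOn_cos ⟨le_rfl, Real.pi_pos.le⟩
      ⟨hx.1.le, hx.2.le.trans hpi⟩ hx.1
    have h2 := Real.strictAntiOn_cos ⟨hx.1.le, hx.2.le.trans hpi⟩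
      ⟨Real.arccos_nonneg _, hpi⟩ hx.2
    rw [Real.cos_zero] at h1
    rw [hcE] at h2
    exact ⟨by simp only; linarith, by simp only; linarith⟩
  · rintro ⟨h1, h2⟩
    refine ⟨Real.arccos (1 - e), ⟨Real.arccos_pos.2 (by linarith), ?_⟩, ?_⟩
    · exact Real.strictAntiOn_arccos ⟨by linarith [hE.2], by linarith [hE.1]⟩
        ⟨by linarith [hE.2], by linarith⟩ (by linarith)
    · simp only
      rw [Real.cos_arccos (by linarith [hE.2]) (by linarith)]
      ring

theorem tauMinus_eq {E : ℝ} (hE : E ∈ Icc (0 : ℝ) 2) :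
    tauMinus E = ∫ e in (0 : ℝ)..E, rateLow e := by
  rw [intervalIntegral_eq_Ioo hE.1, ← image_one_sub_cos hE,
    integral_image_eq_integral_abs_deriv_smul measurableSet_Ioo
      (fun x _ => hasDerivWithinAt_one_sub_cos _ x) injOn_one_sub_cos, tauMinus,
    ← intervalIntegral.integral_const_mul, intervalIntegral_eq_Ioo (Real.arccos_nonneg _)]
  exact setIntegral_congr_fun measurableSet_Ioo fun x hx =>
    tauMinus_integrand_eq ⟨hx.1, hx.2.trans_le (Real.arccos_le_pi _)⟩

/-! ### Continuity and integrability of the rate. -/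

theorem continuousAt_rateLow {b : ℝ} (hb : b ∈ Ioo (0 : ℝ) 2) : ContinuousAt rateLow b := by
  unfold rateLow
  have hev : ∀ᶠ c in 𝓝 b, c ∈ Ioo (0 : ℝ) ((b + 2) / 2) :=
    Ioo_mem_nhds hb.1 (by linarith [hb.2])
  refine ContinuousAt.div ?_ ?_ ?_
  · refine continuousAt_of_dominated_interval
      (bound := fun _ => 1 / √(1 - (b + 2) / 2 / 2)) ?_ ?_ intervalIntegrable_const ?_
    · filter_upwards [hev] with c hc
      exact (continuous_kernelLow ⟨hc.1, by linarith [hc.2, hb.2]⟩).aestronglyMeasurable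
    · filter_upwards [hev] with c hc
      refine ae_of_all _ fun θ _ => ?_
      have hc' : c ∈ Ioo (0 : ℝ) 2 := ⟨hc.1, by linarith [hc.2, hb.2]⟩
      rw [Real.norm_eq_abs, abs_of_pos (kernelLow_pos hc' θ)]
      refine (kernelLow_le hc' θ).trans ?_
      have : 0 < 1 - (b + 2) / 2 / 2 := by linarith [hb.2]
      gcongr
      exact hc.2.le
    · refine ae_of_all _ fun θ _ => ?_
      unfold kernelLow
      exact continuousAt_const.div (by fun_prop) (Real.sqrt_pos.2 (radicand_pos' hb θ)).ne'
  · exact continuousAt_const.mul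
      (Real.continuous_arccos.continuousAt.comp (continuousAt_const.sub continuousAt_id))
  · have := arccos_pos_of_mem hb
    positivity

/-- In the amplitude variable a crude bound is enough: the kernel is at most `1 / cos (x / 2)`, and
this factor is cancelled by the Jacobian `sin x = 2 sin (x / 2) cos (x / 2)`. What is left is at
most `π / 2`. -/
theorem integrableOn_rateLow : IntegrableOn rateLow (Ioo 0 2) := by
  have h2 : (2 : ℝ) ∈ Icc (0 : ℝ) 2 := ⟨by norm_num, le_rfl⟩
  have hpi : Real.arccos (1 - 2) = Real.pi := by
    rw [show (1 : ℝ) - 2 = -1 by norm_num, Real.arccos_neg_one]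
  rw [← image_one_sub_cos h2, integrableOn_image_iff_integrableOn_abs_deriv_smul measurableSet_Ioo
      (fun x _ => hasDerivWithinAt_one_sub_cos _ x) injOn_one_sub_cos, hpi]
  have hcont : ContinuousOn (fun x => |Real.sin x| • rateLow (1 - Real.cos x))
      (Ioo 0 Real.pi) := fun x hx => by
    refine (ContinuousAt.smul Real.continuous_sin.abs.continuousAt ?_).continuousWithinAt
    exact ContinuousAt.comp (g := rateLow) (continuousAt_rateLow (one_sub_cos_mem hx))
      (by fun_prop)
  refine IntegrableOn.of_bound (C := Real.pi / 2) (by simp)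
    (hcont.aestronglyMeasurable measurableSet_Ioo) ?_
  rw [ae_restrict_iff' measurableSet_Ioo]
  refine ae_of_all _ fun x hx => ?_
  have hb := one_sub_cos_mem hx
  have hs := Real.sin_pos_of_mem_Ioo hx
  have h0 := rateLow_nonneg hb
  have hx0 := hx.1
  have hc : 0 < Real.cos (x / 2) :=
    Real.cos_pos_of_mem_Ioo ⟨by linarith [hx.1, Real.pi_pos], by linarith [hx.2]⟩
  have e1 : √(1 - (1 - Real.cos x) / 2) = Real.cos (x / 2) := by
    rw [← Real.sqrt_sq hc.le, cos_eq_one_sub_two_mul x]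
    congr 1
    linarith [Real.sin_sq_add_cos_sq (x / 2)]
  have h1 := integral_kernelLow_le hb
  rw [e1] at h1
  have hsx : Real.sin (x / 2) ≤ x / 2 := Real.sin_le (by linarith)
  have hsd : Real.sin x = 2 * Real.sin (x / 2) * Real.cos (x / 2) := by
    rw [← Real.sin_two_mul]; congr 1; ring
  have hr : rateLow (1 - Real.cos x) ≤ Real.pi * (1 / Real.cos (x / 2)) / (2 * x) := by
    rw [rateLow, sub_sub_cancel, Real.arccos_cos hx.1.le hx.2.le]
    gcongr
  rw [norm_smul, Real.norm_eq_abs, Real.norm_eq_abs, abs_abs, abs_of_pos hs, abs_of_nonneg h0]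
  have hpi := Real.pi_pos
  calc _ ≤ Real.sin x * (Real.pi * (1 / Real.cos (x / 2)) / (2 * x)) := by gcongr
    _ = Real.pi * Real.sin (x / 2) / x := by rw [hsd]; field_simp
    _ ≤ Real.pi * (x / 2) / x := by gcongr
    _ = Real.pi / 2 := by field_simp

theorem continuousAt_rateHigh {b : ℝ} (hb : 2 < b) : ContinuousAt rateHigh b := by
  unfold rateHigh
  have hev : ∀ᶠ c in 𝓝 b, (b + 2) / 2 < c := Ioi_mem_nhds (by linarith)
  refine continuousAt_const.mul (continuousAt_of_dominated_interval
      (bound := fun _ => 1 / √(2 * ((b + 2) / 2 - 2))) ?_ ?_ intervalIntegrable_const ?_)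
  · filter_upwards [hev] with c hc
    exact (continuous_kernelHigh (by linarith)).aestronglyMeasurable
  · filter_upwards [hev] with c hc
    refine ae_of_all _ fun θ _ => ?_
    have hc' : 2 < c := by linarith
    rw [Real.norm_eq_abs, abs_of_pos (kernelHigh_pos hc' θ)]
    refine (kernelHigh_le hc' θ).trans ?_
    have : 0 < 2 * ((b + 2) / 2 - 2) := by linarith
    gcongr
  · refine ae_of_all _ fun θ _ => ?_
    unfold kernelHigh
    have h1 := radicandHigh_le (b := b) θ
    exact continuousAt_const.div (by fun_prop) (Real.sqrt_pos.2 (by linarith)).ne'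

/-- The sign of the cosine is changed by a shift by `π`, which is harmless over a full period. -/
theorem rateHigh_eq {e : ℝ} :
    rateHigh e = 1 / (2 * √2 * Real.pi)
      * ∫ φ in (0 : ℝ)..(2 * Real.pi), 1 / √(e - 1 - Real.cos φ) := by
  have hper : Function.Periodic (fun φ => 1 / √(e - 1 - Real.cos φ)) (2 * Real.pi) := fun φ => by
    simp only [Real.cos_add_two_pi]
  have h1 : ∀ φ, kernelHigh e φ = 1 / √2 * (1 / √(e - 1 - Real.cos (φ + Real.pi))) := fun φ => by
    rw [kernelHigh, Real.cos_add_pi, sub_neg_eq_add, Real.sqrt_mul zero_le_two]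
    rw [one_div_mul_one_div]
  rw [rateHigh]
  simp_rw [h1]
  rw [intervalIntegral.integral_const_mul,
    integral_comp_add_right (fun φ => 1 / √(e - 1 - Real.cos φ)), zero_add,
    add_comm (2 * Real.pi), hper.intervalIntegral_add_eq Real.pi 0, zero_add, ← mul_assoc]
  congr 1
  rw [one_div_mul_one_div]
  congr 1; ring

theorem tauPlus_eq (E : ℝ) : tauPlus E = ∫ e in (2 : ℝ)..E, rateHigh e := by
  simp_rw [rateHigh_eq]
  rw [intervalIntegral.integral_const_mul, tauPlus]

/-- The bound of `rateHigh_le` has only the integrable singularity `(e - 2) ^ (-1 / 2)`. -/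
theorem intervalIntegrable_rateHigh {E : ℝ} (hE : 2 ≤ E) :
    IntervalIntegrable rateHigh volume 2 E := by
  have h1 : IntervalIntegrable (fun e : ℝ => (e - 2) ^ (-(1 / 2) : ℝ)) volume 2 E := by
    have := (intervalIntegrable_rpow' (a := 0) (b := E - 2) (r := -(1 / 2))
      (by norm_num)).comp_sub_right 2
    simpa using this
  rw [intervalIntegrable_iff_integrableOn_Ioo_of_le hE] at h1 ⊢
  have hcont : ContinuousOn rateHigh (Ioo 2 E) := fun e he =>
    (continuousAt_rateHigh he.1).continuousWithinAt
  refine Integrable.mono' h1 (hcont.aestronglyMeasurable measurableSet_Ioo) ?_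
  rw [ae_restrict_iff' measurableSet_Ioo]
  refine ae_of_all _ fun e he => ?_
  rw [Real.norm_eq_abs, abs_of_nonneg (rateHigh_nonneg he.1)]
  have h2 : 0 < e - 2 := by linarith [he.1]
  rw [Real.rpow_neg h2.le, ← Real.sqrt_eq_rpow, ← one_div]
  refine (rateHigh_le he.1).trans ?_
  gcongr
  linarith

theorem intervalIntegrable_rate_low : IntervalIntegrable rate volume 0 2 := by
  rw [intervalIntegrable_iff_integrableOn_Ioo_of_le zero_le_two]
  exact integrableOn_rateLow.congr_fun (fun e he => by rw [rate, if_pos he.2]) measurableSet_Ioo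

theorem intervalIntegrable_rate {a b : ℝ} (ha : 0 ≤ a) (hb : 0 ≤ b) :
    IntervalIntegrable rate volume a b := by
  have key : ∀ E, 0 ≤ E → IntervalIntegrable rate volume 0 E := fun E hE => by
    have h1 : IntervalIntegrable rate volume 2 (max 2 E) :=
      (intervalIntegrable_rateHigh (le_max_left 2 E)).congr (fun e he => by
        rw [uIoc_of_le (le_max_left 2 E)] at he
        rw [rate, if_neg (not_lt.2 he.1.le)])
    refine (intervalIntegrable_rate_low.trans h1).mono_set ?_
    rw [uIcc_of_le hE, uIcc_of_le (by positivity)]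
    exact Icc_subset_Icc le_rfl (le_max_right _ _)
  exact (key a ha).symm.trans (key b hb)

theorem tau_eq {E : ℝ} (hE : 0 ≤ E) : tau E = ∫ e in (0 : ℝ)..E, rate e := by
  have key : ∀ F, F ∈ Icc (0 : ℝ) 2 → tauMinus F = ∫ e in (0 : ℝ)..F, rate e := fun F hF => by
    rw [tauMinus_eq hF, intervalIntegral_eq_Ioo hF.1, intervalIntegral_eq_Ioo hF.1]
    exact setIntegral_congr_fun measurableSet_Ioo fun e he => by
      rw [rate, if_pos (he.2.trans_le hF.2)]
  unfold tau
  split_ifs with h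
  · rw [key 2 ⟨zero_le_two, le_rfl⟩, tauPlus_eq, add_comm,
      ← intervalIntegral.integral_add_adjacent_intervals
        (intervalIntegrable_rate le_rfl zero_le_two) (intervalIntegrable_rate zero_le_two hE)]
    congr 1
    refine integral_congr fun e he => ?_
    rw [uIcc_of_le h] at he
    rw [rate, if_neg (not_lt.2 he.1)]
  · exact key E ⟨hE, (not_le.1 h).le⟩

theorem continuousOn_rate_low {δ : ℝ} (hδ : 0 < δ) : ContinuousOn rate (Icc δ (2 - δ)) :=
  ContinuousOn.congr (f := rateLow) (fun b hb => (continuousAt_rateLow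
    ⟨by linarith [hb.1], by linarith [hb.2]⟩).continuousWithinAt)
    fun b hb => by rw [rate, if_pos (by linarith [hb.2])]

theorem continuousOn_rate_high {δ M : ℝ} (hδ : 0 < δ) : ContinuousOn rate (Icc (2 + δ) M) :=
  ContinuousOn.congr (f := rateHigh) (fun b hb => (continuousAt_rateHigh
    (by linarith [hb.1])).continuousWithinAt)
    fun b hb => by rw [rate, if_neg (by linarith [hb.1])]

theorem rate_nonneg {b : ℝ} (h0 : 0 < b) (h2 : b ≠ 2) : 0 ≤ rate b := by
  unfold rate
  split_ifs with h
  · exact rateLow_nonneg ⟨h0, h⟩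
  · exact rateHigh_nonneg (lt_of_le_of_ne (not_lt.1 h) h2.symm)

/-! ### Motions under dry friction -/

theorem energy_state (m : Motion) (t : ℝ) : energy (m.state t) = en (m.x t) (m.y t) := by
  simp [energy, Motion.state, en]

theorem mem_standstill_state {ε : ℝ} (m : Motion) (t : ℝ) :
    m.state t ∈ standstill ε ↔ |Real.sin (m.x t)| < 2 * ε ∧ |m.y t| < 2 * ε := by
  simp [standstill, Motion.state]

/-- A controlled motion on `[0, T]` to the lower equilibrium with dry friction outside the
standstill zone, in which it spends at most the time `Λ`. -/
structure Braked (ε T Λ : ℝ) (x y u : ℝ → ℝ) : Prop where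
  ctrl : Controlled ε 0 T x y u
  finish : en (x T) (y T) = 0
  friction : ∀ t ∈ Icc 0 T, ¬(|Real.sin (x t)| < 2 * ε ∧ |y t| < 2 * ε) → u t = -Real.sign (y t)
  zone_nonneg : 0 ≤ Λ
  zone_le : volume {t ∈ Icc 0 T | |Real.sin (x t)| < 2 * ε ∧ |y t| < 2 * ε} ≤ ENNReal.ofReal Λ

theorem Motion.IsDamping.controlled {ε : ℝ} {p : Phase} {m : Motion} (h : m.IsDamping ε p)
    (hε : 0 < ε) : Controlled ε 0 m.T m.x m.y m.u := by
  have hx : ContinuousOn m.x (Icc 0 m.T) := fun t ht => (h.deriv_angle t ht).continuousWithinAt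
  have hu : IntervalIntegrable m.u volume 0 m.T := by
    rw [intervalIntegrable_iff_integrableOn_Icc_of_le h.duration_nonneg]
    refine Measure.integrableOn_of_bounded (M := 1) (by simp)
      h.measurable_control.aestronglyMeasurable ?_
    rw [ae_restrict_iff' measurableSet_Icc]
    exact ae_of_all _ fun t ht => h.control_le t ht
  have hf : IntervalIntegrable (fun r => -Real.sin (m.x r) + ε * m.u r) volume 0 m.T := by
    refine IntervalIntegrable.add ?_ (hu.const_mul ε)
    refine ContinuousOn.intervalIntegrable ?_
    rw [uIcc_of_le h.duration_nonneg]
    exact (Real.continuous_sin.comp_continuousOn hx).neg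
  have hsub : ∀ s ∈ Icc 0 m.T, ∀ t ∈ Icc 0 m.T, uIcc s t ⊆ Icc 0 m.T := fun s hs t ht =>
    uIcc_subset_Icc hs ht
  have h0 : (0 : ℝ) ∈ Icc 0 m.T := left_mem_Icc.2 h.duration_nonneg
  refine ⟨h.duration_nonneg, hε, h.measurable_control, h.control_le, hx, h.continuous_velocity,
    fun s hs t ht => ?_, fun s hs t ht => ?_⟩
  · refine (integral_eq_sub_of_hasDeriv_right (hx.mono (hsub s hs t ht)) (fun r hr => ?_)
      (h.continuous_velocity.mono (hsub s hs t ht)).intervalIntegrable).symm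
    have hr' : r ∈ Ioo 0 m.T := ⟨(le_min hs.1 ht.1).trans_lt hr.1, hr.2.trans_le (max_le hs.2 ht.2)⟩
    exact ((h.deriv_angle r (Ioo_subset_Icc_self hr')).hasDerivAt
      (Icc_mem_nhds hr'.1 hr'.2)).hasDerivWithinAt
  · have hi : ∀ r ∈ Icc 0 m.T,
        IntervalIntegrable (fun r => -Real.sin (m.x r) + ε * m.u r) volume 0 r := fun r hr =>
      hf.mono_set (uIcc_subset_uIcc left_mem_uIcc (Icc_subset_uIcc hr))
    rw [h.velocity_eq t ht, h.velocity_eq s hs, ← integral_interval_sub_left (hi t ht) (hi s hs)]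
    ring

theorem Motion.IsDamping.braked {ε Λ : ℝ} {p : Phase} {m : Motion} (h : m.IsDamping ε p)
    (hε : 0 < ε) (hf : m.DryFriction ε) (hΛ : 0 ≤ Λ)
    (hv : volume {t ∈ Icc 0 m.T | m.state t ∈ standstill ε} ≤ ENNReal.ofReal Λ) :
    Braked ε m.T Λ m.x m.y m.u := by
  simp only [mem_standstill_state] at hv
  refine ⟨h.controlled hε, ?_, fun t ht hn => hf t ht ?_, hΛ, hv⟩
  · rw [← energy_state, h.finish]; simp [energy]
  · rwa [mem_standstill_state]

namespace Braked

variable {ε T Λ η δ : ℝ} {x y u : ℝ → ℝ}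

/-- The energy that dry friction alone would leave. -/
def clock (ε : ℝ) (x y : ℝ → ℝ) (t : ℝ) : ℝ := en (x 0) (y 0) - ε * ∫ r in (0 : ℝ)..t, |y r|

theorem isClock (h : Controlled ε 0 T x y u) : IsClock ε 0 T y (clock ε x y) := fun s hs t ht => by
  have hi : ∀ r ∈ Icc 0 T, IntervalIntegrable (fun r => |y r|) volume 0 r := fun r hr =>
    h.integrable_abs_vel.mono_set (h.uIcc_subset h.left_mem hr)
  rw [clock, clock, ← integral_interval_sub_left (hi t ht) (hi s hs)]
  ring

theorem clock_zero : clock ε x y 0 = en (x 0) (y 0) := by simp [clock]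

theorem measurableSet_zone (h : Controlled ε 0 T x y u) :
    MeasurableSet {t ∈ Icc 0 T | |Real.sin (x t)| < 2 * ε ∧ |y t| < 2 * ε} := by
  have h1 := (Real.continuous_sin.comp_continuousOn h.cont_angle).abs
  obtain ⟨U, hU, e1⟩ := continuousOn_iff'.1 h1 (Iio (2 * ε)) isOpen_Iio
  obtain ⟨V, hV, e2⟩ := continuousOn_iff'.1 h.cont_vel.abs (Iio (2 * ε)) isOpen_Iio
  have : {t ∈ Icc 0 T | |Real.sin (x t)| < 2 * ε ∧ |y t| < 2 * ε}
      = (U ∩ Icc 0 T) ∩ (V ∩ Icc 0 T) := by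
    rw [← e1, ← e2]
    ext t
    simp only [mem_ofPred_eq, mem_inter_iff, mem_preimage, mem_Iio, Function.comp_apply]
    tauto
  rw [this]
  exact (hU.measurableSet.inter measurableSet_Icc).inter (hV.measurableSet.inter measurableSet_Icc)

/-- The energy exceeds the clock only by the work done in the standstill zone. -/
theorem en_mem (h : Braked ε T Λ x y u) {t : ℝ} (ht : t ∈ Icc 0 T) :
    en (x t) (y t) ∈ Icc (clock ε x y t) (clock ε x y t + 4 * ε ^ 2 * Λ) := by
  have hc := h.ctrl
  have hε := hc.eps_pos
  set Z := {t ∈ Icc 0 T | |Real.sin (x t)| < 2 * ε ∧ |y t| < 2 * ε} with hZ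
  have hZm : MeasurableSet Z := measurableSet_zone hc
  have hE := hc.energy_sub hc.left_mem ht
  have hi1 : IntervalIntegrable (fun r => |y r|) volume 0 t :=
    hc.integrable_abs_vel.mono_set (hc.uIcc_subset hc.left_mem ht)
  have hi2 : IntervalIntegrable (fun r => u r * y r) volume 0 t :=
    (hc.integrable_control.mul_continuousOn (hc.uIcc_eq ▸ hc.cont_vel)).mono_set
      (hc.uIcc_subset hc.left_mem ht)
  have hsum : en (x t) (y t) - clock ε x y t = ε * ∫ r in (0 : ℝ)..t, (u r * y r + |y r|) := by
    rw [intervalIntegral.integral_add hi2 hi1, clock]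
    rw [intervalIntegral.integral_const_mul] at hE
    unfold en at *
    linarith
  -- Under dry friction the sum vanishes; in the zone it is at most `2 |y| < 4 ε`.
  have hb : ∀ r ∈ Icc 0 T, 0 ≤ u r * y r + |y r| ∧
      u r * y r + |y r| ≤ Z.indicator (fun _ => 4 * ε) r := by
    intro r hr
    have h1 : |u r * y r| ≤ |y r| := by
      rw [abs_mul]
      exact mul_le_of_le_one_left (abs_nonneg _) (hc.bound r hr)
    refine ⟨by linarith [neg_abs_le (u r * y r)], ?_⟩
    by_cases hz : |Real.sin (x r)| < 2 * ε ∧ |y r| < 2 * ε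
    · rw [indicator_of_mem (show r ∈ Z from ⟨hr, hz⟩)]
      linarith [le_abs_self (u r * y r), hz.2]
    · rw [indicator_of_notMem (fun hm => hz hm.2), h.friction r hr hz]
      linarith [mul_comm (Real.sign (y r)) (y r),
        show y r * Real.sign (y r) = |y r| by
          rcases lt_trichotomy (y r) 0 with h0 | h0 | h0
          · rw [Real.sign_of_neg h0, abs_of_neg h0]; ring
          · simp [h0]
          · rw [Real.sign_of_pos h0, abs_of_pos h0]; ring]
  have hsub : ∀ r ∈ Icc 0 t, r ∈ Icc 0 T := fun r hr => ⟨hr.1, hr.2.trans ht.2⟩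
  have hZi : IntegrableOn (Z.indicator fun _ => 4 * ε) (Icc 0 t) :=
    (integrableOn_const (by simp)).indicator hZm
  have hlow : 0 ≤ ∫ r in (0 : ℝ)..t, (u r * y r + |y r|) :=
    integral_nonneg ht.1 fun r hr => (hb r (hsub r hr)).1
  have hup : ∫ r in (0 : ℝ)..t, (u r * y r + |y r|) ≤ 4 * ε * Λ := by
    calc ∫ r in (0 : ℝ)..t, (u r * y r + |y r|)
        ≤ ∫ r in (0 : ℝ)..t, Z.indicator (fun _ => 4 * ε) r :=
          integral_mono_on ht.1 (hi2.add hi1)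
            ((intervalIntegrable_iff_integrableOn_Icc_of_le ht.1).2 hZi)
            fun r hr => (hb r (hsub r hr)).2
      _ = 4 * ε * volume.real (Icc 0 t ∩ Z) := by
          rw [integral_of_le ht.1, ← integral_Icc_eq_integral_Ioc, setIntegral_indicator hZm,
            setIntegral_const, smul_eq_mul, mul_comm]
      _ ≤ 4 * ε * Λ := by
          refine mul_le_mul_of_nonneg_left ?_ (by positivity)
          exact ENNReal.toReal_le_of_le_ofReal h.zone_nonneg
            ((measure_mono inter_subset_right).trans h.zone_le)
  constructor
  · nlinarith
  · nlinarith

/-- The times at which the clock reaches given levels. -/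
theorem exists_hitting {k : ℝ → ℝ} (hT : 0 ≤ T) (hk : ContinuousOn k (Icc 0 T))
    (hanti : AntitoneOn k (Icc 0 T)) : ∃ τ : ℝ → ℝ, (∀ c, τ c ∈ Icc 0 T) ∧ τ (k 0) = 0 ∧
      (∀ c, k T ≤ c → k (τ c) = min c (k 0)) ∧ Antitone τ ∧
      ∀ c d, c < d → τ d = τ c ∨ ∀ t ∈ Icc (τ d) (τ c), k t ∈ Icc c d := by
  have h0 : (0 : ℝ) ∈ Icc 0 T := ⟨le_rfl, hT⟩
  have hT' : T ∈ Icc 0 T := ⟨hT, le_rfl⟩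
  -- Levels outside the range of `k` are assigned the times `0` and `T`, so a stretch between two
  -- levels that the motion never visits collapses to one time.
  have hex : ∀ c, ∃ t ∈ Icc 0 T, (k 0 ≤ c → t = 0) ∧ (c ≤ k T → c < k 0 → t = T) ∧
      (k T < c → c < k 0 → k t = c) := by
    intro c
    by_cases h1 : k 0 ≤ c
    · exact ⟨0, h0, fun _ => rfl, fun _ h => absurd h1 (not_le.2 h), fun _ h => absurd h1 (not_le.2 h)⟩
    by_cases h2 : c ≤ k T
    · exact ⟨T, hT', fun h => absurd h h1, fun _ _ => rfl, fun h _ => absurd h2 (not_le.2 h)⟩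
    push Not at h1 h2
    obtain ⟨t, ht, hc⟩ := intermediate_value_Icc' hT hk ⟨h2.le, h1.le⟩
    exact ⟨t, ht, fun h => absurd h (not_le.2 h1), fun h => absurd h (not_le.2 h2), fun _ _ => hc⟩
  choose τ hτ ha hb hc using hex
  have hle : ∀ c d, c < d → τ d ≤ τ c := by
    intro c d hcd
    rcases le_or_gt (k 0) d with h1 | h1
    · rw [ha d h1]; exact (hτ c).1
    rcases le_or_gt c (k T) with h2 | h2
    · rw [hb c h2 (hcd.trans h1)]; exact (hτ d).2
    by_contra! hn
    have := hanti (hτ c) (hτ d) hn.le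
    rw [hc c h2 (hcd.trans h1), hc d (h2.trans hcd) h1] at this
    linarith
  refine ⟨τ, hτ, ha _ le_rfl, fun c hc1 => ?_, fun c d hcd => hcd.eq_or_lt.elim (fun e => e ▸ le_rfl) (hle c d),
    fun c d hcd => ?_⟩
  · rcases le_or_gt (k 0) c with h1 | h1
    · rw [ha c h1, min_eq_right h1]
    rw [min_eq_left h1.le]
    rcases hc1.eq_or_lt with h2 | h2
    · rw [hb c h2.ge h1, h2]
    · exact hc c h2 h1
  rcases le_or_gt (k 0) c with h1 | h1
  · exact Or.inl ((ha d (h1.trans hcd.le)).trans (ha c h1).symm)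
  by_cases h2 : d ≤ k T ∧ d < k 0
  · exact Or.inl ((hb d h2.1 h2.2).trans (hb c (hcd.le.trans h2.1) h1).symm)
  refine Or.inr fun t ht => ?_
  have htT : t ∈ Icc 0 T := ⟨(hτ d).1.trans ht.1, ht.2.trans (hτ c).2⟩
  constructor
  · have h3 := hanti htT (hτ c) ht.2
    rcases le_or_gt c (k T) with h4 | h4
    · exact h4.trans (hanti htT hT' htT.2)
    · rwa [hc c h4 h1] at h3
  · have h3 := hanti (hτ d) htT ht.1
    rcases le_or_gt (k 0) d with h4 | h4
    · exact (hanti h0 htT htT.1).trans h4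
    · rwa [hc d (not_le.1 fun h5 => h2 ⟨h5, h4⟩) h4] at h3

/-- Velocities are bounded in terms of the energy. -/
theorem abs_le_of_en_le {x y M : ℝ} (h : en x y ≤ M) : |y| ≤ M + 1 := by
  have h1 := Real.cos_le_one x
  unfold en at h
  rw [← sq_abs] at h
  nlinarith [sq_nonneg (|y| - 1)]

/-- The time spent at regular energies. -/
theorem time_regular {p : ℝ → ℝ} {j₁ j₂ δ κ : ℝ} (hδ : 0 < δ) (hκ : 0 < κ)
    (hp : ContinuousOn p (Icc j₁ j₂))
    (hw : ∃ C, 0 ≤ C ∧ ∀ {ε a b β ω : ℝ} {x y u : ℝ → ℝ}, Controlled ε a b x y u → β ∈ Icc j₁ j₂ →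
      (∀ t ∈ Icc a b, en (x t) (y t) ∈ Icc j₁ (j₂ + δ) ∧ |en (x t) (y t) - β| ≤ ω) →
      |(b - a) - p β * (∫ t in a..b, |y t|)| ≤ C + C * (ω + ε) * (b - a)) :
    ∃ ε₀ > 0, ∃ C' ≥ 0, ∀ {ε T Λ a b : ℝ} {x y u : ℝ → ℝ}, Braked ε T Λ x y u → ε < ε₀ →
      4 * ε ^ 2 * Λ < ε₀ → 0 ≤ a → a ≤ b → b ≤ T → (∀ t ∈ Icc a b, clock ε x y t ∈ Icc j₁ j₂) →
      |(b - a) - (∫ e in clock ε x y b..clock ε x y a, p e) / ε| ≤ κ * (b - a) + C' := by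
  obtain ⟨C, hC, hw⟩ := hw
  obtain ⟨ε₀, hε₀, C', hC', H⟩ :=
    regular_of_window (Y := |j₂ + δ| + 1) hp hC (by positivity) hκ
  refine ⟨min ε₀ δ, lt_min hε₀ hδ, C', hC', fun {ε T Λ a b x y u} h hε hη ha hab hb hk => ?_⟩
  have hc := h.ctrl.mono hab ha hb
  have hcl : IsClock ε a b y (clock ε x y) := (isClock h.ctrl).mono ha hb
  have hE : ∀ t ∈ Icc a b, en (x t) (y t)
      ∈ Icc (clock ε x y t) (clock ε x y t + 4 * ε ^ 2 * Λ) := fun t ht =>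
    h.en_mem ⟨ha.trans ht.1, ht.2.trans hb⟩
  have hη' := hη.trans_le (min_le_right _ _)
  have hE' : ∀ t ∈ Icc a b, en (x t) (y t) ∈ Icc j₁ (j₂ + δ) := fun t ht =>
    ⟨(hk t ht).1.trans (hE t ht).1, (hE t ht).2.trans (by linarith [(hk t ht).2])⟩
  refine H hc (hε.trans_le (min_le_left _ _)) (hη.trans_le (min_le_left _ _)) hcl hk
    (fun t ht => abs_le_of_en_le ((hE' t ht).2.trans (le_abs_self _))) fun s hs t ht hst => ?_
  refine hw (hc.mono hst hs.1 ht.2) (hk s hs) fun r hr => ?_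
  have hr' : r ∈ Icc a b := ⟨hs.1.trans hr.1, hr.2.trans ht.2⟩
  refine ⟨hE' r hr', ?_⟩
  have h1 := hcl.antitone hc.eps_pos hs hr' hr.1
  have h2 := hcl.antitone hc.eps_pos hr' ht hr.2
  have h3 := hE r hr'
  have h4 : 0 ≤ 4 * ε ^ 2 * Λ := by have := h.zone_nonneg; positivity
  rw [abs_le]
  constructor <;> linarith [h3.1, h3.2]

/-- The window estimate is taken at `δ / 2`, because the energy may lie above the clock and hence
above `2 - δ`. -/
theorem time_regular_low {δ κ : ℝ} (hδ : 0 < δ) (hκ : 0 < κ) :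
    ∃ ε₀ > 0, ∃ C' ≥ 0, ∀ {ε T Λ a b : ℝ} {x y u : ℝ → ℝ}, Braked ε T Λ x y u → ε < ε₀ →
      4 * ε ^ 2 * Λ < ε₀ → 0 ≤ a → a ≤ b → b ≤ T →
      (∀ t ∈ Icc a b, clock ε x y t ∈ Icc δ (2 - δ)) →
      |(b - a) - (∫ e in clock ε x y b..clock ε x y a, rate e) / ε| ≤ κ * (b - a) + C' := by
  refine time_regular (δ := δ / 2) (by positivity) hκ (continuousOn_rate_low hδ) ?_
  obtain ⟨C, hC, H⟩ := window_low (δ := δ / 2) (by positivity)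
  refine ⟨C, hC, fun {ε a b β ω x y u} h hβ hE => ?_⟩
  rw [rate, if_pos (by linarith [hβ.2])]
  exact H h ⟨by linarith [hβ.1], by linarith [hβ.2]⟩ fun t ht =>
    ⟨⟨by linarith [(hE t ht).1.1], by linarith [(hE t ht).1.2]⟩, (hE t ht).2⟩

theorem time_regular_high {δ κ : ℝ} (M : ℝ) (hδ : 0 < δ) (hκ : 0 < κ) :
    ∃ ε₀ > 0, ∃ C' ≥ 0, ∀ {ε T Λ a b : ℝ} {x y u : ℝ → ℝ}, Braked ε T Λ x y u → ε < ε₀ →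
      4 * ε ^ 2 * Λ < ε₀ → 0 ≤ a → a ≤ b → b ≤ T →
      (∀ t ∈ Icc a b, clock ε x y t ∈ Icc (2 + δ) M) →
      |(b - a) - (∫ e in clock ε x y b..clock ε x y a, rate e) / ε| ≤ κ * (b - a) + C' := by
  refine time_regular hδ hκ (continuousOn_rate_high hδ) ?_
  obtain ⟨C, hC, H⟩ := window_high hδ
  refine ⟨C, hC, fun {ε a b β ω x y u} h hβ hE => ?_⟩
  rw [rate, if_neg (by linarith [hβ.1])]
  exact H h hβ.1 fun t ht => ⟨(hE t ht).1.1, (hE t ht).2⟩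

/-- The time spent at energies near the critical values, outside their cores. -/
theorem time_critical (h : Braked ε T Λ x y u) {a b c σ : ℝ} (ha : 0 ≤ a) (hab : a ≤ b)
    (hb : b ≤ T) (hσc : σ = 1 ∧ (c = 0 ∨ c = 2) ∨ σ = -1 ∧ c = 2) (hη : 16 * ε ^ 2 ≤ η)
    (hηΛ : 4 * ε ^ 2 * Λ ≤ η) (hδ : δ ≤ 1 / 2)
    (hk : ∀ t ∈ Icc a b, σ * (clock ε x y t - c) ∈ Icc (2 * η) δ) :
    b - a ≤ 30 + 124 * (√δ / ε) := by
  have hc := h.ctrl.mono hab ha hb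
  have hη0 : 0 < η := by have := hc.eps_pos; exact lt_of_lt_of_le (by positivity) hη
  refine hc.time_le_near_critical ((isClock h.ctrl).mono ha hb) (c := c) (σ := σ)
    (by rcases hσc with h | h <;> simp [h.1]) (fun t ht => by linarith [(hk t ht).1])
    (fun t ht => (hk t ht).2) (fun t ht => ?_) (fun t ht => ?_)
  -- The energy lies between the clock and the clock plus `η`, while the clock is at least `2 η`
  -- away from `c`; so the energy keeps at least half of that distance.
  all_goals
    have h1 := hk t ht
    have h2 := h.en_mem ⟨ha.trans ht.1, ht.2.trans hb⟩
    unfold en at h2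
    obtain ⟨h1l, h1u⟩ := h1
    obtain ⟨h2l, h2u⟩ := h2
    rcases hσc with ⟨rfl, rfl | rfl⟩ | ⟨rfl, rfl⟩
  · linarith
  · linarith
  · linarith
  · rw [abs_of_neg] <;> linarith
  · rw [abs_of_pos] <;> linarith
  · rw [abs_of_neg] <;> linarith

theorem time_core (h : Braked ε T Λ x y u) {a b ω : ℝ} (ha : 0 ≤ a) (hab : a ≤ b)
    (hb : b ≤ T) (hk : clock ε x y a - clock ε x y b ≤ ω) :
    b - a ≤ 30 + 16 * (ω / ε ^ 2) + 7 * Λ := by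
  have hc := h.ctrl.mono hab ha hb
  refine hc.time_le_core ((isClock h.ctrl).mono ha hb) (measurableSet_zone h.ctrl)
    (fun t ht h1 h2 => ⟨⟨ha.trans ht.1.le, ht.2.le.trans hb⟩, h2, h1⟩) h.zone_nonneg
    ((measure_mono inter_subset_left).trans h.zone_le) hk

end Braked

/-! ### The damping time -/

theorem integral_rate_sub {a b : ℝ} (ha : 0 ≤ a) (hb : 0 ≤ b) :
    ∫ e in a..b, rate e = (∫ e in (0 : ℝ)..b, rate e) - ∫ e in (0 : ℝ)..a, rate e :=
  (integral_interval_sub_left (intervalIntegrable_rate le_rfl hb)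
    (intervalIntegrable_rate le_rfl ha)).symm

theorem integral_rate_mono {a b : ℝ} (ha : 0 ≤ a) (hab : a ≤ b) :
    ∫ e in (0 : ℝ)..a, rate e ≤ ∫ e in (0 : ℝ)..b, rate e := by
  have h := integral_rate_sub ha (ha.trans hab)
  have h1 : 0 ≤ ∫ e in a..b, rate e := by
    refine integral_nonneg_of_ae_restrict hab ?_
    rw [EventuallyLE, ae_restrict_iff' measurableSet_Icc]
    have h0 : ∀ᵐ t : ℝ, t ≠ 0 := by simp [ae_iff, measure_singleton]
    have h2 : ∀ᵐ t : ℝ, t ≠ 2 := by simp [ae_iff, measure_singleton]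
    filter_upwards [h0, h2] with t h0 h2 ht
    exact rate_nonneg (lt_of_le_of_ne (ha.trans ht.1) h0.symm) h2
  linarith

theorem continuousOn_integral_rate : ContinuousOn (fun b => ∫ e in (0 : ℝ)..b, rate e) (Icc 0 3) := by
  have h := intervalIntegrable_rate le_rfl (by norm_num : (0 : ℝ) ≤ 3)
  have := continuousOn_primitive_interval' h left_mem_uIcc
  rwa [uIcc_of_le (by norm_num)] at this

/-- The primitive of `rate` is continuous, so small neighbourhoods of `0` and `2` contribute little
to it. The factor `372 = 3 * 124` stands for the three critical stretches: above `2`, below `2` and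
above `0`. -/
theorem exists_level {κ : ℝ} (hκ : 0 < κ) : ∃ δ > 0, δ ≤ 1 / 2 ∧ 372 * √δ ≤ κ ∧
    (∫ e in (0 : ℝ)..δ, rate e) ≤ κ ∧
    (∫ e in (0 : ℝ)..(2 + δ), rate e) - (∫ e in (0 : ℝ)..(2 - δ), rate e) ≤ κ := by
  have hc := continuousOn_integral_rate
  have h1 : ∀ᶠ δ in 𝓝[>] (0 : ℝ), δ ∈ Ioc (0 : ℝ) (1 / 2) :=
    Ioc_mem_nhdsGT (by norm_num)
  have hsub : ∀ (f : ℝ → ℝ) (c : ℝ), Continuous f → f 0 = c → c ∈ Icc (0 : ℝ) 3 →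
      (∀ δ ∈ Ioc (0 : ℝ) (1 / 2), f δ ∈ Icc (0 : ℝ) 3) →
      Tendsto (fun δ => ∫ e in (0 : ℝ)..f δ, rate e) (𝓝[>] 0) (𝓝 (∫ e in (0 : ℝ)..c, rate e)) := by
    intro f c hf h0 hc3 hm
    refine (hc c hc3).tendsto.comp (tendsto_nhdsWithin_iff.2 ⟨?_, h1.mono hm⟩)
    exact h0 ▸ hf.continuousAt.tendsto.mono_left nhdsWithin_le_nhds
  have t0 := hsub (fun δ => δ) 0 continuous_id rfl ⟨le_rfl, by norm_num⟩ fun δ hδ =>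
    ⟨hδ.1.le, by linarith [hδ.2]⟩
  have t1 := hsub (fun δ => 2 + δ) 2 (by fun_prop) (by norm_num) ⟨by norm_num, by norm_num⟩
    fun δ hδ => ⟨by linarith [hδ.1], by linarith [hδ.2]⟩
  have t2 := hsub (fun δ => 2 - δ) 2 (by fun_prop) (by norm_num) ⟨by norm_num, by norm_num⟩
    fun δ hδ => ⟨by linarith [hδ.2], by linarith [hδ.1]⟩
  have t3 : Tendsto (fun δ : ℝ => 372 * √δ) (𝓝[>] 0) (𝓝 0) := by
    have : Continuous fun δ : ℝ => 372 * √δ := by fun_prop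
    simpa using (this.tendsto 0).mono_left (nhdsWithin_le_nhds (s := Ioi (0 : ℝ)))
  have t12 := t1.sub t2
  rw [sub_self] at t12
  rw [integral_same] at t0
  obtain ⟨δ, h1, h2, h3, h4⟩ := (h1.and ((t3.eventually_le_const hκ).and
    ((t0.eventually_le_const hκ).and (t12.eventually_le_const hκ)))).exists
  exact ⟨δ, h1.1, h1.2, h2, h3, h4⟩

/-- The clock range is cut at `2 + δ`, `2 + 2 η`, `2 - 2 η`, `2 - δ`, `δ` and `2 η`. Two regular
stretches carry the integral of `rate`, three critical ones take a time of order `√δ / ε`, and two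
cores one of order `1 + Λ`. -/
theorem Braked.time_estimate (M : ℝ) {κ : ℝ} (hκ : 0 < κ) : ∃ ε₀ > 0,
    ∀ {ε T Λ : ℝ} {x y u : ℝ → ℝ}, Braked ε T Λ x y u → ε < ε₀ → ε * Λ < ε₀ →
      en (x 0) (y 0) ≤ M → |ε * T - ∫ e in (0 : ℝ)..en (x 0) (y 0), rate e| ≤ κ := by
  set R : ℝ → ℝ := fun b => ∫ e in (0 : ℝ)..b, rate e with hR
  set κ₁ := κ / 6 with hκ₁
  have hκ₁0 : 0 < κ₁ := by positivity
  set M' := max M 0 with hM'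
  have hM0 : 0 ≤ M' := le_max_right _ _
  have hRM : 0 ≤ R M' := by
    have := integral_rate_mono le_rfl hM0
    rwa [integral_same] at this
  -- The relative error `κ₂` multiplies the unknown `T`. From `κ₂ ≤ 1 / 2` follows the a priori
  -- bound `ε * T ≤ B`, and then `κ₂ * B ≤ κ₁` is the sixth error of size `κ₁`.
  set B := 2 * (R M' + 5 * κ₁) with hB
  have hB0 : 0 < B := by positivity
  set κ₂ := min (1 / 2) (κ₁ / B) with hκ₂
  have hκ₂0 : 0 < κ₂ := lt_min (by norm_num) (by positivity)
  have hκ₂B : κ₂ * B ≤ κ₁ := by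
    calc κ₂ * B ≤ κ₁ / B * B := by gcongr; exact min_le_right _ _
      _ = κ₁ := div_mul_cancel₀ _ hB0.ne'
  have hκ₂h : κ₂ ≤ 1 / 2 := min_le_left _ _
  obtain ⟨δ, hδ0, hδ, hδs, hδ1, hδ2⟩ := exists_level hκ₁0
  obtain ⟨ε₁, hε₁, C₁, hC₁, H₁⟩ := time_regular_high M hδ0 hκ₂0
  obtain ⟨ε₂, hε₂, C₂, hC₂, H₂⟩ := time_regular_low hδ0 hκ₂0
  -- `2198 = 5 * 30 + 2 * 1024` collects the constants of the critical stretches and the cores; the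
  -- two cores also give `526 Λ = 2 * (256 + 7) Λ`.
  set D := C₁ + C₂ + 2198 with hD
  have hD0 : 0 < D := by positivity
  refine ⟨min (min (ε₁ / 4) (ε₂ / 4)) (min (min 1 (δ / 40)) (min (κ₁ / D) (κ₁ / 526))), by positivity,
    fun {ε T Λ x y u} h hε hΛ hM => ?_⟩
  simp only [lt_min_iff] at hε hΛ
  obtain ⟨⟨ha1, ha2⟩, ⟨ha3, ha4⟩, ha5, ha6⟩ := hε
  obtain ⟨⟨hb1, hb2⟩, ⟨hb3, hb4⟩, hb5, hb6⟩ := hΛ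
  have hε0 := h.ctrl.eps_pos
  have hT := h.ctrl.le
  have hΛ0 := h.zone_nonneg
  have hεΛ : 4 * ε ^ 2 * Λ ≤ 4 * (ε * Λ) := by
    have : ε * (ε * Λ) ≤ 1 * (ε * Λ) := by gcongr
    nlinarith
  -- The first summand is what the critical estimate requires, the second bounds the gap between
  -- energy and clock. Division by `ε²` leaves only a multiple of `1 + Λ`.
  set η := 16 * ε ^ 2 + 4 * ε ^ 2 * Λ with hη
  have hη0 : 0 < η := by positivity
  have hη1 : 16 * ε ^ 2 ≤ η := by rw [hη]; have : 0 ≤ 4 * ε ^ 2 * Λ := by positivity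
                                  linarith
  have hη2 : 4 * ε ^ 2 * Λ ≤ η := by rw [hη]; have : 0 ≤ ε ^ 2 := by positivity
                                     linarith
  have hηδ : 2 * η < δ := by
    have : ε ^ 2 ≤ 1 * ε := by rw [sq]; gcongr
    linarith
  have hηdiv : 64 * η / ε ^ 2 = 1024 + 256 * Λ := by
    rw [hη]; field_simp; ring
  set k := clock ε x y with hk
  have hkc : IsClock ε 0 T y k := isClock h.ctrl
  obtain ⟨τ, hτ, hτ0, hτk, hanti, hlev⟩ := exists_hitting hT (hkc.continuousOn h.ctrl)
    (fun s hs t ht hst => hkc.antitone hε0 hs ht hst)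
  have hk0 : k 0 = en (x 0) (y 0) := clock_zero
  set E := en (x 0) (y 0) with hE
  have hE0 : 0 ≤ E := en_nonneg _ _
  have hkT := h.en_mem h.ctrl.right_mem
  rw [h.finish] at hkT
  have hkT0 : k T ≤ 0 := hkT.1
  have hkTη : -η ≤ k T := by linarith [hkT.2]
  rw [hk0] at hτ0 hτk
  have hττ : ∀ c, 0 ≤ c → k (τ c) = min c E := fun c hc => hτk c (hkT0.trans hc)
  -- the seven stretches
  have s1 : |(τ (2 + δ) - 0) - (R E - R (min (2 + δ) E)) / ε| ≤ κ₂ * (τ (2 + δ) - 0) + C₁ := by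
    have := H₁ h (by linarith) (by linarith) le_rfl (hτ (2 + δ)).1 (hτ (2 + δ)).2
    rw [← hk, hττ _ (by linarith), hk0,
      integral_rate_sub (le_min (by linarith) hE0) hE0] at this
    rcases le_or_gt E (2 + δ) with h1 | h1
    · have h2 : τ (2 + δ) = 0 := le_antisymm (hτ0 ▸ hanti h1) (hτ _).1
      rw [h2, min_eq_right h1]; simpa using hC₁
    · refine this fun t ht => ⟨?_, ?_⟩
      · have h3 := hkc.antitone hε0 ⟨ht.1, ht.2.trans (hτ _).2⟩ (hτ (2 + δ)) ht.2
        rwa [hττ _ (by linarith), min_eq_left h1.le] at h3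
      · have h3 := hkc.antitone hε0 h.ctrl.left_mem ⟨ht.1, ht.2.trans (hτ _).2⟩ ht.1
        linarith
  have s2 : τ (2 + 2 * η) - τ (2 + δ) ≤ 30 + 124 * (√δ / ε) := by
    rcases hlev (2 + 2 * η) (2 + δ) (by linarith) with h1 | h1
    · rw [h1, sub_self]; positivity
    · exact h.time_critical (hτ _).1 (hanti (by linarith)) (hτ _).2 (c := 2) (σ := 1)
        (Or.inl ⟨rfl, Or.inr rfl⟩) hη1 hη2 hδ fun t ht =>
          ⟨by linarith [(h1 t ht).1], by linarith [(h1 t ht).2]⟩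
  have s3 : τ (2 - 2 * η) - τ (2 + 2 * η) ≤ 30 + 16 * (4 * η / ε ^ 2) + 7 * Λ := by
    refine h.time_core (hτ _).1 (hanti (by linarith)) (hτ _).2 ?_
    rw [← hk, hττ _ (by linarith), hττ _ (by linarith)]
    have := min_le_left (2 + 2 * η) E
    rcases le_total E (2 - 2 * η) with h1 | h1
    · rw [min_eq_right h1, min_eq_right (by linarith)]; linarith
    · rw [min_eq_left h1]; linarith
  have s4 : τ (2 - δ) - τ (2 - 2 * η) ≤ 30 + 124 * (√δ / ε) := by
    rcases hlev (2 - δ) (2 - 2 * η) (by linarith) with h1 | h1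
    · rw [h1, sub_self]; positivity
    · exact h.time_critical (hτ _).1 (hanti (by linarith)) (hτ _).2 (c := 2) (σ := -1)
        (Or.inr ⟨rfl, rfl⟩) hη1 hη2 hδ fun t ht =>
          ⟨by linarith [(h1 t ht).2], by linarith [(h1 t ht).1]⟩
  have s5 : |(τ δ - τ (2 - δ)) - (R (min (2 - δ) E) - R (min δ E)) / ε|
      ≤ κ₂ * (τ δ - τ (2 - δ)) + C₂ := by
    have := H₂ h (by linarith) (by linarith) (hτ (2 - δ)).1 (hanti (by linarith : δ ≤ 2 - δ))
      (hτ δ).2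
    rw [← hk, hττ _ (by linarith), hττ _ (by linarith),
      integral_rate_sub (le_min (by linarith) hE0) (le_min (by linarith) hE0)] at this
    rcases hlev δ (2 - δ) (by linarith) with h1 | h1
    · have h2 := hττ δ hδ0.le
      have h3 := hττ (2 - δ) (by linarith)
      rw [h1, h2] at h3
      rw [h1, h3]; simpa using hC₂
    · exact this h1
  have s6 : τ (2 * η) - τ δ ≤ 30 + 124 * (√δ / ε) := by
    rcases hlev (2 * η) δ (by linarith) with h1 | h1
    · rw [h1, sub_self]; positivity
    · exact h.time_critical (hτ _).1 (hanti (by linarith)) (hτ _).2 (c := 0) (σ := 1)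
        (Or.inl ⟨rfl, Or.inl rfl⟩) hη1 hη2 hδ fun t ht =>
          ⟨by linarith [(h1 t ht).1], by linarith [(h1 t ht).2]⟩
  have s7 : T - τ (2 * η) ≤ 30 + 16 * (4 * η / ε ^ 2) + 7 * Λ := by
    refine h.time_core (hτ _).1 (hτ _).2 le_rfl ?_
    rw [← hk, hττ _ (by linarith)]
    have := min_le_left (2 * η) E
    linarith
  have m1 : 0 ≤ R (min (2 + δ) E) - R (min (2 - δ) E) ∧
      R (min (2 + δ) E) - R (min (2 - δ) E) ≤ κ₁ := by
    constructor
    · exact sub_nonneg.2 (integral_rate_mono (le_min (by linarith) hE0)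
        (min_le_min_right _ (by linarith)))
    · rcases le_total E (2 - δ) with h1 | h1
      · rw [min_eq_right h1, min_eq_right (by linarith), sub_self]; exact hκ₁0.le
      · rw [min_eq_left h1]
        exact (sub_le_sub_right (integral_rate_mono (le_min (by linarith) hE0)
          (min_le_left _ _)) _).trans hδ2
  have m2 : 0 ≤ R (min δ E) ∧ R (min δ E) ≤ κ₁ := by
    have h1 := integral_rate_mono le_rfl (le_min hδ0.le hE0)
    rw [integral_same] at h1
    exact ⟨h1, (integral_rate_mono (le_min hδ0.le hE0) (min_le_left _ _)).trans hδ1⟩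
  have hRE : R E ≤ R M' := integral_rate_mono hE0 (hM.trans (le_max_left _ _))
  have o2 : τ (2 + δ) ≤ τ (2 + 2 * η) := hanti (by linarith)
  have o3 : τ (2 + 2 * η) ≤ τ (2 - 2 * η) := hanti (by linarith)
  have o4 : τ (2 - 2 * η) ≤ τ (2 - δ) := hanti (by linarith)
  have o5 : τ (2 - δ) ≤ τ δ := hanti (by linarith)
  have o6 : τ δ ≤ τ (2 * η) := hanti (by linarith)
  have o7 := (hτ (2 * η)).2
  have o1 := (hτ (2 + δ)).1
  have hdv : 16 * (4 * η / ε ^ 2) = 1024 + 256 * Λ := by rw [← hηdiv]; ring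
  rw [hdv] at s3 s7
  have key : |T - R E / ε| ≤ κ₂ * T + D + 526 * Λ + (372 * √δ + 2 * κ₁) / ε := by
    rw [abs_le] at s1 s5 ⊢
    have e1 : (R E - R (min (2 + δ) E)) / ε + (R (min (2 + δ) E) - R (min (2 - δ) E)) / ε
      + (R (min (2 - δ) E) - R (min δ E)) / ε + R (min δ E) / ε = R E / ε := by ring
    have e2 : (372 * √δ + 2 * κ₁) / ε = 3 * (124 * (√δ / ε)) + 2 * (κ₁ / ε) := by ring
    have q1 : 0 ≤ (R (min (2 + δ) E) - R (min (2 - δ) E)) / ε := div_nonneg m1.1 hε0.le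
    have q2 : (R (min (2 + δ) E) - R (min (2 - δ) E)) / ε ≤ κ₁ / ε := by gcongr; exact m1.2
    have q3 : 0 ≤ R (min δ E) / ε := div_nonneg m2.1 hε0.le
    have q4 : R (min δ E) / ε ≤ κ₁ / ε := by gcongr; exact m2.2
    have q5 : 0 ≤ √δ / ε := by positivity
    have q6 : κ₂ * (τ (2 + δ) - 0) + κ₂ * (τ δ - τ (2 - δ)) ≤ κ₂ * T := by
      rw [← mul_add]; gcongr; linarith
    rw [e2]
    constructor <;> linarith [s1.1, s1.2, s5.1, s5.2]
  have key2 : |ε * T - R E| ≤ κ₂ * (ε * T) + 5 * κ₁ := by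
    have e1 : ε * T - R E = ε * (T - R E / ε) := by field_simp
    rw [e1, abs_mul, abs_of_pos hε0]
    have e2 : ε * (κ₂ * T + D + 526 * Λ + (372 * √δ + 2 * κ₁) / ε)
        = κ₂ * (ε * T) + ε * D + 526 * (ε * Λ) + (372 * √δ + 2 * κ₁) := by field_simp
    have e3 := mul_le_mul_of_nonneg_left key hε0.le
    rw [e2] at e3
    have e4 : ε * D ≤ κ₁ := by rw [← le_div_iff₀ hD0]; exact ha5.le
    linarith
  have hεT : ε * T ≤ B := by
    have h1 := (abs_le.1 key2).2
    have h2 : κ₂ * (ε * T) ≤ 1 / 2 * (ε * T) := by gcongr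
    linarith
  have : κ₂ * (ε * T) ≤ κ₂ * B := by gcongr
  linarith

/-! ### Passage to the limit for the damping time. -/

theorem tendsto_ofReal_of_forall {F : ℝ → ℝ≥0∞} {l : Filter ℝ} {c : ℝ}
    (h : ∀ κ > 0, ∀ᶠ ε in l, ENNReal.ofReal (c - κ) ≤ F ε ∧ F ε ≤ ENNReal.ofReal (c + κ)) :
    Tendsto F l (𝓝 (ENNReal.ofReal c)) := by
  have key : ∀ f : ℝ → ℝ, Continuous f → f 0 = c →
      Tendsto (fun κ => ENNReal.ofReal (f κ)) (𝓝[>] 0) (𝓝 (ENNReal.ofReal c)) := fun f hf h0 =>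
    h0 ▸ ((ENNReal.continuous_ofReal.comp hf).tendsto 0).mono_left nhdsWithin_le_nhds
  rw [tendsto_order]
  constructor
  · intro a ha
    obtain ⟨κ, h1, h2⟩ := (((key (fun κ => c - κ) (by fun_prop) (by simp)).eventually_const_lt
      ha).and self_mem_nhdsWithin).exists
    exact (h κ h2).mono fun ε hε => h1.trans_le hε.1
  · intro a ha
    obtain ⟨κ, h1, h2⟩ := (((key (fun κ => c + κ) (by fun_prop) (by simp)).eventually_lt_const
      ha).and self_mem_nhdsWithin).exists
    exact (h κ h2).mono fun ε hε => hε.2.trans_lt h1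

theorem tendsto_mul_log_inv (C : ℝ) :
    Tendsto (fun ε : ℝ => ε * (C * Real.log (1 / ε))) (𝓝[>] 0) (𝓝 0) := by
  have h := (tendsto_log_mul_rpow_nhdsGT_zero zero_lt_one).const_mul (-C)
  rw [mul_zero] at h
  refine h.congr fun ε => ?_
  rw [one_div, Real.log_inv, Real.rpow_one]; ring

theorem IsQuasioptimal.exists_braked {m : ℝ → Phase → Motion} (hm : IsQuasioptimal m) :
    ∃ Λ : ℝ → ℝ, Tendsto (fun ε => ε * Λ ε) (𝓝[>] 0) (𝓝 0) ∧
      ∀ᶠ ε in 𝓝[>] (0 : ℝ), ∀ p, (m ε p).IsDamping ε p ∧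
        Braked ε (m ε p).T (Λ ε) (m ε p).x (m ε p).y (m ε p).u ∧
        (({t ∈ (m ε p).switchings | (m ε p).state t ∈ closure (standstill ε)}.encard : ℕ∞) : ℝ≥0∞)
          ≤ ENNReal.ofReal (Λ ε) := by
  obtain ⟨C, hC⟩ := hm.zone
  refine ⟨fun ε => |C| * Real.log (1 / ε), tendsto_mul_log_inv _, ?_⟩
  filter_upwards [hm.isDamping, hm.dryFriction, hC, Ioo_mem_nhdsGT (zero_lt_one (α := ℝ))]
    with ε h1 h2 h3 h4 p
  have hlog : 0 ≤ Real.log (1 / ε) := Real.log_nonneg (by rw [le_div_iff₀ h4.1]; linarith [h4.2])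
  have hle : ENNReal.ofReal (C * Real.log (1 / ε)) ≤ ENNReal.ofReal (|C| * Real.log (1 / ε)) :=
    ENNReal.ofReal_le_ofReal (mul_le_mul_of_nonneg_right (le_abs_self C) hlog)
  exact ⟨h1 p, (h1 p).braked h4.1 (h2 p) (mul_nonneg (abs_nonneg C) hlog) ((h3 p).1.trans hle),
    (h3 p).2.trans hle⟩

theorem en_start {ε : ℝ} {p : Phase} {m : Motion} (h : m.IsDamping ε p) :
    en (m.x 0) (m.y 0) = energy p := by
  rw [← energy_state, h.start]

theorem energy_nonneg (p : Phase) : 0 ≤ energy p := by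
  obtain ⟨θ, y⟩ := p
  induction θ using Real.Angle.induction_on with
  | h x => exact en_nonneg x y

/-- `Braked.time_estimate` is uniform over initial energies up to `E`. A point of maximal energy
gives the lower bound, and monotonicity of the integral of `rate` the upper one. -/
theorem tendsto_dampingTime {m : ℝ → Phase → Motion} (hm : IsQuasioptimal m) {K : Set Phase} {E : ℝ}
    (hE : IsGreatest (energy '' K) E) :
    Tendsto (fun ε : ℝ => ENNReal.ofReal ε * dampingTime m K ε) (𝓝[>] 0)
      (𝓝 (ENNReal.ofReal (tau E))) := by
  obtain ⟨p₀, hp₀, hpE⟩ := hE.1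
  have hE0 : 0 ≤ E := hpE ▸ energy_nonneg p₀
  rw [tau_eq hE0]
  obtain ⟨Λ, hΛ, hm⟩ := hm.exists_braked
  refine tendsto_ofReal_of_forall fun κ hκ => ?_
  obtain ⟨ε₀, hε₀, H⟩ := Braked.time_estimate E hκ
  filter_upwards [hm, hΛ.eventually_lt_const hε₀, Ioo_mem_nhdsGT hε₀] with ε h1 h2 h3
  have key : ∀ p ∈ K, |ε * (m ε p).T - ∫ e in (0 : ℝ)..energy p, rate e| ≤ κ := fun p hp => by
    have := H (h1 p).2.1 h3.2 h2 (by rw [en_start (h1 p).1]; exact hE.2 ⟨p, hp, rfl⟩)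
    rwa [en_start (h1 p).1] at this
  constructor
  · have h4 := (abs_le.1 (key p₀ hp₀)).1
    rw [hpE] at h4
    calc ENNReal.ofReal ((∫ e in (0 : ℝ)..E, rate e) - κ)
        ≤ ENNReal.ofReal (ε * (m ε p₀).T) := ENNReal.ofReal_le_ofReal (by linarith)
      _ = ENNReal.ofReal ε * ENNReal.ofReal (m ε p₀).T := ENNReal.ofReal_mul h3.1.le
      _ ≤ _ := by
        gcongr
        exact le_iSup₂ (f := fun p _ => ENNReal.ofReal (m ε p).T) p₀ hp₀
  · rw [dampingTime, ENNReal.mul_iSup]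
    refine iSup_le fun p => ?_
    rw [ENNReal.mul_iSup]
    refine iSup_le fun hp => ?_
    rw [← ENNReal.ofReal_mul h3.1.le]
    refine ENNReal.ofReal_le_ofReal ?_
    have h4 := (abs_le.1 (key p hp)).2
    have h5 := integral_rate_mono (energy_nonneg p) (hE.2 ⟨p, hp, rfl⟩)
    linarith

/-! ### Spacing of the turning points -/

/-- Jordan's inequality, with `π / 2 < 8 / 5`. -/
theorem arcsin_le_of_nonneg {ε : ℝ} (h0 : 0 ≤ ε) (h1 : ε ≤ 1) : Real.arcsin ε ≤ 8 / 5 * ε := by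
  have h := Real.mul_le_sin (Real.arcsin_nonneg.2 h0) (Real.arcsin_le_pi_div_two ε)
  rw [Real.sin_arcsin (by linarith) h1] at h
  have hpi := Real.pi_pos
  have h2 : Real.arcsin ε ≤ Real.pi / 2 * ε := by
    rw [div_mul_eq_mul_div, div_le_iff₀ hpi] at h
    linarith
  have := Real.pi_lt_d2
  nlinarith

theorem le_sin_of_mem {ε v : ℝ} (h0 : 0 ≤ ε) (h1 : ε ≤ 1)
    (hv : v ∈ Icc (Real.arcsin ε) (Real.pi - Real.arcsin ε)) : ε ≤ Real.sin v := by
  have h2 := Real.arcsin_nonneg.2 h0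
  have h3 := Real.arcsin_le_pi_div_two ε
  rw [← Real.sin_arcsin (by linarith : -1 ≤ ε) h1]
  rcases le_total v (Real.pi / 2) with h | h
  · exact Real.sin_le_sin_of_le_of_le_pi_div_two (by linarith) h hv.1
  · rw [← Real.sin_pi_sub v]
    exact Real.sin_le_sin_of_le_of_le_pi_div_two (by linarith) (by linarith) (by linarith [hv.2])

theorem arcsin_lt_of_lt_sin {ε v : ℝ} (h0 : 0 ≤ ε) (hv : v ∈ Ioo 0 Real.pi)
    (h : ε < Real.sin v) : v ∈ Ioo (Real.arcsin ε) (Real.pi - Real.arcsin ε) := by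
  have h1 : ε ≤ 1 := h.le.trans (Real.sin_le_one v)
  have h3 := Real.arcsin_le_pi_div_two ε
  have h4 : ∀ w, 0 < w → ε < Real.sin w → Real.arcsin ε < w := by
    intro w hw hs
    by_contra! hn
    have := Real.sin_le_sin_of_le_of_le_pi_div_two (by linarith [Real.pi_pos]) h3 hn
    rw [Real.sin_arcsin (by linarith) h1] at this
    linarith
  refine ⟨h4 v hv.1 h, ?_⟩
  have := h4 (Real.pi - v) (by linarith [hv.2]) (by rwa [Real.sin_pi_sub])
  linarith

namespace Controlled

variable {ε a b : ℝ} {x y u : ℝ → ℝ}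

theorem abs_angle_sub_le (h : Controlled ε a b x y u) {s t : ℝ} (hs : s ∈ Icc a b)
    (ht : t ∈ Icc a b) (hst : s ≤ t) : |x t - x s| ≤ ∫ r in s..t, |y r| := by
  rw [h.angle s hs t ht]
  exact abs_integral_le_integral_abs hst

/-- Where `sin x ≥ ε` the force is nonpositive for every admissible control. Released at rest, the
pendulum starts downwards and cannot stop before `sin x` has fallen to `ε`, that is, before the
angle `arcsin ε`. -/
theorem exists_swing_aux (h : Controlled ε a b x y u) (hab : a < b) (hya : y a = 0) (hyb : y b = 0)
    (hx : x a ∈ Ioo 0 Real.pi) (hs : ε < Real.sin (x a)) :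
    ∃ s ∈ Ioo a b, (∀ r ∈ Ioo a s, y r < 0 ∧ 0 < Real.sin (x r)) ∧ x s = Real.arcsin ε := by
  have hε := h.eps_pos
  have hε1 : ε ≤ 1 := hs.le.trans (Real.sin_le_one _)
  have hα := Real.arcsin_nonneg.2 hε.le
  have hx' := arcsin_lt_of_lt_sin hε.le hx hs
  set m := (ε + Real.sin (x a)) / 2 with hm
  have hma : m < Real.sin (x a) := by rw [hm]; linarith
  have hmε : ε < m := by rw [hm]; linarith
  have hev : ∀ᶠ r in 𝓝[Icc a b] a, m < Real.sin (x r) :=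
    (Real.continuous_sin.comp_continuousOn h.cont_angle a h.left_mem).eventually_const_lt hma
  rw [nhdsWithin_Icc_eq_nhdsGE hab] at hev
  obtain ⟨c, hc, hcm⟩ := (mem_nhdsGE_iff_exists_Ico_subset' (lt_add_one a)).1 hev
  set c' := min ((a + c) / 2) b with hc'
  have hc0 : a < c := hc
  have hac : a < c' := lt_min (by linarith) hab
  have hcc : c' < c := (min_le_left _ _).trans_lt (by linarith)
  have hcb : c' ≤ b := min_le_right _ _
  have hneg1 : ∀ r ∈ Ioc a c', y r < 0 := by
    intro r hr
    have h1 := h.vel_sub_le (c := -m + ε) h.left_mem ⟨hr.1.le, hr.2.trans hcb⟩ hr.1.le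
      fun q hq => by
        have h2 : m < Real.sin (x q) := hcm ⟨hq.1.le, hq.2.trans (hr.2.trans_lt hcc)⟩
        have h3 := (abs_le.1 (h.bound q ⟨hq.1.le, hq.2.le.trans (hr.2.trans hcb)⟩)).2
        nlinarith
    rw [hya] at h1
    have : 0 < r - a := by linarith [hr.1]
    nlinarith
  set F : Set ℝ := Icc c' b ∩ y ⁻¹' Ici 0 with hF
  have hFc : IsClosed F :=
    (h.cont_vel.mono (Icc_subset_Icc hac.le le_rfl)).preimage_isClosed_of_isClosed isClosed_Icc isClosed_Ici
  have hFn : F.Nonempty := ⟨b, ⟨hcb, le_rfl⟩, by simp [hyb]⟩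
  have hFb : BddBelow F := ⟨c', fun r hr => hr.1.1⟩
  set s₁ := sInf F with hs₁
  have hsF : s₁ ∈ F := hFc.csInf_mem hFn hFb
  have hneg : ∀ r ∈ Ioo a s₁, y r < 0 := by
    intro r hr
    rcases le_or_gt r c' with h1 | h1
    · exact hneg1 r ⟨hr.1, h1⟩
    · by_contra! hn
      exact not_le.2 hr.2 (csInf_le hFb ⟨⟨h1.le, hr.2.le.trans hsF.1.2⟩, hn⟩)
  have hcs : c' < s₁ := by
    refine lt_of_le_of_ne hsF.1.1 fun he => ?_
    have := hneg1 c' ⟨hac, le_rfl⟩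
    rw [he] at this
    exact absurd hsF.2 (not_le.2 this)
  have hanti : ∀ r ∈ Icc a s₁, ∀ q ∈ Icc a s₁, r ≤ q → x q ≤ x r := by
    intro r hr q hq hrq
    have h1 := h.angle r ⟨hr.1, hr.2.trans hsF.1.2⟩ q ⟨hq.1, hq.2.trans hsF.1.2⟩
    have h2 : ∫ t in r..q, y t ≤ 0 := by
      have h3 : ∫ t in r..q, y t ≤ ∫ t in r..q, (0 : ℝ) :=
        integral_mono_on_of_le_Ioo hrq (h.integrable_vel.mono_set (h.uIcc_subset
          ⟨hr.1, hr.2.trans hsF.1.2⟩ ⟨hq.1, hq.2.trans hsF.1.2⟩)) intervalIntegrable_const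
          fun t ht => (hneg t ⟨hr.1.trans_lt ht.1, ht.2.trans_le hq.2⟩).le
      simpa using h3
    linarith
  have ha1 : a ∈ Icc a s₁ := ⟨le_rfl, (hac.trans hcs).le⟩
  have hex : ∃ r ∈ Ioo a s₁, x r ≤ Real.arcsin ε := by
    by_contra! hn
    have h1 := h.vel_sub_le (c := 0) ⟨hac.le, hcb⟩ ⟨(hac.trans hcs).le, hsF.1.2⟩ hcs.le
      fun q hq => by
        have h2 := hn q ⟨hac.trans hq.1, hq.2⟩
        have h4 := hanti a ha1 q ⟨(hac.trans hq.1).le, hq.2.le⟩ (hac.trans hq.1).le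
        have h5 := le_sin_of_mem hε.le hε1 ⟨h2.le, h4.trans hx'.2.le⟩
        have h3 := (abs_le.1 (h.bound q ⟨(hac.trans hq.1).le, hq.2.le.trans hsF.1.2⟩)).2
        nlinarith
    have h2 := hneg1 c' ⟨hac, le_rfl⟩
    have h3 : 0 ≤ y s₁ := hsF.2
    linarith
  obtain ⟨r, hr, hrα⟩ := hex
  obtain ⟨s, hsm, hsα⟩ := intermediate_value_Icc' hr.1.le
    (h.cont_angle.mono (Icc_subset_Icc le_rfl (hr.2.le.trans hsF.1.2))) ⟨hrα, hx'.1.le⟩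
  have has : a < s := lt_of_le_of_ne hsm.1 fun he => by rw [← he] at hsα; linarith [hx'.1]
  refine ⟨s, ⟨has, hsm.2.trans_lt (hr.2.trans_le hsF.1.2)⟩, fun q hq => ?_, hsα⟩
  have hq1 : q ∈ Icc a s₁ := ⟨hq.1.le, (hq.2.le.trans hsm.2).trans hr.2.le⟩
  refine ⟨hneg q ⟨hq.1, (hq.2.trans_le hsm.2).trans hr.2⟩, ?_⟩
  have h1 := hanti a ha1 q hq1 hq.1.le
  have h2 := hanti q hq1 s ⟨has.le, hsm.2.trans hr.2.le⟩ hq.2.le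
  have h3 := le_sin_of_mem (v := x q) hε.le hε1 ⟨hsα ▸ h2, h1.trans hx'.2.le⟩
  linarith

theorem exists_swing (h : Controlled ε a b x y u) (hab : a < b) (hya : y a = 0) (hyb : y b = 0)
    (hs : ε < |Real.sin (x a)|) : ∃ s ∈ Ioo a b, (∀ r ∈ Ioo a s, y r * Real.sin (x r) < 0) ∧
      Real.arccos (Real.cos (x a)) - Real.arcsin ε ≤ ∫ r in a..s, |y r| := by
  have hε := h.eps_pos
  obtain ⟨n, hn⟩ : ∃ n : ℤ, x a + n * (2 * Real.pi) ∈ Ioc (-Real.pi) (-Real.pi + 2 * Real.pi) := by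
    obtain ⟨n, hn, -⟩ := existsUnique_add_zsmul_mem_Ioc Real.two_pi_pos (x a) (-Real.pi)
    exact ⟨n, by simpa using hn⟩
  have hsin : ∀ r, Real.sin (r + n * (2 * Real.pi)) = Real.sin r := fun r =>
    Real.sin_add_int_mul_two_pi r n
  have h1 := h.shift hsin
  rw [← Real.cos_add_int_mul_two_pi (x a) n]
  rw [← hsin] at hs
  set z := x a + n * (2 * Real.pi) with hz
  have hz0 : z ≠ 0 := fun h0 => by rw [h0, Real.sin_zero, abs_zero] at hs; linarith
  have hzπ : z < Real.pi := lt_of_le_of_ne (by linarith [hn.2]) fun h0 => by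
    rw [h0, Real.sin_pi, abs_zero] at hs; linarith
  rcases lt_or_gt_of_ne hz0 with h0 | h0
  · have hzm : -z ∈ Ioo 0 Real.pi := ⟨by linarith, by linarith [hn.1]⟩
    have hs0 := Real.sin_pos_of_mem_Ioo hzm
    rw [← abs_neg, ← Real.sin_neg, abs_of_pos hs0] at hs
    obtain ⟨s, hsm, hr, hα⟩ := h1.neg.exists_swing_aux hab (by simp [hya]) (by simp [hyb]) hzm hs
    refine ⟨s, hsm, fun r hr' => ?_, ?_⟩
    · have h2 := hr r hr'
      rw [Real.sin_neg, hsin] at h2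
      nlinarith [h2.1, h2.2]
    · have h3 := h1.neg.abs_angle_sub_le h.left_mem ⟨hsm.1.le, hsm.2.le⟩ hsm.1.le
      simp only [abs_neg] at h3
      rw [← Real.cos_neg, Real.arccos_cos hzm.1.le hzm.2.le]
      rw [hα] at h3
      exact le_trans (by rw [← abs_sub_comm]; exact le_abs_self _) h3
  · have hzm : z ∈ Ioo 0 Real.pi := ⟨h0, hzπ⟩
    have hs0 := Real.sin_pos_of_mem_Ioo hzm
    rw [abs_of_pos hs0] at hs
    obtain ⟨s, hsm, hr, hα⟩ := h1.exists_swing_aux hab hya hyb hzm hs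
    refine ⟨s, hsm, fun r hr' => ?_, ?_⟩
    · have h2 := hr r hr'
      rw [hsin] at h2
      nlinarith [h2.1, h2.2]
    · have h3 := h1.abs_angle_sub_le h.left_mem ⟨hsm.1.le, hsm.2.le⟩ hsm.1.le
      rw [Real.arccos_cos hzm.1.le hzm.2.le]
      rw [hα] at h3
      exact le_trans (by rw [← abs_sub_comm]; exact le_abs_self _) h3

/-- Between two turning points the angle runs through both amplitudes. -/
theorem spacing (h : Controlled ε a b x y u) (hab : a < b) (hya : y a = 0) (hyb : y b = 0)
    (hsa : ε < |Real.sin (x a)|) (hsb : ε < |Real.sin (x b)|) :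
    Real.arccos (Real.cos (x a)) + Real.arccos (Real.cos (x b)) - 2 * Real.arcsin ε
      ≤ ∫ r in a..b, |y r| := by
  obtain ⟨s, hs, hs1, hs2⟩ := h.exists_swing hab hya hyb hsa
  have hrev := h.reverse 0
  obtain ⟨q, hq, hq1, hq2⟩ := hrev.exists_swing (by linarith) (by simpa using hyb)
    (by simpa using hya) (by simpa using hsb)
  simp only [zero_sub, neg_neg, abs_neg] at hq hq1 hq2
  rw [integral_comp_neg (fun r => |y r|), neg_neg] at hq2
  -- On the first swing `y * sin x` is negative, on the one followed backwards from `b` it is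
  -- positive; so the two cannot overlap and their lengths add up.
  have hsq : s ≤ -q := by
    by_contra! hn
    obtain ⟨r, hr1, hr2⟩ := exists_between (max_lt (lt_min hs.1 (by linarith [hq.1] : a < b))
      (lt_min hn (by linarith [hq.1])) : max a (-q) < min s b)
    simp only [max_lt_iff, lt_min_iff] at hr1 hr2
    have h1 := hs1 r ⟨hr1.1, hr2.1⟩
    have h2 := hq1 (-r) ⟨by linarith, by linarith⟩
    rw [neg_neg] at h2
    linarith
  have hi : ∀ c ∈ Icc a b, ∀ d ∈ Icc a b, IntervalIntegrable (fun r => |y r|) volume c d :=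
    fun c hc d hd => h.integrable_abs_vel.mono_set (h.uIcc_subset hc hd)
  have hsm : s ∈ Icc a b := ⟨hs.1.le, hs.2.le⟩
  have hqm : -q ∈ Icc a b := ⟨by linarith [hq.2], by linarith [hq.1]⟩
  rw [← integral_add_adjacent_intervals (hi a h.left_mem s hsm) (hi s hsm b h.right_mem),
    ← integral_add_adjacent_intervals (hi s hsm (-q) hqm) (hi (-q) hqm b h.right_mem)]
  have h3 : 0 ≤ ∫ r in s..(-q), |y r| := integral_nonneg hsq fun _ _ => abs_nonneg _
  linarith

end Controlled

/-! ### The scale in which turning points are equidistributed -/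

/-- The integral of `sin x / (2 x)` up to the amplitude of the energy level `b`. -/
def swing (b : ℝ) : ℝ := ∫ x in (0 : ℝ)..Real.arccos (1 - b), Real.sinc x / 2

theorem continuous_sinc_div : Continuous fun x => Real.sinc x / 2 :=
  Real.continuous_sinc.div_const 2

theorem continuous_swing : Continuous swing :=
  (contDiff_integral continuous_sinc_div 0).continuous.comp
    (Real.continuous_arccos.comp (continuous_const.sub continuous_id))

theorem swing_zero : swing 0 = 0 := by simp [swing]

theorem swing_two : swing 2 = ∫ x in (0 : ℝ)..Real.pi, Real.sin x / (2 * x) := by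
  rw [swing, show (1 : ℝ) - 2 = -1 by norm_num, Real.arccos_neg_one,
    intervalIntegral_eq_Ioo Real.pi_pos.le, intervalIntegral_eq_Ioo Real.pi_pos.le]
  refine setIntegral_congr_fun measurableSet_Ioo fun x hx => ?_
  rw [Real.sinc_of_ne_zero hx.1.ne', div_div, mul_comm]

theorem arccos_one_sub_mono {b c : ℝ} (h : b ≤ c) : Real.arccos (1 - b) ≤ Real.arccos (1 - c) :=
  Real.antitone_arccos (by linarith)

/-- Quantitative form of `swing' b = 1 / (2 * amplitude)`: between the two amplitudes the
denominator `2 x` is replaced by its extreme values, and the integral of `sin` is the energy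
difference. -/
theorem swing_sub_mem {b₁ b₂ : ℝ} (h2 : 0 < b₂) (h12 : b₂ ≤ b₁) (h1 : b₁ ≤ 2) :
    swing b₁ - swing b₂ ∈ Icc ((b₁ - b₂) / (2 * Real.arccos (1 - b₁)))
      ((b₁ - b₂) / (2 * Real.arccos (1 - b₂))) := by
  set a₁ := Real.arccos (1 - b₁) with ha₁
  set a₂ := Real.arccos (1 - b₂) with ha₂
  have h3 : 0 < a₂ := Real.arccos_pos.2 (by linarith)
  have h4 : a₂ ≤ a₁ := arccos_one_sub_mono h12
  have h5 : a₁ ≤ Real.pi := Real.arccos_le_pi _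
  have e1 : swing b₁ - swing b₂ = ∫ x in a₂..a₁, Real.sinc x / 2 :=
    integral_interval_sub_left (continuous_sinc_div.intervalIntegrable _ _)
      (continuous_sinc_div.intervalIntegrable _ _)
  have e2 : ∀ c : ℝ, ∫ x in a₂..a₁, Real.sin x / c = (b₁ - b₂) / c := fun c => by
    rw [intervalIntegral.integral_div, integral_sin, Real.cos_arccos (by linarith) (by linarith),
      Real.cos_arccos (by linarith) (by linarith)]
    ring
  have hi : ∀ c : ℝ, IntervalIntegrable (fun x => Real.sin x / c) volume a₂ a₁ := fun c =>
    (Real.continuous_sin.div_const c).intervalIntegrable _ _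
  have hpt : ∀ x ∈ Icc a₂ a₁, Real.sinc x / 2 = Real.sin x / (2 * x) ∧ 0 ≤ Real.sin x := by
    intro x hx
    rw [Real.sinc_of_ne_zero (h3.trans_le hx.1).ne', div_div, mul_comm]
    exact ⟨rfl, Real.sin_nonneg_of_nonneg_of_le_pi (h3.trans_le hx.1).le (hx.2.trans h5)⟩
  rw [e1, ← e2, ← e2]
  constructor
  · refine integral_mono_on h4 (hi _) (continuous_sinc_div.intervalIntegrable _ _) fun x hx => ?_
    obtain ⟨e, hs⟩ := hpt x hx
    have := h3.trans_le hx.1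
    rw [e]
    gcongr
    exact hx.2
  · refine integral_mono_on h4 (continuous_sinc_div.intervalIntegrable _ _) (hi _) fun x hx => ?_
    obtain ⟨e, hs⟩ := hpt x hx
    rw [e]
    gcongr
    exact hx.1

theorem swing_mono {b₁ b₂ : ℝ} (h2 : 0 < b₂) (h12 : b₂ ≤ b₁) (h1 : b₁ ≤ 2) :
    swing b₂ ≤ swing b₁ := by
  have h := (swing_sub_mem h2 h12 h1).1
  have h3 : 0 ≤ (b₁ - b₂) / (2 * Real.arccos (1 - b₁)) :=
    div_nonneg (by linarith) (mul_nonneg zero_le_two (Real.arccos_nonneg _))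
  linarith

theorem swing_nonneg {b : ℝ} (h0 : 0 ≤ b) (h2 : b ≤ 2) : 0 ≤ swing b := by
  rcases h0.eq_or_lt with rfl | h0
  · exact swing_zero.ge
  have h3 : Tendsto swing (𝓝[>] 0) (𝓝 (swing 0)) :=
    (continuous_swing.tendsto 0).mono_left nhdsWithin_le_nhds
  rw [swing_zero] at h3
  refine le_of_tendsto h3 ?_
  filter_upwards [Ioo_mem_nhdsGT h0] with c hc
  exact swing_mono hc.1 hc.2.le h2

theorem exists_modulus_arccos {κ : ℝ} (hκ : 0 < κ) : ∃ d > 0, ∀ b ∈ Icc (0 : ℝ) 3,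
    ∀ c ∈ Icc (0 : ℝ) 3, |b - c| < d → |Real.arccos (1 - b) - Real.arccos (1 - c)| < κ := by
  have hu := (isCompact_Icc (a := (0 : ℝ)) (b := 3)).uniformContinuousOn_of_continuous
    (f := fun b => Real.arccos (1 - b))
    (Real.continuous_arccos.comp (continuous_const.sub continuous_id)).continuousOn
  rw [Metric.uniformContinuousOn_iff] at hu
  obtain ⟨d, hd, H⟩ := hu κ hκ
  exact ⟨d, hd, fun b hb c hc h => H b hb c hc h⟩

/-- If `b₁` and `b₂` are close, so are the amplitudes, and the ratio of their sum to `2 * arccos (1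
- b₁)` is nearly 1. If they are at least `d` apart, the gap alone gives a step of at least `d / (2
π) ≥ ε`. -/
theorem swing_step_ge {δ κ : ℝ} (hδ : 0 < δ) (hκ : 0 < κ) : ∃ ε₀ > 0, ∀ ε b₁ b₂ : ℝ,
    0 < ε → ε < ε₀ → δ ≤ b₂ → b₂ ≤ b₁ → b₁ ≤ 2 →
    ε * (Real.arccos (1 - b₁) + Real.arccos (1 - b₂) - 2 * Real.arcsin ε) ≤ b₁ - b₂ →
    ε * (1 - κ) ≤ swing b₁ - swing b₂ := by
  set A := Real.arccos (1 - δ) with hA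
  have hA0 : 0 < A := Real.arccos_pos.2 (by linarith)
  have hpi := Real.pi_pos
  obtain ⟨d, hd, H⟩ := exists_modulus_arccos (κ := κ * A) (by positivity)
  refine ⟨min 1 (min (κ * A / 4) (d / (2 * Real.pi))), by positivity,
    fun ε b₁ b₂ hε hε0 h2 h12 h1 h => ?_⟩
  simp only [lt_min_iff] at hε0
  obtain ⟨he1, he2, he3⟩ := hε0
  have hsw := (swing_sub_mem (hδ.trans_le h2) h12 h1).1
  refine le_trans ?_ hsw
  have hA1 : A ≤ Real.arccos (1 - b₁) := arccos_one_sub_mono (h2.trans h12)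
  have hAπ := Real.arccos_le_pi (1 - b₁)
  have hA10 : 0 < Real.arccos (1 - b₁) := hA0.trans_le hA1
  rcases lt_or_ge (b₁ - b₂) d with h3 | h3
  · have h4 := H b₁ ⟨by linarith, by linarith⟩ b₂ ⟨by linarith, by linarith⟩
      (by rw [abs_of_nonneg (by linarith)]; exact h3)
    have h5 := arcsin_le_of_nonneg hε.le he1.le
    rw [le_div_iff₀ (by positivity)]
    refine le_trans ?_ h
    rw [mul_assoc]
    gcongr
    have h6 : κ * A ≤ κ * Real.arccos (1 - b₁) := by gcongr
    linarith [(abs_lt.1 h4).2]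
  · rw [le_div_iff₀ (by positivity)]
    rw [lt_div_iff₀ (by positivity)] at he3
    have h4 : 2 * Real.arccos (1 - b₁) ≤ 2 * Real.pi := by linarith
    calc ε * (1 - κ) * (2 * Real.arccos (1 - b₁)) ≤ ε * (2 * Real.arccos (1 - b₁)) := by
          gcongr
          nlinarith
      _ ≤ ε * (2 * Real.pi) := by gcongr
      _ ≤ b₁ - b₂ := by linarith

/-- Here the hypothesis itself forces `b₁ - b₂ ≤ 2 π ε`, so all amplitudes involved are close. The
shift by `η` allows for an energy above the clock. -/
theorem swing_step_le {δ κ : ℝ} (hδ : 0 < δ) (hδ1 : δ < 1) (hκ : 0 < κ) : ∃ ε₀ > 0, ∀ ε η b₁ b₂ : ℝ,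
    0 < ε → ε < ε₀ → 0 ≤ η → η < ε₀ → δ ≤ b₂ → b₂ ≤ b₁ → b₁ ≤ 2 - δ →
    b₁ - b₂ ≤ ε * (Real.arccos (1 - (b₁ + η)) + Real.arccos (1 - (b₂ + η))) →
    swing b₁ - swing b₂ ≤ ε * (1 + κ) := by
  set A := Real.arccos (1 - δ) with hA
  have hA0 : 0 < A := Real.arccos_pos.2 (by linarith)
  have hpi := Real.pi_pos
  obtain ⟨d, hd, H⟩ := exists_modulus_arccos (κ := κ * A) (by positivity)
  refine ⟨min 1 (min (d / 2) (d / (4 * Real.pi))), by positivity,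
    fun ε η b₁ b₂ hε hε0 hη hη0 h2 h12 h1 h => ?_⟩
  simp only [lt_min_iff] at hε0 hη0
  obtain ⟨he1, he2, he3⟩ := hε0
  obtain ⟨hn1, hn2, hn3⟩ := hη0
  refine (swing_sub_mem (hδ.trans_le h2) h12 (by linarith)).2.trans ?_
  have hA2 : A ≤ Real.arccos (1 - b₂) := arccos_one_sub_mono h2
  have hA20 : 0 < Real.arccos (1 - b₂) := hA0.trans_le hA2
  rw [lt_div_iff₀ (by positivity)] at he3
  have hb : b₁ - b₂ < d / 2 := by
    have h3 := Real.arccos_le_pi (1 - (b₁ + η))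
    have h4 := Real.arccos_le_pi (1 - (b₂ + η))
    have h5 : ε * (Real.arccos (1 - (b₁ + η)) + Real.arccos (1 - (b₂ + η)))
      ≤ ε * (2 * Real.pi) := by gcongr; linarith
    linarith
  have h3 := H (b₁ + η) ⟨by linarith, by linarith⟩ b₂ ⟨by linarith, by linarith⟩
    (by rw [abs_of_nonneg (by linarith)]; linarith)
  have h4 := H (b₂ + η) ⟨by linarith, by linarith⟩ b₂ ⟨by linarith, by linarith⟩
    (by rw [abs_of_nonneg (by linarith)]; linarith)
  rw [div_le_iff₀ (by positivity)]
  refine h.trans ?_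
  rw [mul_assoc]
  gcongr
  have h6 : κ * A ≤ κ * Real.arccos (1 - b₂) := by gcongr
  linarith [(abs_lt.1 h4).2, (abs_lt.1 h3).2]

/-! ### Counting -/

/-- The values of `f` fall into different bins of width `d`. -/
theorem encard_le_of_spacing {S : Set ℝ} {f : ℝ → ℝ} {α β d : ℝ} (hd : 0 < d)
    (hm : ∀ t ∈ S, f t ∈ Icc α β) (hs : ∀ t ∈ S, ∀ t' ∈ S, t < t' → d ≤ f t - f t') :
    (S.encard : ℝ≥0∞) ≤ ENNReal.ofReal ((β - α) / d + 1) := by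
  rcases S.eq_empty_or_nonempty with rfl | ⟨t₀, ht₀⟩
  · simp
  have hαβ : α ≤ β := (hm t₀ ht₀).1.trans (hm t₀ ht₀).2
  set N := ⌊(β - α) / d⌋₊ with hN
  have h1 : S.encard ≤ (Finset.range (N + 1) : Set ℕ).encard := by
    refine encard_le_encard_of_injOn (f := fun t => ⌊(f t - α) / d⌋₊) (fun t ht => ?_) ?_
    · simp only [Finset.coe_range, mem_Iio, Nat.lt_succ_iff]
      refine Nat.floor_le_floor ?_
      gcongr
      exact (hm t ht).2
    · have key : ∀ t ∈ S, ∀ t' ∈ S, t < t' → ⌊(f t - α) / d⌋₊ ≠ ⌊(f t' - α) / d⌋₊ := by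
        intro t ht t' ht' h he
        have h2 := hs t ht t' ht' h
        have h3 : (f t' - α) / d + 1 ≤ (f t - α) / d := by
          rw [div_add_one hd.ne']
          gcongr
          linarith
        have h4 : 0 ≤ (f t' - α) / d := div_nonneg (by linarith [(hm t' ht').1]) hd.le
        have h5 := Nat.floor_le_floor h3
        rw [Nat.floor_add_one h4] at h5
        omega
      intro t ht t' ht' he
      by_contra hne
      rcases lt_or_gt_of_ne hne with h | h
      · exact key t ht t' ht' h he
      · exact key t' ht' t ht h he.symm
  rw [encard_coe_eq_coe_finsetCard, Finset.card_range] at h1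
  calc (S.encard : ℝ≥0∞) ≤ (((N + 1 : ℕ) : ℕ∞) : ℝ≥0∞) := ENat.toENNReal_le.2 h1
    _ = ENNReal.ofReal ((N + 1 : ℕ) : ℝ) := by rw [ENat.toENNReal_coe, ENNReal.ofReal_natCast]
    _ ≤ _ := by
      refine ENNReal.ofReal_le_ofReal ?_
      push_cast
      gcongr
      exact Nat.floor_le (div_nonneg (by linarith) hd.le)

/-! ### Switchings -/

/-- Where `|sin x| > 2 ε` gravity dominates the control, so the velocity passes through zero
strictly monotonically; since `u = -sign y` nearby, the one-sided limits of `u` are `1` and `-1`. -/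
theorem Controlled.switching_of_turning {ε a b : ℝ} {x y u : ℝ → ℝ} (h : Controlled ε a b x y u)
    {t : ℝ} (ht : t ∈ Ioo a b) (hy : y t = 0) (hs : 2 * ε < |Real.sin (x t)|)
    (hf : ∀ t ∈ Icc a b, ¬(|Real.sin (x t)| < 2 * ε ∧ |y t| < 2 * ε) → u t = -Real.sign (y t)) :
    ¬∃ c, Tendsto u (𝓝[≠] t) (𝓝 c) := by
  have hε := h.eps_pos
  have key : ∀ {x y u : ℝ → ℝ}, Controlled ε a b x y u → y t = 0 → 2 * ε < Real.sin (x t) →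
      (∀ t ∈ Icc a b, ¬(|Real.sin (x t)| < 2 * ε ∧ |y t| < 2 * ε) → u t = -Real.sign (y t)) →
      ¬∃ c, Tendsto u (𝓝[≠] t) (𝓝 c) := by
    rintro x y u h hy hs hf ⟨c, hc⟩
    have hct : ContinuousAt x t := h.cont_angle.continuousAt (Icc_mem_nhds ht.1 ht.2)
    have hev : ∀ᶠ r in 𝓝 t, r ∈ Ioo a b ∧ 2 * ε < Real.sin (x r) :=
      Filter.Eventually.and (Ioo_mem_nhds ht.1 ht.2)
        ((Real.continuous_sin.continuousAt.comp hct).eventually_const_lt hs)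
    obtain ⟨d, hd, H⟩ := Metric.eventually_nhds_iff.1 hev
    simp only [Real.dist_eq] at H
    have ht' := Ioo_subset_Icc_self ht
    have hsub : ∀ s r, |s - t| < d → |r - t| < d → s < r → y r - y s ≤ -ε * (r - s) := by
      intro s r hs hr hsr
      refine h.vel_sub_le (Ioo_subset_Icc_self (H hs).1) (Ioo_subset_Icc_self (H hr).1) hsr.le
        fun q hq => ?_
      have hq' : |q - t| < d := by
        rw [abs_lt] at *
        exact ⟨by linarith [hq.1], by linarith [hq.2]⟩
      have h1 := (abs_le.1 (h.bound q (Ioo_subset_Icc_self (H hq').1))).2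
      nlinarith [(H hq').2]
    have hz : ∀ r, |r - t| < d → u r = -Real.sign (y r) := fun r hr =>
      hf r (Ioo_subset_Icc_self (H hr).1) fun hn => by
        linarith [(H hr).2, le_abs_self (Real.sin (x r)), hn.1]
    have h1 : Tendsto u (𝓝[>] t) (𝓝 1) := by
      refine tendsto_const_nhds.congr' ?_
      filter_upwards [Ioo_mem_nhdsGT (by linarith : t < t + d)] with r hr
      have hrd : |r - t| < d := by rw [abs_lt]; constructor <;> linarith [hr.1, hr.2]
      have h2 := hsub t r (by simpa using hd) hrd hr.1
      rw [hz r hrd, Real.sign_of_neg (by nlinarith [hr.1]), neg_neg]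
    have h2 : Tendsto u (𝓝[<] t) (𝓝 (-1)) := by
      refine tendsto_const_nhds.congr' ?_
      filter_upwards [Ioo_mem_nhdsLT (by linarith : t - d < t)] with r hr
      have hrd : |r - t| < d := by rw [abs_lt]; constructor <;> linarith [hr.1, hr.2]
      have h2 := hsub r t hrd (by simpa using hd) hr.2
      rw [hz r hrd, Real.sign_of_pos (by nlinarith [hr.2])]
    have e1 := tendsto_nhds_unique h1 (hc.mono_left (nhdsWithin_mono _ fun r hr => ne_of_gt hr))
    have e2 := tendsto_nhds_unique h2 (hc.mono_left (nhdsWithin_mono _ fun r hr => ne_of_lt hr))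
    linarith
  rcases le_total 0 (Real.sin (x t)) with h0 | h0
  · exact key h hy (by rwa [abs_of_nonneg h0] at hs) hf
  · rintro ⟨c, hc⟩
    refine key h.neg (by simp [hy]) (by rwa [Real.sin_neg, ← abs_of_nonpos h0]) (fun r hr hn => ?_)
      ⟨-c, hc.neg⟩
    rw [Real.sin_neg, abs_neg, abs_neg] at hn
    rw [hf r hr hn, Real.sign_neg]

/-! ### The number of switchings -/

theorem continuousAt_state {ε T : ℝ} {m : Motion} (h : Controlled ε 0 T m.x m.y m.u) {t : ℝ}
    (ht : t ∈ Ioo 0 T) : ContinuousAt m.state t := by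
  have h1 := h.cont_angle.continuousAt (Icc_mem_nhds ht.1 ht.2)
  have h2 := h.cont_vel.continuousAt (Icc_mem_nhds ht.1 ht.2)
  exact (Real.Angle.continuous_coe.continuousAt.comp h1).prodMk h2

/-- Outside the closure of the standstill zone the control switches only at turning points. -/
theorem turning_of_switching {ε : ℝ} {m : Motion} (h : Controlled ε 0 m.T m.x m.y m.u)
    (hf : m.DryFriction ε) {t : ℝ} (ht : t ∈ m.switchings)
    (hz : m.state t ∉ closure (standstill ε)) : m.y t = 0 ∧ 2 * ε ≤ |Real.sin (m.x t)| := by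
  have hε := h.eps_pos
  obtain ⟨htm, hsw⟩ := ht
  have hy : m.y t = 0 := by
    by_contra hne
    refine hsw ⟨-Real.sign (m.y t), tendsto_const_nhds.congr' ?_⟩
    have h2 := h.cont_vel.continuousAt (Icc_mem_nhds htm.1 htm.2)
    have e1 : ∀ᶠ r in 𝓝 t, m.state r ∈ (closure (standstill ε))ᶜ :=
      continuousAt_state h htm (isClosed_closure.isOpen_compl.mem_nhds hz)
    have e2 : ∀ᶠ r in 𝓝 t, Real.sign (m.y r) = Real.sign (m.y t) := by
      rcases lt_or_gt_of_ne hne with h0 | h0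
      · filter_upwards [h2.eventually_lt_const h0] with r hr
        rw [Real.sign_of_neg hr, Real.sign_of_neg h0]
      · filter_upwards [h2.eventually_const_lt h0] with r hr
        rw [Real.sign_of_pos hr, Real.sign_of_pos h0]
    refine Filter.Eventually.filter_mono nhdsWithin_le_nhds ?_
    filter_upwards [e1, e2, Icc_mem_nhds htm.1 htm.2] with r h1 h2 h3
    rw [hf r h3 fun h4 => h1 (subset_closure h4), h2]
  refine ⟨hy, ?_⟩
  by_contra! hn
  exact hz (subset_closure ((mem_standstill_state m t).2 ⟨hn, by rw [hy, abs_zero]; positivity⟩))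

namespace Braked

variable {ε T Λ : ℝ} {x y u : ℝ → ℝ}

/-- The turning points outside the standstill zone. -/
def turnings (ε T : ℝ) (x y : ℝ → ℝ) : Set ℝ := {t ∈ Ioo 0 T | y t = 0 ∧ 2 * ε ≤ |Real.sin (x t)|}

theorem clock_spacing (h : Braked ε T Λ x y u) {s t : ℝ} (hs : s ∈ turnings ε T x y)
    (ht : t ∈ turnings ε T x y) (hst : s < t) :
    ε * (Real.arccos (Real.cos (x s)) + Real.arccos (Real.cos (x t)) - 2 * Real.arcsin ε)
      ≤ clock ε x y s - clock ε x y t := by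
  have hε := h.ctrl.eps_pos
  have hc := h.ctrl.mono hst.le hs.1.1.le ht.1.2.le
  rw [isClock h.ctrl s (Ioo_subset_Icc_self hs.1) t (Ioo_subset_Icc_self ht.1)]
  refine mul_le_mul_of_nonneg_left ?_ hε.le
  exact hc.spacing hst hs.2.1 ht.2.1 (by linarith [hs.2.2]) (by linarith [ht.2.2])

theorem clock_le_of_turning (h : Braked ε T Λ x y u) {t : ℝ} (ht : t ∈ turnings ε T x y) :
    clock ε x y t ≤ 1 - Real.cos (x t) := by
  have h1 := (h.en_mem (Ioo_subset_Icc_self ht.1)).1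
  simpa [en, ht.2.1] using h1

theorem arccos_clock_le (h : Braked ε T Λ x y u) {t : ℝ} (ht : t ∈ turnings ε T x y) :
    Real.arccos (1 - clock ε x y t) ≤ Real.arccos (Real.cos (x t)) :=
  Real.antitone_arccos (by linarith [h.clock_le_of_turning ht])

theorem abs_sin_le_arccos_cos (v : ℝ) : |Real.sin v| ≤ Real.arccos (Real.cos v) := by
  have h1 := Real.sin_le (Real.arccos_nonneg (Real.cos v))
  rwa [Real.sin_arccos, ← Real.abs_sin_eq_sqrt_one_sub_cos_sq] at h1

/-- Three ranges of the clock, each with a scale in which turning points are spaced: `swing` above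
`δ` gives the main term, the square root between `16 ε²` and `δ` gives at most about `2 √δ / ε`
points, and the clock itself below `16 ε²` gives a multiple of `1 + Λ`. -/
theorem encard_turnings_le {κ : ℝ} (hκ : 0 < κ) : ∃ ε₀ > 0, ∀ {ε T Λ : ℝ} {x y u : ℝ → ℝ},
    Braked ε T Λ x y u → ε < ε₀ → ε * Λ < ε₀ →
      ENNReal.ofReal ε * ((turnings ε T x y).encard : ℝ≥0∞) ≤ ENNReal.ofReal (swing 2 + κ) := by
  have hpi := Real.pi_pos
  have hI0 : 0 ≤ swing 2 := swing_nonneg zero_le_two le_rfl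
  set I := swing 2 with hIdef
  -- the parameters
  set κ₁ := min (1 / 2) (κ / (8 * (I + 1))) with hκ₁
  have hκ₁0 : 0 < κ₁ := lt_min (by norm_num) (by positivity)
  have hκ₁1 : κ₁ ≤ 1 / 2 := min_le_left _ _
  have hκ₁I : κ₁ * (8 * (I + 1)) ≤ κ := by
    rw [← le_div_iff₀ (by positivity)]; exact min_le_right _ _
  set δ := min 1 (κ / 16) ^ 2 with hδ
  have hδ0 : 0 < δ := by positivity
  have hδs : √δ ≤ κ / 16 := by
    rw [hδ, Real.sqrt_sq (by positivity)]; exact min_le_right _ _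
  obtain ⟨ε₁, hε₁, H₁⟩ := swing_step_ge hδ0 hκ₁0
  refine ⟨min (min ε₁ 1) (κ / 240), by positivity, fun {ε T Λ x y u} h hε hΛ => ?_⟩
  simp only [lt_min_iff] at hε hΛ
  have hε0 := h.ctrl.eps_pos
  have hΛ0 := h.zone_nonneg
  have harc := arcsin_le_of_nonneg hε0.le hε.1.2.le
  set k := clock ε x y with hk
  set W := turnings ε T x y with hW
  have hcos : ∀ t, 1 - Real.cos (x t) ≤ 2 := fun t => by linarith [Real.neg_one_le_cos (x t)]
  -- high energies
  have c1 := encard_le_of_spacing (S := {t ∈ W | δ ≤ k t}) (f := fun t => swing (k t)) (α := 0) (β := I)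
    (d := ε * (1 - κ₁)) (mul_pos hε0 (by linarith)) (fun t ht => by
      have h2 := (h.clock_le_of_turning ht.1).trans (hcos t)
      exact ⟨swing_nonneg (hδ0.le.trans ht.2) h2, swing_mono (hδ0.trans_le ht.2) h2 le_rfl⟩) fun s hs t ht hst => by
    have h2 := h.clock_spacing hs.1 ht.1 hst
    have h3 := h.arccos_clock_le hs.1
    have h4 := h.arccos_clock_le ht.1
    refine H₁ ε _ _ hε0 hε.1.1 ht.2 ((isClock h.ctrl).antitone hε0 (Ioo_subset_Icc_self hs.1.1)
      (Ioo_subset_Icc_self ht.1.1) hst.le) ((h.clock_le_of_turning hs.1).trans (hcos s)) ?_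
    refine le_trans ?_ h2
    gcongr
  -- low energies
  have c2 := encard_le_of_spacing (S := {t ∈ W | 16 * ε ^ 2 ≤ k t ∧ k t ≤ δ})
    (f := fun t => √(k t)) (α := 0) (β := √δ)
    (d := ε / 2) (by positivity) (fun t ht => ⟨Real.sqrt_nonneg _, Real.sqrt_le_sqrt ht.2.2⟩)
    fun s hs t ht hst => by
    have h2 := h.clock_spacing hs.1 ht.1 hst
    -- The amplitude is at least `√k ≥ 4 ε`. Hence the correction `2 arcsin ε ≤ 16 / 5 * ε` takes
    -- away at most half of the sum of the two roots.
    have low : ∀ r, r ∈ W ∧ 16 * ε ^ 2 ≤ k r ∧ k r ≤ δ →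
        4 * ε ≤ √(k r) ∧ √(k r) ≤ Real.arccos (Real.cos (x r)) := by
      intro r hr
      have h5 : 0 ≤ k r := le_trans (by positivity) hr.2.1
      refine ⟨Real.le_sqrt_of_sq_le (by nlinarith [hr.2.1]), ?_⟩
      refine le_trans ?_ (h.arccos_clock_le hr.1)
      refine le_trans ?_ (sqrt_le_arccos ⟨h5, (h.clock_le_of_turning hr.1).trans (hcos r)⟩)
      exact Real.sqrt_le_sqrt (by linarith)
    obtain ⟨l1, l2⟩ := low s hs
    obtain ⟨l3, l4⟩ := low t ht
    have q1 := Real.sq_sqrt (le_trans (by positivity) hs.2.1 : 0 ≤ k s)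
    have q2 := Real.sq_sqrt (le_trans (by positivity) ht.2.1 : 0 ≤ k t)
    have h6 : ε * ((√(k s) + √(k t)) / 2) ≤ k s - k t := by
      refine le_trans ?_ h2
      gcongr
      linarith
    rw [← q1, ← q2] at h6
    have h7 : 0 < √(k s) + √(k t) := by linarith
    have h8 : (√(k s) + √(k t)) * (ε / 2) ≤ (√(k s) + √(k t)) * (√(k s) - √(k t)) := by
      rw [q1, q2] at h6
      nlinarith
    exact le_of_mul_le_mul_left h8 h7
  -- lowest energies
  have c3 := encard_le_of_spacing (S := {t ∈ W | k t ≤ 16 * ε ^ 2}) (f := k)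
    (α := -(4 * ε ^ 2 * Λ)) (β := 16 * ε ^ 2) (d := 4 / 5 * ε ^ 2) (by positivity)
    (fun t ht => ⟨by
      have h2 := (h.en_mem (Ioo_subset_Icc_self ht.1.1)).2
      linarith [en_nonneg (x t) (y t)], ht.2⟩) fun s hs t ht hst => by
    have h2 := h.clock_spacing hs.1 ht.1 hst
    have h3 := abs_sin_le_arccos_cos (x s)
    have h4 := abs_sin_le_arccos_cos (x t)
    refine le_trans ?_ h2
    -- Outside the zone both amplitudes are at least `2 ε`, and `4 ε - 2 * (8 / 5 * ε) = 4 / 5 * ε`.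
    rw [show 4 / 5 * ε ^ 2 = ε * (4 / 5 * ε) by ring]
    gcongr
    linarith [hs.1.2.2, ht.1.2.2]
  have hsub : W ⊆ ({t ∈ W | δ ≤ k t} ∪ {t ∈ W | 16 * ε ^ 2 ≤ k t ∧ k t ≤ δ})
      ∪ {t ∈ W | k t ≤ 16 * ε ^ 2} := by
    intro t ht
    rcases le_total δ (k t) with h1 | h1
    · exact Or.inl (Or.inl ⟨ht, h1⟩)
    rcases le_total (16 * ε ^ 2) (k t) with h2 | h2
    · exact Or.inl (Or.inr ⟨ht, h2, h1⟩)
    · exact Or.inr ⟨ht, h2⟩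
  have hcard := (encard_le_encard hsub).trans ((encard_union_le _ _).trans
    (add_le_add_left (encard_union_le _ _) _))
  have hcard' := ENat.toENNReal_le.2 hcard
  rw [ENat.toENNReal_add, ENat.toENNReal_add] at hcard'
  have hd1 : 0 ≤ (I - 0) / (ε * (1 - κ₁)) + 1 := by
    have : 0 ≤ (I - 0) / (ε * (1 - κ₁)) :=
      div_nonneg (by linarith) (mul_nonneg hε0.le (by linarith))
    linarith
  have hd2 : 0 ≤ (√δ - 0) / (ε / 2) + 1 := by rw [sub_zero]; positivity
  have hd3 : 0 ≤ (16 * ε ^ 2 - -(4 * ε ^ 2 * Λ)) / (4 / 5 * ε ^ 2) + 1 := by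
    rw [sub_neg_eq_add]; positivity
  have htot := hcard'.trans (add_le_add (add_le_add c1 c2) c3)
  rw [← ENNReal.ofReal_add hd1 hd2, ← ENNReal.ofReal_add (add_nonneg hd1 hd2) hd3] at htot
  calc ENNReal.ofReal ε * (W.encard : ℝ≥0∞) ≤ ENNReal.ofReal ε * _ := by gcongr
    _ = ENNReal.ofReal (ε * _) := (ENNReal.ofReal_mul hε0.le).symm
    _ ≤ _ := by
      refine ENNReal.ofReal_le_ofReal ?_
      have e1 : ε * ((I - 0) / (ε * (1 - κ₁)) + 1 + ((√δ - 0) / (ε / 2) + 1)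
          + ((16 * ε ^ 2 - -(4 * ε ^ 2 * Λ)) / (4 / 5 * ε ^ 2) + 1))
          = I / (1 - κ₁) + 2 * √δ + 23 * ε + 5 * (ε * Λ) := by
        have : 1 - κ₁ ≠ 0 := by linarith
        field_simp
        ring
      rw [e1]
      have e2 : I / (1 - κ₁) ≤ I + κ / 4 := by
        rw [div_le_iff₀ (by linarith)]
        nlinarith
      linarith

/-- A stretch of the clock that is long in the scale `swing` contains a turning point. -/
theorem exists_turning (h : Braked ε T Λ x y u) {s t b₁ b₂ η r : ℝ} (hs : s ∈ Icc 0 T)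
    (ht : t ∈ Icc 0 T) (hst : s < t) (h1 : clock ε x y s = b₁) (h2 : clock ε x y t = b₂)
    (hη : 4 * ε ^ 2 * Λ ≤ η) (hb₁ : b₁ + η < 2)
    (hstep : b₁ - b₂ ≤ ε * (Real.arccos (1 - (b₁ + η)) + Real.arccos (1 - (b₂ + η))) →
      swing b₁ - swing b₂ ≤ r) (hr : r < swing b₁ - swing b₂) :
    ∃ z ∈ Ioo s t, y z = 0 := by
  by_contra! hn
  refine hr.not_ge (hstep ?_)
  have hε := h.ctrl.eps_pos
  have hc := h.ctrl.mono hst.le hs.1 ht.2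
  have hk := isClock h.ctrl
  have hmem : ∀ r ∈ Icc s t, r ∈ Icc 0 T := fun r hr => ⟨hs.1.trans hr.1, hr.2.trans ht.2⟩
  have hE : ∀ r ∈ Icc s t, en (x r) (y r) < 2 := fun r hr => by
    have h3 := (h.en_mem (hmem r hr)).2
    have h4 := hk.antitone hε hs (hmem r hr) hr.1
    linarith
  obtain ⟨n, hw⟩ := hc.exists_well hE
  have hamp : ∀ r ∈ Icc s t,
      |x r + n * (2 * Real.pi)| ≤ Real.arccos (1 - (clock ε x y r + η)) := fun r hr => by
    rw [← Real.arccos_cos (abs_nonneg _) (hw r hr).le, Real.cos_abs, Real.cos_add_int_mul_two_pi]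
    refine Real.antitone_arccos ?_
    have h3 := (h.en_mem (hmem r hr)).2
    unfold en at h3
    nlinarith [sq_nonneg (y r)]
  obtain ⟨σ, hσ, hσy⟩ := exists_sign_of_ne_zero isPreconnected_Ioo
    (hc.cont_vel.mono Ioo_subset_Icc_self) hn
  -- Without a turning point the angle is monotone, so the path length is an angle difference inside
  -- one well. It is at most the sum of the amplitudes of the levels clock plus `η`, which is the
  -- premise of `hstep`.
  have hint : ∫ r in s..t, |y r| = σ * (x t - x s) := by
    rw [h.ctrl.angle s hs t ht, ← intervalIntegral.integral_const_mul,
      intervalIntegral_eq_Ioo hst.le, intervalIntegral_eq_Ioo hst.le]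
    exact setIntegral_congr_fun measurableSet_Ioo hσy
  have hle : σ * (x t - x s) ≤ |x t + n * (2 * Real.pi)| + |x s + n * (2 * Real.pi)| := by
    calc σ * (x t - x s) ≤ |σ * (x t - x s)| := le_abs_self _
      _ = |(x t + n * (2 * Real.pi)) - (x s + n * (2 * Real.pi))| := by
        rw [abs_mul, hσ, one_mul]; congr 1; ring
      _ ≤ _ := abs_sub _ _
  have e1 := hk s hs t ht
  rw [h1, h2, hint] at e1
  have e2 := hamp s (left_mem_Icc.2 hst.le)
  have e3 := hamp t (right_mem_Icc.2 hst.le)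
  rw [h1] at e2
  rw [h2] at e3
  rw [e1]
  gcongr
  linarith

/-- Clock levels are chosen at distance `ε (1 + κ)` in the scale `swing`. A stretch without turning
point has length at most `ε (1 + κ / 2)` there, so between consecutive levels one occurs. -/
theorem le_encard_turnings {δ κ : ℝ} (hδ : 0 < δ) (hδ1 : δ < 1) (hκ : 0 < κ) : ∃ ε₀ > 0,
    ∀ {ε T Λ : ℝ} {x y u : ℝ → ℝ}, Braked ε T Λ x y u → ε < ε₀ → ε * Λ < ε₀ → 2 ≤ en (x 0) (y 0) →
      ∀ n : ℕ, n * (ε * (1 + κ)) ≤ swing (2 - δ) - swing δ →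
        (n : ℕ∞) ≤ {t ∈ Ioo 0 T | y t = 0 ∧ 2 * ε < |Real.sin (x t)|}.encard := by
  obtain ⟨ε₁, hε₁, H⟩ := swing_step_le hδ hδ1 (half_pos hκ)
  refine ⟨min (min 1 (ε₁ / 8)) (δ / 16), by positivity, fun {ε T Λ x y u} h hε hΛ hE n hn => ?_⟩
  simp only [lt_min_iff] at hε hΛ
  have hε0 := h.ctrl.eps_pos
  have hT := h.ctrl.le
  have hΛ0 := h.zone_nonneg
  set η := 4 * ε ^ 2 * Λ with hη
  have hη0 : 0 ≤ η := by positivity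
  have hη1 : η ≤ 4 * (ε * Λ) := by
    have : ε * (ε * Λ) ≤ 1 * (ε * Λ) := by gcongr; exact hε.1.1.le
    rw [hη]
    linarith
  set k := clock ε x y with hk
  have hkc : IsClock ε 0 T y k := isClock h.ctrl
  obtain ⟨τ, hτ, -, hτk, hanti, hlev⟩ := exists_hitting hT (hkc.continuousOn h.ctrl)
    (fun s hs t ht hst => hkc.antitone hε0 hs ht hst)
  have hk0 : 2 ≤ k 0 := by rw [hk, clock_zero]; exact hE
  have hkT : k T ≤ 0 := by
    have := (h.en_mem h.ctrl.right_mem).1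
    rwa [h.finish] at this
  set s := ε * (1 + κ) with hs
  have hs0 : 0 < s := by positivity
  have hlevels : ∀ j : ℕ, ∃ b ∈ Icc δ (2 - δ), j ≤ n → swing b = swing (2 - δ) - j * s := by
    intro j
    by_cases hj : j ≤ n
    · have h1 : (j : ℝ) * s ≤ n * s := by gcongr
      have h2 : (0 : ℝ) ≤ j * s := by positivity
      obtain ⟨b, hb, hbs⟩ := intermediate_value_Icc (by linarith : δ ≤ 2 - δ)
        continuous_swing.continuousOn
        (⟨by linarith, by linarith⟩ : swing (2 - δ) - j * s ∈ Icc (swing δ) (swing (2 - δ)))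
      exact ⟨b, hb, fun _ => hbs⟩
    -- A default level, so that `b` is defined on all of `ℕ`; levels beyond `n` are never used.
    · exact ⟨δ, ⟨le_rfl, by linarith⟩, fun h => absurd h hj⟩
  choose b hb hbs using hlevels
  have hlt : ∀ i j : ℕ, i < j → j ≤ n → b j < b i := by
    intro i j hij hj
    by_contra! hle
    have h1 := swing_mono (hδ.trans_le (hb i).1) hle (by linarith [(hb j).2])
    rw [hbs i (hij.le.trans hj), hbs j hj] at h1
    have : (i : ℝ) * s < j * s := by gcongr
    linarith
  have hkb : ∀ j, k (τ (b j)) = b j := fun j => by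
    have h1 := hb j
    rw [hτk _ (by linarith [h1.1]), min_eq_left (by linarith [h1.2])]
  have hz : ∀ j : Fin n, ∃ z ∈ Ioo (τ (b j)) (τ (b (j + 1))), y z = 0 := by
    intro j
    have hj : (j : ℕ) + 1 ≤ n := j.2
    have h1 := hlt j (j + 1) (Nat.lt_succ_self _) hj
    have h2 : τ (b j) < τ (b (j + 1)) := by
      refine lt_of_le_of_ne (hanti h1.le) fun he => ?_
      have := hkb j
      rw [he, hkb] at this
      exact h1.ne this
    refine h.exists_turning (hτ _) (hτ _) h2 (hkb _) (hkb _) (le_refl η)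
      (by linarith [(hb j).2]) (H ε η _ _ hε0 (by linarith) hη0 (by linarith) (hb _).1 h1.le (hb _).2) ?_
    rw [hbs j (by omega), hbs (j + 1) hj]
    push_cast
    rw [hs]
    nlinarith [mul_pos hε0 hκ]
  choose z hzm hzy using hz
  have hinj : Function.Injective z := by
    have key : ∀ i j : Fin n, i < j → z i < z j := by
      intro i j hij
      have h1 : (i : ℕ) + 1 ≤ j := hij
      have h2 : τ (b (i + 1)) ≤ τ (b j) := by
        rcases h1.eq_or_lt with h3 | h3
        · rw [h3]
        · exact hanti (hlt _ _ h3 j.2.le).le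
      exact (hzm i).2.trans_le (h2.trans (hzm j).1.le)
    exact StrictMono.injective key
  calc (n : ℕ∞) ≤ (range z).encard := by simpa using hinj.encard_range
    _ ≤ _ := encard_le_encard ?_
  rintro _ ⟨j, rfl⟩
  have hj : (j : ℕ) + 1 ≤ n := j.2
  have hm : z j ∈ Ioo 0 T := ⟨(hτ _).1.trans_lt (hzm j).1, (hzm j).2.trans_le (hτ _).2⟩
  refine ⟨hm, hzy j, ?_⟩
  have h1 := h.en_mem (Ioo_subset_Icc_self hm)
  have h2 := hkc.antitone hε0 (hτ (b j)) (Ioo_subset_Icc_self hm) (hzm j).1.le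
  have h3 := hkc.antitone hε0 (Ioo_subset_Icc_self hm) (hτ (b (j + 1))) (hzm j).2.le
  rw [hkb] at h2 h3
  have h4 := (hb j).2
  have h5 := (hb (j + 1)).1
  have h6 : en (x (z j)) (y (z j)) = 1 - Real.cos (x (z j)) := by simp [en, hzy]
  rw [h6] at h1
  obtain ⟨h1l, h1u⟩ := h1
  have h7 := Real.sin_sq_add_cos_sq (x (z j))
  -- At rest the energy is `1 - cos x`, which stays away from `0` and `2`; so `sin² x ≥ δ² / 2`, and
  -- `ε < δ / 16`.
  have h8 : (2 * ε) ^ 2 < |Real.sin (x (z j))| ^ 2 := by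
    rw [sq_abs]
    have h9 : δ ≤ 1 - Real.cos (x (z j)) := by linarith
    have h10 : δ / 2 ≤ 1 + Real.cos (x (z j)) := by linarith
    have h11 : δ * (δ / 2) ≤ (1 - Real.cos (x (z j))) * (1 + Real.cos (x (z j))) :=
      mul_le_mul h9 h10 (by linarith) (by linarith)
    nlinarith [hε.2]
  exact lt_of_pow_lt_pow_left₀ 2 (abs_nonneg _) h8

end Braked

theorem tendsto_switchingNumber {m : ℝ → Phase → Motion} (hm : IsQuasioptimal m) :
    Tendsto (fun ε : ℝ => ENNReal.ofReal ε * switchingNumber m ε) (𝓝[>] 0)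
      (𝓝 (ENNReal.ofReal (∫ x in (0 : ℝ)..Real.pi, Real.sin x / (2 * x)))) := by
  rw [← swing_two]
  have hfr := hm.dryFriction
  obtain ⟨Λ, hΛ, hm⟩ := hm.exists_braked
  refine tendsto_ofReal_of_forall fun κ hκ => ?_
  obtain ⟨ε₁, hε₁, H₁⟩ := Braked.encard_turnings_le (half_pos hκ)
  have hI0 : 0 ≤ swing 2 := swing_nonneg zero_le_two le_rfl
  obtain ⟨δ, hδ0, hδ1, hδ⟩ : ∃ δ > 0, δ < 1 ∧ swing 2 - κ / 4 ≤ swing (2 - δ) - swing δ := by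
    have hc : Continuous fun δ : ℝ => swing (2 - δ) - swing δ :=
      (continuous_swing.comp (continuous_const.sub continuous_id)).sub continuous_swing
    have ht := (hc.tendsto 0).mono_left (nhdsWithin_le_nhds (s := Ioi (0 : ℝ)))
    rw [sub_zero, swing_zero, sub_zero] at ht
    obtain ⟨δ, h1, h2⟩ := ((ht.eventually_const_le (by linarith : swing 2 - κ / 4 < swing 2)).and
      (Ioo_mem_nhdsGT (zero_lt_one (α := ℝ)))).exists
    exact ⟨δ, h2.1, h2.2, h1⟩
  set κ₁ := κ / (4 * (swing 2 + 1)) with hκ₁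
  have hκ₁0 : 0 < κ₁ := by positivity
  have hκ₁I : κ₁ * swing 2 ≤ κ / 4 := by
    rw [hκ₁, div_mul_eq_mul_div, div_le_div_iff₀ (by positivity) (by norm_num)]
    nlinarith
  obtain ⟨ε₂, hε₂, H₂⟩ := Braked.le_encard_turnings hδ0 hδ1 hκ₁0
  filter_upwards [hm, hfr, hΛ.eventually_lt_const hε₁, hΛ.eventually_lt_const hε₂,
    hΛ.eventually_lt_const (half_pos hκ), Ioo_mem_nhdsGT hε₁, Ioo_mem_nhdsGT hε₂,
    Ioo_mem_nhdsGT (by positivity : 0 < κ / 4)] with ε h1 h2 h3 h4 h5 h6 h7 h8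
  have hε0 := h6.1
  constructor
  -- A point of energy exactly `2`; its motion must pass through the whole range of turning points.
  · set p : Phase := ((0 : ℝ), 2) with hp
    obtain ⟨hd, hb, -⟩ := h1 p
    have hen : 2 ≤ en ((m ε p).x 0) ((m ε p).y 0) := by
      rw [en_start hd, hp]
      simp [energy]; norm_num
    set s := ε * (1 + κ₁) with hs
    have hs0 : 0 < s := by positivity
    have hD : 0 ≤ swing (2 - δ) - swing δ :=
      sub_nonneg.2 (swing_mono hδ0 (by linarith) (by linarith))
    set n := ⌊(swing (2 - δ) - swing δ) / s⌋₊ with hn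
    have hns : n * s ≤ swing (2 - δ) - swing δ := by
      rw [← le_div_iff₀ hs0]; exact Nat.floor_le (by positivity)
    have hcard := H₂ hb h7.2 h4 hen n hns
    have hsub : {t ∈ Ioo 0 (m ε p).T | (m ε p).y t = 0 ∧ 2 * ε < |Real.sin ((m ε p).x t)|}
        ⊆ (m ε p).switchings := fun t ht =>
      ⟨ht.1, hb.ctrl.switching_of_turning ht.1 ht.2.1 ht.2.2 hb.friction⟩
    have hN : (n : ℝ≥0∞) ≤ switchingNumber m ε := by
      rw [← ENat.toENNReal_coe]
      exact (ENat.toENNReal_le.2 (hcard.trans (encard_le_encard hsub))).trans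
        (le_iSup (fun p => (m ε p).numSwitchings) p)
    calc ENNReal.ofReal (swing 2 - κ) ≤ ENNReal.ofReal (ε * n) := by
          refine ENNReal.ofReal_le_ofReal ?_
          have h9 := Nat.lt_floor_add_one ((swing (2 - δ) - swing δ) / s)
          rw [div_lt_iff₀ hs0, ← hn, hs] at h9
          by_contra! hlt
          have h10 : (ε * n + ε) * κ₁ ≤ swing 2 * κ₁ := by
            gcongr
            linarith [h8.2]
          have h11 : (n + 1) * (ε * (1 + κ₁)) = (ε * n + ε) + (ε * n + ε) * κ₁ := by ring
          linarith [h8.2]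
      _ = ENNReal.ofReal ε * n := by rw [ENNReal.ofReal_mul hε0.le, ENNReal.ofReal_natCast]
      _ ≤ _ := by gcongr
  · rw [switchingNumber, ENNReal.mul_iSup]
    refine iSup_le fun p => ?_
    obtain ⟨hd, hb, hz⟩ := h1 p
    have hsub : (m ε p).switchings ⊆ Braked.turnings ε (m ε p).T (m ε p).x (m ε p).y
        ∪ {t ∈ (m ε p).switchings | (m ε p).state t ∈ closure (standstill ε)} := by
      intro t ht
      by_cases hcl : (m ε p).state t ∈ closure (standstill ε)
      · exact Or.inr ⟨ht, hcl⟩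
      · exact Or.inl ⟨ht.1, turning_of_switching hb.ctrl (h2 p) ht hcl⟩
    have hcard := ENat.toENNReal_le.2 ((encard_le_encard hsub).trans (encard_union_le _ _))
    rw [ENat.toENNReal_add] at hcard
    calc ENNReal.ofReal ε * (m ε p).numSwitchings
        ≤ ENNReal.ofReal ε * (_ + ENNReal.ofReal (Λ ε)) := by
          refine mul_le_mul_right (hcard.trans (add_le_add_right hz _)) _
      _ = ENNReal.ofReal ε * _ + ENNReal.ofReal (ε * Λ ε) := by
          rw [mul_add, ENNReal.ofReal_mul hε0.le]
      _ ≤ ENNReal.ofReal (swing 2 + κ / 2) + ENNReal.ofReal (κ / 2) :=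
          add_le_add (H₁ hb h6.2 h3) (ENNReal.ofReal_le_ofReal h5.le)
      _ = ENNReal.ofReal (swing 2 + κ) := by
          rw [← ENNReal.ofReal_add (by positivity) (by positivity)]; congr 1; ring

/-! ### A feedback control and its trajectories -/

/-- The distance of `(x, y)` from the upper equilibrium `(-π, 0)` in the maximum norm. -/
def upperDist (x y : ℝ) : ℝ := max |x + Real.pi| |y|

/-- The feedback `-1`, which is changed to `1` close to the upper equilibrium `(-π, 0)`. -/
def feedback (ε x y : ℝ) : ℝ := -1 + 2 * max 0 (min 1 (5 * (9 / 5 - upperDist x y / ε)))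

theorem abs_feedback_le (ε x y : ℝ) : |feedback ε x y| ≤ 1 := by
  have h1 : 0 ≤ max 0 (min 1 (5 * (9 / 5 - upperDist x y / ε))) := le_max_left _ _
  have h2 : max 0 (min 1 (5 * (9 / 5 - upperDist x y / ε))) ≤ 1 :=
    max_le zero_le_one (min_le_left _ _)
  rw [feedback, abs_le]
  constructor <;> linarith

theorem feedback_eq_neg_one {ε x y : ℝ} (hε : 0 < ε) (h : 9 / 5 * ε ≤ upperDist x y) :
    feedback ε x y = -1 := by
  have h1 : 9 / 5 ≤ upperDist x y / ε := by rwa [le_div_iff₀ hε]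
  rw [feedback, max_eq_left ((min_le_right _ _).trans (by linarith))]
  ring

theorem feedback_eq_one {ε x y : ℝ} (hε : 0 < ε) (h : upperDist x y ≤ 8 / 5 * ε) :
    feedback ε x y = 1 := by
  have h1 : upperDist x y / ε ≤ 8 / 5 := by rwa [div_le_iff₀ hε]
  rw [feedback, min_eq_left (by linarith), max_eq_right zero_le_one]
  ring

theorem continuous_feedback (ε : ℝ) : Continuous fun p : ℝ × ℝ => feedback ε p.1 p.2 := by
  unfold feedback upperDist
  fun_prop

theorem abs_upperDist_sub_le (x y x' y' : ℝ) :
    |upperDist x y - upperDist x' y'| ≤ max |x - x'| |y - y'| := by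
  refine (abs_max_sub_max_le_max _ _ _ _).trans (max_le_max ?_ ?_)
  · refine (abs_abs_sub_abs_le _ _).trans (le_of_eq ?_)
    congr 1; ring
  · exact abs_abs_sub_abs_le _ _

theorem abs_feedback_sub_le {ε : ℝ} (hε : 0 < ε) (x y x' y' : ℝ) :
    |feedback ε x y - feedback ε x' y'| ≤ 10 / ε * max |x - x'| |y - y'| := by
  have e1 : feedback ε x y - feedback ε x' y'
      = 2 * (max 0 (min 1 (5 * (9 / 5 - upperDist x y / ε)))
        - max 0 (min 1 (5 * (9 / 5 - upperDist x' y' / ε)))) := by unfold feedback; ring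
  rw [e1, abs_mul, abs_two]
  have h1 := abs_max_sub_max_le_max 0 (min 1 (5 * (9 / 5 - upperDist x y / ε))) 0
    (min 1 (5 * (9 / 5 - upperDist x' y' / ε)))
  have h2 := abs_min_sub_min_le_max 1 (5 * (9 / 5 - upperDist x y / ε)) 1
    (5 * (9 / 5 - upperDist x' y' / ε))
  have h0 : ∀ c d : ℝ, max |c - c| |d| ≤ |d| := fun c d => max_le (by simp) le_rfl
  replace h1 := h1.trans (h0 _ _)
  replace h2 := h2.trans (h0 _ _)
  have e2 : 5 * (9 / 5 - upperDist x y / ε) - 5 * (9 / 5 - upperDist x' y' / ε)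
      = -(5 / ε * (upperDist x y - upperDist x' y')) := by ring
  rw [e2, abs_neg, abs_mul, abs_of_pos (by positivity : 0 < 5 / ε)] at h2
  calc 2 * _ ≤ 2 * (5 / ε * |upperDist x y - upperDist x' y'|) := by
        gcongr; exact h1.trans h2
    _ ≤ 2 * (5 / ε * max |x - x'| |y - y'|) := by gcongr; exact abs_upperDist_sub_le _ _ _ _
    _ = _ := by ring

/-- `x, y` follow the feedback control on `[0, T]`. -/
structure Follows (ε T : ℝ) (x y : ℝ → ℝ) : Prop where
  cont_angle : Continuous x
  cont_vel : Continuous y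
  ctrl : Controlled ε 0 T x y fun t => feedback ε (x t) (y t)
  deriv_vel : ∀ t ∈ Ioo 0 T, HasDerivAt y (-Real.sin (x t) + ε * feedback ε (x t) (y t)) t

/-- One application of Picard-Lindelöf covers `[0, T]` because the velocity is rescaled by `M = 2
T`: the first component of the field then grows so slowly that a ball of radius `a` is not left
before time `T`. -/
theorem exists_follows {ε T : ℝ} (hε : 0 < ε) (hε1 : ε ≤ 1) (hT : 0 < T) (x₀ y₀ : ℝ) :
    ∃ x y : ℝ → ℝ, Follows ε T x y ∧ x 0 = x₀ ∧ y 0 = y₀ := by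
  set M : ℝ := 2 * T with hM
  have hM0 : 0 < M := by positivity
  set f : ℝ → ℝ × ℝ → ℝ × ℝ := fun _ p =>
    (p.2 / M, M * (-Real.sin p.1 + ε * feedback ε p.1 (p.2 / M))) with hf
  set a : ℝ := |M * y₀| + 2 * M * T with ha
  have ha0 : 0 ≤ a := by positivity
  set K : ℝ := max (1 / M) (M * (1 + 10 * max 1 (1 / M))) with hK
  have hK0 : 0 ≤ K := le_max_of_le_left (by positivity)
  have hlip : LipschitzWith ⟨K, hK0⟩ (f 0) := by
    refine LipschitzWith.of_dist_le_mul fun p q => ?_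
    have hp1 : |p.1 - q.1| ≤ dist p q := by rw [← Real.dist_eq]; exact le_max_left _ _
    have hp2 : |p.2 - q.2| ≤ dist p q := by rw [← Real.dist_eq]; exact le_max_right _ _
    rw [Prod.dist_eq, Real.dist_eq, Real.dist_eq]
    refine max_le ?_ ?_
    · simp only [hf]
      rw [← sub_div, abs_div, abs_of_pos hM0, div_eq_inv_mul]
      refine mul_le_mul ?_ hp2 (abs_nonneg _) hK0
      rw [← one_div]; exact le_max_left _ _
    · simp only [hf]
      have e1 : M * (-Real.sin p.1 + ε * feedback ε p.1 (p.2 / M))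
          - M * (-Real.sin q.1 + ε * feedback ε q.1 (q.2 / M))
          = M * (-(Real.sin p.1 - Real.sin q.1)
            + ε * (feedback ε p.1 (p.2 / M) - feedback ε q.1 (q.2 / M))) := by ring
      rw [e1, abs_mul, abs_of_pos hM0]
      have h1 : |Real.sin p.1 - Real.sin q.1| ≤ dist p q := by
        refine le_trans ?_ hp1
        have := Real.lipschitzWith_sin.dist_le_mul p.1 q.1
        simpa [Real.dist_eq] using this
      have h2 := abs_feedback_sub_le hε p.1 (p.2 / M) q.1 (q.2 / M)
      have h3 : max |p.1 - q.1| |p.2 / M - q.2 / M| ≤ max 1 (1 / M) * dist p q := by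
        refine max_le ?_ ?_
        · exact hp1.trans (le_mul_of_one_le_left dist_nonneg (le_max_left _ _))
        · rw [← sub_div, abs_div, abs_of_pos hM0, div_eq_inv_mul, ← one_div]
          exact mul_le_mul (le_max_right _ _) hp2 (abs_nonneg _) (by positivity)
      calc M * _ ≤ M * (dist p q + 10 * (max 1 (1 / M) * dist p q)) := by
            gcongr
            refine (abs_add_le _ _).trans ?_
            rw [abs_neg, abs_mul, abs_of_pos hε]
            refine add_le_add h1 ?_
            calc ε * _ ≤ ε * (10 / ε * (max 1 (1 / M) * dist p q)) := by
                  gcongr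
                  exact h2.trans (by gcongr)
              _ = _ := by field_simp
        _ = M * (1 + 10 * max 1 (1 / M)) * dist p q := by ring
        _ ≤ K * dist p q := by gcongr; exact le_max_right _ _
  have hpl : IsPicardLindelof f (tmin := 0) (tmax := T) ⟨0, left_mem_Icc.2 hT.le⟩ (x₀, M * y₀)
      ⟨a, ha0⟩ 0 ⟨a / T, by positivity⟩ ⟨K, hK0⟩ := by
    refine ⟨fun t _ => hlip.lipschitzOnWith, fun p _ => continuousOn_const, fun t _ p hp => ?_, ?_⟩
    · rw [Metric.mem_closedBall, Prod.dist_eq, max_le_iff, Real.dist_eq, Real.dist_eq] at hp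
      have hp2 : |p.2| ≤ |M * y₀| + a := by
        have := abs_sub_abs_le_abs_sub p.2 (M * y₀)
        have h3 : |p.2 - M * y₀| ≤ a := hp.2
        linarith
      rw [Prod.norm_def, Real.norm_eq_abs, Real.norm_eq_abs]
      change max _ _ ≤ a / T
      have h2 : 0 ≤ 2 * M * T := by positivity
      refine max_le ?_ ?_
      · simp only [hf]
        rw [abs_div, abs_of_pos hM0, div_le_div_iff₀ hM0 hT]
        rw [hM]
        nlinarith
      · simp only [hf]
        rw [abs_mul, abs_of_pos hM0, le_div_iff₀ hT]
        have h3 : |-Real.sin p.1 + ε * feedback ε p.1 (p.2 / M)| ≤ 2 := by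
          refine (abs_add_le _ _).trans ?_
          rw [abs_neg, abs_mul, abs_of_pos hε]
          have h4 := Real.abs_sin_le_one p.1
          have h5 := abs_feedback_le ε p.1 (p.2 / M)
          nlinarith [abs_nonneg (feedback ε p.1 (p.2 / M))]
        calc M * |-Real.sin p.1 + ε * feedback ε p.1 (p.2 / M)| * T ≤ M * 2 * T := by gcongr
          _ ≤ a := by rw [ha]; linarith [abs_nonneg (M * y₀)]
    · simp only [sub_zero, sub_self, max_eq_left hT.le, NNReal.coe_zero]
      change a / T * T ≤ a
      rw [div_mul_cancel₀ _ hT.ne']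
  obtain ⟨α, hα0, hα⟩ := hpl.exists_eq_forall_mem_Icc_hasDerivWithinAt₀
  have hαc : ContinuousOn α (Icc 0 T) := fun t ht => (hα t ht).continuousWithinAt
  set β : ℝ → ℝ × ℝ := IccExtend hT.le ((Icc 0 T).domRestrict α) with hβ
  have hβc : Continuous β := (continuousOn_iff_continuous_domRestrict.1 hαc).Icc_extend'
  have hβeq : ∀ t ∈ Icc 0 T, β t = α t := fun t ht => by rw [hβ, IccExtend_of_mem _ _ ht]; rfl
  have hβd : ∀ t ∈ Ioo 0 T, HasDerivAt β (f t (β t)) t := fun t ht => by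
    rw [hβeq t (Ioo_subset_Icc_self ht)]
    refine ((hα t (Ioo_subset_Icc_self ht)).hasDerivAt (Icc_mem_nhds ht.1 ht.2)).congr_of_eventuallyEq ?_
    filter_upwards [Icc_mem_nhds ht.1 ht.2] with s hs
    exact hβeq s hs
  set x : ℝ → ℝ := fun t => (β t).1 with hx
  set y : ℝ → ℝ := fun t => (β t).2 / M with hy
  have hxc : Continuous x := continuous_fst.comp hβc
  have hyc : Continuous y := (continuous_snd.comp hβc).div_const M
  have hgc : Continuous fun t => feedback ε (x t) (y t) :=
    (continuous_feedback ε).comp (hxc.prodMk hyc)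
  have hxd : ∀ t ∈ Ioo 0 T, HasDerivAt x (y t) t := fun t ht => (hβd t ht).fst
  have hyd : ∀ t ∈ Ioo 0 T, HasDerivAt y (-Real.sin (x t) + ε * feedback ε (x t) (y t)) t :=
    fun t ht => by
      have h1 : HasDerivAt (fun t => (β t).2) (f t (β t)).2 t := (hβd t ht).snd
      exact (h1.div_const M).congr_deriv (mul_div_cancel_left₀ _ hM0.ne')
  have hβ0 : β 0 = (x₀, M * y₀) := by
    rw [hβeq 0 (left_mem_Icc.2 hT.le)]; exact hα0
  have hIoo : ∀ s ∈ Icc 0 T, ∀ t ∈ Icc 0 T, Ioo (min s t) (max s t) ⊆ Ioo 0 T :=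
    fun s hs t ht r hr => ⟨(le_min hs.1 ht.1).trans_lt hr.1, hr.2.trans_le (max_le hs.2 ht.2)⟩
  refine ⟨x, y, ⟨hxc, hyc, ⟨hT.le, hε, hgc.measurable, fun t _ => abs_feedback_le _ _ _,
    hxc.continuousOn, hyc.continuousOn, fun s hs t ht => ?_, fun s hs t ht => ?_⟩, hyd⟩, ?_, ?_⟩
  · exact (integral_eq_sub_of_hasDeriv_right hxc.continuousOn (fun r hr =>
      (hxd r (hIoo s hs t ht hr)).hasDerivWithinAt) (hyc.intervalIntegrable _ _)).symm
  · exact (integral_eq_sub_of_hasDeriv_right hyc.continuousOn (fun r hr =>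
      (hyd r (hIoo s hs t ht hr)).hasDerivWithinAt) (Continuous.intervalIntegrable (by fun_prop) _ _)).symm
  · rw [hx]; simp only [hβ0]
  · rw [hy]; simp only [hβ0]; rw [mul_div_cancel_left₀ _ hM0.ne']

/-! ### The time near the equilibria -/

namespace Controlled

variable {ε a b : ℝ} {x y u : ℝ → ℝ}

theorem angle_mono (h : Controlled ε a b x y u) (hy : ∀ t ∈ Icc a b, 0 ≤ y t) {s t : ℝ}
    (hs : s ∈ Icc a b) (ht : t ∈ Icc a b) (hst : s ≤ t) : x s ≤ x t := by
  have h1 := h.angle s hs t ht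
  have h2 : 0 ≤ ∫ r in s..t, y r :=
    integral_nonneg hst fun r hr => hy r ⟨hs.1.trans hr.1, hr.2.trans ht.2⟩
  linarith

theorem en_sub_mem (h : Controlled ε a b x y u) (hy : ∀ t ∈ Icc a b, 0 ≤ y t) {s t : ℝ}
    (hs : s ∈ Icc a b) (ht : t ∈ Icc a b) (hst : s ≤ t) :
    |en (x t) (y t) - en (x s) (y s)| ≤ ε * (x t - x s) := by
  have h1 := h.energy_sub hs ht
  have hsub := h.uIcc_subset hs ht
  have hi : IntervalIntegrable y volume s t := h.integrable_vel.mono_set hsub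
  have hc : IntervalIntegrable (fun r => ε * (u r * y r)) volume s t :=
    ((h.integrable_control.mul_continuousOn (h.uIcc_eq ▸ h.cont_vel)).const_mul ε).mono_set hsub
  have e : en (x t) (y t) - en (x s) (y s) = ∫ r in s..t, ε * (u r * y r) := h1
  have hmem : ∀ r ∈ Icc s t, r ∈ Icc a b := fun r hr => ⟨hs.1.trans hr.1, hr.2.trans ht.2⟩
  have hpt : ∀ r ∈ Icc s t, |ε * (u r * y r)| ≤ ε * y r := fun r hr => by
    rw [abs_mul, abs_mul, abs_of_pos h.eps_pos, abs_of_nonneg (hy r (hmem r hr))]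
    have := h.bound r (hmem r hr)
    have h2 := hy r (hmem r hr)
    have h3 := h.eps_pos
    gcongr
    nlinarith
  rw [e, h.angle s hs t ht, ← intervalIntegral.integral_const_mul]
  calc |∫ r in s..t, ε * (u r * y r)| ≤ ∫ r in s..t, |ε * (u r * y r)| :=
        abs_integral_le_integral_abs hst
    _ ≤ _ := integral_mono_on hst hc.abs (hi.const_mul ε) hpt

/-- Lower bounds for `y' + y`. -/
theorem vel_add_angle_sub_ge (h : Controlled ε a b x y u) {s t c : ℝ} (hs : s ∈ Icc a b)
    (ht : t ∈ Icc a b) (hst : s ≤ t)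
    (hc : ∀ r ∈ Ioo s t, c ≤ (-Real.sin (x r) + ε * u r) + y r) :
    c * (t - s) ≤ (y t - y s) + (x t - x s) := by
  have hsub := h.uIcc_subset hs ht
  rw [h.vel s hs t ht, h.angle s hs t ht, ← intervalIntegral.integral_add
    (h.integrable_force.mono_set hsub) (h.integrable_vel.mono_set hsub)]
  have h1 : ∫ _ in s..t, c = c * (t - s) := by simp [mul_comm]
  rw [← h1]
  exact integral_mono_on_of_le_Ioo hst intervalIntegrable_const
    ((h.integrable_force.mono_set hsub).add (h.integrable_vel.mono_set hsub)) hc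

end Controlled

theorem lt_sin_of_le {ε z : ℝ} (hε : 0 < ε) (hε1 : ε ≤ 1 / 100) (h0 : 8 / 5 * ε ≤ z)
    (h1 : z ≤ 16 / 5 * ε) : 3 / 2 * ε ≤ Real.sin z := by
  have h2 := Real.sin_gt_sub_cube (x := z) (by linarith)
  have h3 : z ^ 3 ≤ z * (1 / 600) := by
    have : z * z ≤ 1 / 25 * (1 / 25) := by gcongr <;> linarith
    nlinarith
  linarith

/-- Velocities of an arc over a short angle close to an equilibrium differ little. -/
theorem vel_sub_le_of_close {ε ys yt D e : ℝ} (hε : 0 < ε) (hs : 0 ≤ ys)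
    (h : yt ^ 2 / 2 - ys ^ 2 / 2 ≤ e + D) (he : e ≤ ε * (16 / 5 * ε)) (hD : D ≤ (16 / 5 * ε) ^ 2 / 2) :
    yt - ys ≤ 41 / 10 * ε := by
  by_contra! hn
  have h1 : (41 / 10 * ε) ^ 2 < (yt - ys) ^ 2 := by gcongr
  nlinarith

namespace Follows

variable {ε T : ℝ} {x y : ℝ → ℝ}

/-- The push of the feedback away from the upper equilibrium. -/
theorem push (hε : 0 < ε) (hε1 : ε ≤ 1 / 100) {v w : ℝ} (hv : -Real.pi ≤ v)
    (hv1 : v ≤ -Real.pi + 16 / 5 * ε) (hw : 0 ≤ w) (hw1 : w < 8 / 5 * ε) :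
    ε / 2 ≤ -Real.sin v + ε * feedback ε v w := by
  have hsin : -Real.sin v = Real.sin (v + Real.pi) := by rw [Real.sin_add_pi]
  rw [hsin]
  rcases le_total (v + Real.pi) (8 / 5 * ε) with h1 | h1
  · have h2 : upperDist v w ≤ 8 / 5 * ε := by
      refine max_le ?_ ?_
      · rwa [abs_of_nonneg (by linarith)]
      · rw [abs_of_nonneg hw]; exact hw1.le
    have h3 : 0 ≤ Real.sin (v + Real.pi) :=
      Real.sin_nonneg_of_nonneg_of_le_pi (by linarith) (by linarith [Real.pi_gt_three])
    rw [feedback_eq_one hε h2]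
    linarith
  · have h2 := lt_sin_of_le hε hε1 h1 (by linarith)
    have h3 := (abs_le.1 (abs_feedback_le ε v w)).1
    nlinarith

/-- Here `y' + y ≥ ε / 2`: for small velocity the feedback pushes away from the equilibrium,
otherwise `y` itself outweighs the control. As `x + y` grows by at most `(16 / 5 + 41 / 10) ε`, the
time is below `15`. -/
theorem time_upper_left (h : Follows ε T x y) (hε1 : ε ≤ 1 / 100) {s t : ℝ} (hs : 0 ≤ s)
    (hst : s ≤ t) (ht : t ≤ T) (hy : ∀ r ∈ Icc s t, 0 ≤ y r)
    (hx : ∀ r ∈ Icc s t, x r ∈ Icc (-Real.pi) (-Real.pi + 16 / 5 * ε)) : t - s ≤ 15 := by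
  have hc := h.ctrl.mono hst hs ht
  have hε := hc.eps_pos
  have h1 := hc.vel_add_angle_sub_ge (c := ε / 2) hc.left_mem hc.right_mem hst fun r hr => by
    have hr' := Ioo_subset_Icc_self hr
    have hyr := hy r hr'
    rcases lt_or_ge (y r) (8 / 5 * ε) with h2 | h2
    · have := push hε hε1 (hx r hr').1 (hx r hr').2 hyr h2
      linarith
    · have h3 : 0 ≤ -Real.sin (x r) := by
        rw [← Real.sin_add_pi]
        have := hx r hr'
        exact Real.sin_nonneg_of_nonneg_of_le_pi (by linarith [this.1])
          (by linarith [this.2, Real.pi_gt_three])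
      have h4 := (abs_le.1 (abs_feedback_le ε (x r) (y r))).1
      nlinarith
  have h2 := hc.en_sub_mem hy hc.left_mem hc.right_mem hst
  have hxs := hx s hc.left_mem
  have hxt := hx t hc.right_mem
  have h3 : y t - y s ≤ 41 / 10 * ε := by
    refine vel_sub_le_of_close (e := ε * (x t - x s)) (D := Real.cos (x t) - Real.cos (x s)) hε (hy s hc.left_mem)
      ?_ (by gcongr; linarith [hxs.1, hxt.2]) ?_
    · have := (abs_le.1 h2).2
      unfold en at this
      linarith
    · have e1 := Real.cos_add_pi (x t)
      have e2 := Real.neg_one_le_cos (x s)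
      have e3 := Real.one_sub_sq_div_two_le_cos (x := x t + Real.pi)
      have e4 : (x t + Real.pi) ^ 2 ≤ (16 / 5 * ε) ^ 2 :=
        pow_le_pow_left₀ (by linarith [hxt.1]) (by linarith [hxt.2]) 2
      linarith
  have h4 : ε / 2 * (t - s) ≤ ε / 2 * 15 := by linarith [hxs.1, hxt.2]
  exact le_of_mul_le_mul_left h4 (by positivity)

theorem feedback_of_far (hε : 0 < ε) {v w : ℝ} (h : -Real.pi + 9 / 5 * ε ≤ v) :
    feedback ε v w = -1 :=
  feedback_eq_neg_one hε (le_max_of_le_left ((by linarith : 9 / 5 * ε ≤ v + Real.pi).trans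
    (le_abs_self _)))

/-- Climbing towards the top with control `-1` gives `y' ≤ -ε`, and the velocity can lose at most
`41 / 10 * ε`. -/
theorem time_upper_right (h : Follows ε T x y) (hε1 : ε ≤ 1 / 100) {s t : ℝ} (hs : 0 ≤ s)
    (hst : s ≤ t) (ht : t ≤ T) (hy : ∀ r ∈ Icc s t, 0 ≤ y r)
    (hx : ∀ r ∈ Icc s t, x r ∈ Icc (Real.pi - 16 / 5 * ε) Real.pi) : t - s ≤ 5 := by
  have hc := h.ctrl.mono hst hs ht
  have hε := hc.eps_pos
  have hpi := Real.pi_gt_three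
  have h1 := hc.vel_sub_le (c := -ε) hc.left_mem hc.right_mem hst fun r hr => by
    have hr' := hx r (Ioo_subset_Icc_self hr)
    rw [feedback_of_far hε (by linarith [hr'.1])]
    have := Real.sin_nonneg_of_nonneg_of_le_pi (by linarith [hr'.1]) hr'.2
    linarith
  have h2 := hc.en_sub_mem hy hc.left_mem hc.right_mem hst
  have hxs := hx s hc.left_mem
  have hxt := hx t hc.right_mem
  have h3 : y s - y t ≤ 41 / 10 * ε := by
    refine vel_sub_le_of_close (e := ε * (x t - x s)) (D := Real.cos (x s) - Real.cos (x t)) hε (hy t hc.right_mem)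
      ?_ (by gcongr; linarith [hxs.1, hxt.2]) ?_
    · have := (abs_le.1 h2).1
      unfold en at this
      linarith
    · have e1 := Real.cos_sub_pi (x s)
      have e2 := Real.neg_one_le_cos (x t)
      have e3 := Real.one_sub_sq_div_two_le_cos (x := x s - Real.pi)
      have e4 : (x s - Real.pi) ^ 2 ≤ (16 / 5 * ε) ^ 2 := by
        rw [← neg_sq]
        exact pow_le_pow_left₀ (by linarith [hxs.2]) (by linarith [hxs.1]) 2
      linarith
  have h4 : ε * (t - s) ≤ ε * 5 := by linarith
  exact le_of_mul_le_mul_left h4 hε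

/-- With control `-1` the equilibrium moves to `-arcsin ε`, and `sin` has slope at least `1 / 2` on
`[-1, 1]`. -/
theorem half_mul_le_sin_add {ε v : ℝ} (hε : 0 < ε) (hε1 : ε ≤ 1 / 100) (hv : |v| ≤ 1) :
    1 / 2 * (v + Real.arcsin ε) ^ 2 ≤ (v + Real.arcsin ε) * (Real.sin v + ε) := by
  have h1 := arcsin_le_of_nonneg hε.le (by linarith)
  have h0 := Real.arcsin_nonneg.2 hε.le
  have hpi := Real.pi_gt_three
  have key : ∀ p q : ℝ, -1 ≤ p → p ≤ q → q ≤ 1 → 1 / 2 * (q - p) ≤ Real.sin q - Real.sin p := by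
    intro p q hp hpq hq
    refine Convex.mul_sub_le_image_sub_of_le_deriv (convex_Icc (-1) 1)
      Real.continuous_sin.continuousOn Real.differentiable_sin.differentiableOn (fun r hr => ?_)
      p ⟨hp, by linarith⟩ q ⟨by linarith, hq⟩ hpq
    rw [interior_Icc] at hr
    rw [Real.deriv_sin]
    have h2 := Real.one_sub_sq_div_two_le_cos (x := r)
    nlinarith [hr.1, hr.2]
  have e1 : Real.sin (-Real.arcsin ε) = -ε := by
    rw [Real.sin_neg, Real.sin_arcsin (by linarith) (by linarith)]
  rw [abs_le] at hv
  rcases le_total (-Real.arcsin ε) v with h2 | h2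
  · have := key _ _ (by linarith) h2 hv.2
    rw [e1] at this
    nlinarith
  · have := key _ _ hv.1 h2 (by linarith)
    rw [e1] at this
    nlinarith

/-- The polar angle about the shifted equilibrium `(-arcsin ε, 0)` turns at a rate at least `1 / 2`,
and it ranges over an interval of length `π` while `y > 0`. -/
theorem time_lower (h : Follows ε T x y) (hε1 : ε ≤ 1 / 100) {s t : ℝ} (hs : 0 ≤ s)
    (ht : t ≤ T) (hy : ∀ r ∈ Ioo s t, 0 < y r)
    (hx : ∀ r ∈ Icc s t, |x r| ≤ 1) : t - s ≤ 2 * Real.pi := by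
  have hε := h.ctrl.eps_pos
  have hpi := Real.pi_gt_three
  have key : ∀ p q, s < p → p < q → q < t → q - p ≤ 2 * Real.pi := by
    intro p q hp hpq hq
    set φ : ℝ → ℝ := fun r => Real.arctan ((x r + Real.arcsin ε) / y r) with hφ
    have hd : ∀ r ∈ Ioo s t, HasDerivAt φ
        (1 / (1 + ((x r + Real.arcsin ε) / y r) ^ 2)
          * ((y r * y r - (x r + Real.arcsin ε) * (-Real.sin (x r) + ε * feedback ε (x r) (y r)))
            / y r ^ 2)) r := by
      intro r hr
      have hr' : r ∈ Ioo 0 T := ⟨hs.trans_lt hr.1, hr.2.trans_le ht⟩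
      exact (((h.ctrl.hasDerivAt_angle hr').add_const _).fun_div (h.deriv_vel r hr')
        (hy r hr).ne').arctan
    obtain ⟨r, hr, hslope⟩ := exists_hasDerivAt_eq_slope φ _ hpq
      (fun r hr => (hd r ⟨hp.trans_le hr.1, hr.2.trans_lt hq⟩).continuousAt.continuousWithinAt)
      (fun r hr => hd r ⟨hp.trans hr.1, hr.2.trans hq⟩)
    have hrm : r ∈ Ioo s t := ⟨hp.trans hr.1, hr.2.trans hq⟩
    have hyr := hy r hrm
    have hxr := hx r (Ioo_subset_Icc_self hrm)
    have hge : 1 / 2 ≤ (φ q - φ p) / (q - p) := by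
      rw [← hslope, feedback_of_far hε (by linarith [(abs_le.1 hxr).1])]
      have h1 := half_mul_le_sin_add hε hε1 hxr
      have e1 : 1 / (1 + ((x r + Real.arcsin ε) / y r) ^ 2)
          * ((y r * y r - (x r + Real.arcsin ε) * (-Real.sin (x r) + ε * -1)) / y r ^ 2)
          = (y r ^ 2 + (x r + Real.arcsin ε) * (Real.sin (x r) + ε))
            / (y r ^ 2 + (x r + Real.arcsin ε) ^ 2) := by
        field_simp
        ring
      rw [e1, le_div_iff₀ (by positivity)]
      nlinarith [sq_nonneg (y r)]
    rw [le_div_iff₀ (by linarith)] at hge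
    have h2 := Real.arctan_lt_pi_div_two ((x q + Real.arcsin ε) / y q)
    have h3 := Real.neg_pi_div_two_lt_arctan ((x p + Real.arcsin ε) / y p)
    simp only [hφ] at hge
    linarith
  -- The velocity may vanish at the ends, so the estimate is applied to a slightly shorter interval.
  by_contra! hn
  have := key (s + (t - s - 2 * Real.pi) / 3) (t - (t - s - 2 * Real.pi) / 3) (by linarith)
    (by linarith) (by linarith)
  linarith

/-- The part of a time interval on which an increasing angle lies in an interval. -/
theorem volume_le_of_window {S : Set ℝ} {B : ℝ}
    (h : ∀ s ∈ S, ∀ t ∈ S, s ≤ t → t - s ≤ B) : volume S ≤ ENNReal.ofReal B := by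
  refine (Real.volume_le_diam S).trans (Metric.ediam_le fun s hs t ht => ?_)
  rw [edist_dist, Real.dist_eq]
  refine ENNReal.ofReal_le_ofReal ?_
  rcases le_total s t with h1 | h1
  · rw [abs_sub_comm, abs_of_nonneg (by linarith)]; exact h s hs t ht h1
  · rw [abs_of_nonneg (by linarith)]; exact h t ht s hs h1

/-- The width comes from `arcsin (2 ε) ≤ 16 / 5 * ε`. The generous middle interval costs nothing, as
`time_lower` allows angles up to 1. -/
theorem zone_split {ε v : ℝ} (hε : 0 < ε) (hε1 : ε ≤ 1 / 100) (hv : v ∈ Icc (-Real.pi) Real.pi)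
    (hs : |Real.sin v| < 2 * ε) :
    v ∈ Icc (-Real.pi) (-Real.pi + 16 / 5 * ε) ∨ v ∈ Icc (-1 : ℝ) 1
      ∨ v ∈ Icc (Real.pi - 16 / 5 * ε) Real.pi := by
  by_contra! hn
  simp only [mem_Icc, not_and, not_le] at hn
  obtain ⟨h1, h2, h3⟩ := hn
  have h1 := h1 hv.1
  have h3 : v < Real.pi - 16 / 5 * ε := by by_contra! h; exact (h3 h).not_ge hv.2
  have harc := arcsin_le_of_nonneg (ε := 2 * ε) (by linarith) (by linarith)
  have key : ∀ w, 1 < w → w < Real.pi - 16 / 5 * ε → 2 * ε ≤ Real.sin w := fun w h4 h5 =>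
    le_sin_of_mem (by linarith) (by linarith) ⟨by linarith, by linarith⟩
  rcases le_or_gt (-1) v with h4 | h4
  · have := key v (h2 h4) h3
    linarith [le_abs_self (Real.sin v)]
  · have := key (-v) (by linarith) (by linarith)
    rw [Real.sin_neg] at this
    linarith [neg_abs_le (Real.sin v)]

theorem volume_zone_le (h : Follows ε T x y) (hε1 : ε ≤ 1 / 100) {b : ℝ} (hb0 : 0 ≤ b) (hb : b ≤ T)
    (hy : ∀ t ∈ Ioo 0 b, 0 < y t) (hy' : ∀ t ∈ Icc 0 b, 0 ≤ y t)
    (hx : ∀ t ∈ Icc 0 b, x t ∈ Icc (-Real.pi) Real.pi) :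
    volume {t ∈ Icc 0 b | |Real.sin (x t)| < 2 * ε ∧ |y t| < 2 * ε} ≤ ENNReal.ofReal 27 := by
  have hc := h.ctrl.mono hb0 le_rfl hb
  have hε := hc.eps_pos
  set W : ℝ → ℝ → Set ℝ := fun c d => {t ∈ Icc 0 b | x t ∈ Icc c d} with hW
  have hwin : ∀ c d s t, s ∈ W c d → t ∈ W c d → ∀ r ∈ Icc s t, x r ∈ Icc c d := by
    intro c d s t hs ht r hr
    have hr' : r ∈ Icc 0 b := ⟨hs.1.1.trans hr.1, hr.2.trans ht.1.2⟩
    exact ⟨hs.2.1.trans (hc.angle_mono hy' hs.1 hr' hr.1),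
      (hc.angle_mono hy' hr' ht.1 hr.2).trans ht.2.2⟩
  have hsub : ∀ {c d s t r : ℝ}, s ∈ W c d → t ∈ W c d → r ∈ Icc s t → r ∈ Icc 0 b :=
    fun hs ht hr => ⟨hs.1.1.trans hr.1, hr.2.trans ht.1.2⟩
  have v1 : volume (W (-Real.pi) (-Real.pi + 16 / 5 * ε)) ≤ ENNReal.ofReal 15 :=
    volume_le_of_window fun s hs t ht hst => h.time_upper_left hε1 hs.1.1 hst
      (ht.1.2.trans hb) (fun r hr => hy' r (hsub hs ht hr)) (hwin _ _ s t hs ht)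
  have v2 : volume (W (-1) 1) ≤ ENNReal.ofReal 7 :=
    volume_le_of_window fun s hs t ht hst => by
      have := h.time_lower hε1 hs.1.1 (ht.1.2.trans hb)
        (fun r hr => hy r ⟨hs.1.1.trans_lt hr.1, hr.2.trans_le ht.1.2⟩)
        (fun r hr => abs_le.2 (hwin _ _ s t hs ht r hr))
      linarith [Real.pi_lt_d2]
  have v3 : volume (W (Real.pi - 16 / 5 * ε) Real.pi) ≤ ENNReal.ofReal 5 :=
    volume_le_of_window fun s hs t ht hst => h.time_upper_right hε1 hs.1.1 hst
      (ht.1.2.trans hb) (fun r hr => hy' r (hsub hs ht hr)) (hwin _ _ s t hs ht)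
  have hcov : {t ∈ Icc 0 b | |Real.sin (x t)| < 2 * ε ∧ |y t| < 2 * ε}
      ⊆ (W (-Real.pi) (-Real.pi + 16 / 5 * ε) ∪ W (-1) 1) ∪ W (Real.pi - 16 / 5 * ε) Real.pi := by
    intro t ht
    rcases zone_split hε hε1 (hx t ht.1) ht.2.1 with h1 | h1 | h1
    · exact Or.inl (Or.inl ⟨ht.1, h1⟩)
    · exact Or.inl (Or.inr ⟨ht.1, h1⟩)
    · exact Or.inr ⟨ht.1, h1⟩
  calc _ ≤ _ := measure_mono hcov
    _ ≤ (volume _ + volume _) + volume _ :=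
      (measure_union_le _ _).trans (add_le_add_left (measure_union_le _ _) _)
    _ ≤ (ENNReal.ofReal 15 + ENNReal.ofReal 7) + ENNReal.ofReal 5 :=
      add_le_add (add_le_add v1 v2) v3
    _ = ENNReal.ofReal 27 := by
      rw [← ENNReal.ofReal_add (by norm_num) (by norm_num),
        ← ENNReal.ofReal_add (by norm_num) (by norm_num)]
      norm_num

end Follows

/-! ### Concatenation of motions -/

namespace Controlled

variable {ε a b c : ℝ} {x y u x' y' u' : ℝ → ℝ}

theorem congr (h : Controlled ε a b x y u) (hx : EqOn x x' (Icc a b)) (hy : EqOn y y' (Icc a b))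
    (hu : EqOn u u' (Ioo a b)) (hm : Measurable u') (hb : ∀ t ∈ Icc a b, |u' t| ≤ 1) :
    Controlled ε a b x' y' u' := by
  refine ⟨h.le, h.eps_pos, hm, hb, h.cont_angle.congr hx.symm, h.cont_vel.congr hy.symm,
    fun s hs t ht => ?_, fun s hs t ht => ?_⟩
  · rw [← hx hs, ← hx ht, h.angle s hs t ht]
    exact integral_congr fun r hr => hy (uIcc_subset_Icc hs ht hr)
  · rw [← hy hs, ← hy ht, h.vel s hs t ht]
    refine integral_congr_ae ?_
    have h₁ : ∀ᵐ t : ℝ, t ≠ a := by simp [ae_iff, measure_singleton]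
    have h₂ : ∀ᵐ t : ℝ, t ≠ b := by simp [ae_iff, measure_singleton]
    filter_upwards [h₁, h₂] with r h1 h2 hr
    have hr' := uIcc_subset_Icc hs ht (uIoc_subset_uIcc hr)
    rw [hx hr', hu ⟨lt_of_le_of_ne hr'.1 h1.symm, lt_of_le_of_ne hr'.2 h2⟩]

theorem _root_.intervalIntegral.sub_eq_integral_of_adjacent {X F : ℝ → ℝ} {a b c : ℝ}
    (hab : a ≤ b) (hbc : b ≤ c)
    (hF1 : IntervalIntegrable F volume a b) (hF2 : IntervalIntegrable F volume b c)
    (h1 : ∀ s ∈ Icc a b, ∀ t ∈ Icc a b, X t - X s = ∫ r in s..t, F r)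
    (h2 : ∀ s ∈ Icc b c, ∀ t ∈ Icc b c, X t - X s = ∫ r in s..t, F r) :
    ∀ s ∈ Icc a c, ∀ t ∈ Icc a c, X t - X s = ∫ r in s..t, F r := by
  have key : ∀ t ∈ Icc a c, X t - X b = ∫ r in b..t, F r := fun t ht => by
    rcases le_total t b with h | h
    · exact h1 b ⟨hab, le_rfl⟩ t ⟨ht.1, h⟩
    · exact h2 b ⟨le_rfl, hbc⟩ t ⟨h, ht.2⟩
  have hi : IntervalIntegrable F volume a c := hF1.trans hF2
  have hi' : ∀ t ∈ Icc a c, IntervalIntegrable F volume b t := fun t ht =>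
    hi.mono_set (uIcc_subset_uIcc (Icc_subset_uIcc ⟨hab, hbc⟩) (Icc_subset_uIcc ht))
  intro s hs t ht
  rw [← integral_interval_sub_left (hi' t ht) (hi' s hs), ← key t ht, ← key s hs]
  ring

theorem trans (h : Controlled ε a b x y u) (h' : Controlled ε b c x y u) :
    Controlled ε a c x y u := by
  have hU : Icc a b ∪ Icc b c = Icc a c := Icc_union_Icc_eq_Icc h.le h'.le
  refine ⟨h.le.trans h'.le, h.eps_pos, h.meas, fun t ht => ?_, ?_, ?_,
    sub_eq_integral_of_adjacent h.le h'.le h.integrable_vel h'.integrable_vel h.angle h'.angle,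
    sub_eq_integral_of_adjacent h.le h'.le h.integrable_force h'.integrable_force h.vel h'.vel⟩
  · rw [← hU] at ht
    exact ht.elim (h.bound t) (h'.bound t)
  · rw [← hU]; exact h.cont_angle.union_of_isClosed h'.cont_angle isClosed_Icc isClosed_Icc
  · rw [← hU]; exact h.cont_vel.union_of_isClosed h'.cont_vel isClosed_Icc isClosed_Icc

theorem translate (h : Controlled ε a b x y u) (d : ℝ) :
    Controlled ε (a + d) (b + d) (fun t => x (t - d)) (fun t => y (t - d)) fun t => u (t - d) := by
  have hm : ∀ t ∈ Icc (a + d) (b + d), t - d ∈ Icc a b := fun t ht =>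
    ⟨by linarith [ht.1], by linarith [ht.2]⟩
  refine ⟨by linarith [h.le], h.eps_pos, h.meas.comp (measurable_id.sub measurable_const),
    fun t ht => h.bound _ (hm t ht), h.cont_angle.comp (by fun_prop) hm,
    h.cont_vel.comp (by fun_prop) hm, fun s hs t ht => ?_, fun s hs t ht => ?_⟩
  · rw [integral_comp_sub_right (fun r => y r) d, ← h.angle _ (hm s hs) _ (hm t ht)]
  · rw [integral_comp_sub_right (fun r => -Real.sin (x r) + ε * u r) d,
      ← h.vel _ (hm s hs) _ (hm t ht)]

end Controlled

/-- A controlled motion with dry friction outside the standstill zone. -/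
structure Arc (ε T : ℝ) (x y u : ℝ → ℝ) : Prop where
  ctrl : Controlled ε 0 T x y u
  friction : ∀ t ∈ Icc 0 T, ¬(|Real.sin (x t)| < 2 * ε ∧ |y t| < 2 * ε) → u t = -Real.sign (y t)

/-- The times spent in the standstill zone. -/
def zoneTimes (ε T : ℝ) (x y : ℝ → ℝ) : Set ℝ :=
  {t ∈ Icc 0 T | |Real.sin (x t)| < 2 * ε ∧ |y t| < 2 * ε}

/-- The switchings in the closed standstill zone. -/
def zoneSwitchings (ε T : ℝ) (x y u : ℝ → ℝ) : Set ℝ :=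
  {t ∈ Ioo 0 T | (¬∃ c, Tendsto u (𝓝[≠] t) (𝓝 c)) ∧ |Real.sin (x t)| ≤ 2 * ε ∧ |y t| ≤ 2 * ε}

/-- From `(x₀, y₀)` there is a motion to the lower equilibrium with at most `c` switchings and at
most the time `27 c` in the standstill zone. -/
def Damps (ε c x₀ y₀ : ℝ) : Prop :=
  ∃ (T : ℝ) (x y u : ℝ → ℝ), Arc ε T x y u ∧ x 0 = x₀ ∧ y 0 = y₀ ∧ (∃ n : ℤ, x T = n * (2 * Real.pi)) ∧
    y T = 0 ∧ volume (zoneTimes ε T x y) ≤ ENNReal.ofReal (27 * c) ∧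
      (((zoneSwitchings ε T x y u).encard : ℕ∞) : ℝ≥0∞) ≤ ENNReal.ofReal c

namespace Damps

variable {ε c d x₀ y₀ : ℝ}

theorem mono (h : Damps ε c x₀ y₀) (hcd : c ≤ d) : Damps ε d x₀ y₀ := by
  obtain ⟨T, x, y, u, ha, h1, h2, h3, h4, h5, h6⟩ := h
  exact ⟨T, x, y, u, ha, h1, h2, h3, h4, h5.trans (ENNReal.ofReal_le_ofReal (by linarith)),
    h6.trans (ENNReal.ofReal_le_ofReal hcd)⟩

theorem neg (h : Damps ε c x₀ y₀) : Damps ε c (-x₀) (-y₀) := by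
  obtain ⟨T, x, y, u, ha, h1, h2, ⟨n, h3⟩, h4, h5, h6⟩ := h
  refine ⟨T, fun t => -x t, fun t => -y t, fun t => -u t, ⟨ha.ctrl.neg, fun t ht hn => ?_⟩,
    by simp [h1], by simp [h2], ⟨-n, by simp only [h3]; push_cast; ring⟩, by simp [h4], ?_, ?_⟩
  · rw [Real.sin_neg, abs_neg, abs_neg] at hn
    rw [ha.friction t ht hn, Real.sign_neg]
  · simpa [zoneTimes] using h5
  · refine le_trans (ENat.toENNReal_le.2 (encard_le_encard ?_)) h6
    rintro t ⟨ht, hs, h7, h8⟩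
    rw [Real.sin_neg, abs_neg] at h7
    rw [abs_neg] at h8
    exact ⟨ht, fun ⟨e, he⟩ => hs ⟨-e, he.neg⟩, h7, h8⟩

theorem add_int_mul (h : Damps ε c x₀ y₀) (k : ℤ) : Damps ε c (x₀ + k * (2 * Real.pi)) y₀ := by
  obtain ⟨T, x, y, u, ha, h1, h2, ⟨n, h3⟩, h4, h5, h6⟩ := h
  have hsin : ∀ r, Real.sin (r + k * (2 * Real.pi)) = Real.sin r := fun r =>
    Real.sin_add_int_mul_two_pi r k
  refine ⟨T, fun t => x t + k * (2 * Real.pi), y, u, ⟨ha.ctrl.shift hsin, fun t ht hn => ?_⟩,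
    by simp [h1], h2, ⟨n + k, by simp only [h3]; push_cast; ring⟩, h4, ?_, ?_⟩
  · rw [hsin] at hn
    exact ha.friction t ht hn
  · simpa [zoneTimes, hsin] using h5
  · simpa only [zoneSwitchings, hsin] using h6

/-- The first arc has no switching inside, so the only new one can occur at the junction. The budget
`d` pays for it and for the zone time of the arc; an arc away from the zone is free, `d = 0`. -/
theorem append {T : ℝ} {x y u : ℝ → ℝ} (ha : Arc ε T x y u) (hc : 0 ≤ c) (hd : 0 ≤ d)
    (hv : volume (zoneTimes ε T x y) ≤ ENNReal.ofReal (27 * d))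
    (hu : ∀ t ∈ Ioo 0 T, ∃ c, Tendsto u (𝓝[≠] t) (𝓝 c))
    (hj : |Real.sin (x T)| ≤ 2 * ε → |y T| ≤ 2 * ε → 1 ≤ d) (h : Damps ε c (x T) (y T)) :
    Damps ε (c + d) (x 0) (y 0) := by
  obtain ⟨S, x', y', u', ha', h1, h2, ⟨n, h3⟩, h4, h5, h6⟩ := h
  have hT := ha.ctrl.le
  have hS := ha'.ctrl.le
  set X : ℝ → ℝ := fun t => if t ≤ T then x t else x' (t - T) with hX
  set Y : ℝ → ℝ := fun t => if t ≤ T then y t else y' (t - T) with hY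
  set U : ℝ → ℝ := fun t => if t < T then u t else u' (t - T) with hU
  have hUm : Measurable U := Measurable.ite measurableSet_Iio ha.ctrl.meas
    (ha'.ctrl.meas.comp (measurable_id.sub measurable_const))
  have X1 : ∀ t, t ≤ T → X t = x t := fun t ht => if_pos ht
  have Y1 : ∀ t, t ≤ T → Y t = y t := fun t ht => if_pos ht
  have U1 : ∀ t, t < T → U t = u t := fun t ht => if_pos ht
  have X2 : ∀ t, T ≤ t → X t = x' (t - T) := fun t ht => by
    rcases ht.eq_or_lt with rfl | ht
    · rw [X1 _ le_rfl, sub_self, h1]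
    · exact if_neg (not_le.2 ht)
  have Y2 : ∀ t, T ≤ t → Y t = y' (t - T) := fun t ht => by
    rcases ht.eq_or_lt with rfl | ht
    · rw [Y1 _ le_rfl, sub_self, h2]
    · exact if_neg (not_le.2 ht)
  have U2 : ∀ t, T ≤ t → U t = u' (t - T) := fun t ht => if_neg (not_lt.2 ht)
  have hm2 : ∀ t, T ≤ t → t ≤ T + S → t - T ∈ Icc 0 S := fun t h1 h2 =>
    ⟨by linarith, by linarith⟩
  have hUb : ∀ t ∈ Icc 0 (T + S), |U t| ≤ 1 := fun t ht => by
    rcases lt_or_ge t T with h7 | h7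
    · rw [U1 t h7]; exact ha.ctrl.bound t ⟨ht.1, h7.le⟩
    · rw [U2 t h7]; exact ha'.ctrl.bound _ (hm2 t h7 ht.2)
  have c1 : Controlled ε 0 T X Y U := ha.ctrl.congr (fun t ht => (X1 t ht.2).symm)
    (fun t ht => (Y1 t ht.2).symm) (fun t ht => (U1 t ht.2).symm) hUm
    fun t ht => hUb t ⟨ht.1, by linarith [ht.2]⟩
  have ht2 := ha'.ctrl.translate T
  rw [zero_add, add_comm S T] at ht2
  have c2 : Controlled ε T (T + S) X Y U := ht2.congr (fun t ht => (X2 t ht.1).symm)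
    (fun t ht => (Y2 t ht.1).symm) (fun t ht => (U2 t ht.1.le).symm) hUm
    fun t ht => hUb t ⟨by linarith [ht.1], ht.2⟩
  refine ⟨T + S, X, Y, U, ⟨c1.trans c2, fun t ht hn => ?_⟩, X1 0 hT, Y1 0 hT, ⟨n, ?_⟩, ?_, ?_, ?_⟩
  · rcases lt_or_ge t T with h7 | h7
    · rw [X1 t h7.le, Y1 t h7.le] at hn
      rw [U1 t h7, Y1 t h7.le]
      exact ha.friction t ⟨ht.1, h7.le⟩ hn
    · rw [X2 t h7, Y2 t h7] at hn
      rw [U2 t h7, Y2 t h7]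
      exact ha'.friction _ (hm2 t h7 ht.2) hn
  · rw [X2 _ (by linarith), add_sub_cancel_left, h3]
  · rw [Y2 _ (by linarith), add_sub_cancel_left, h4]
  · have hsub : zoneTimes ε (T + S) X Y
        ⊆ zoneTimes ε T x y ∪ (fun t => t + -T) ⁻¹' zoneTimes ε S x' y' := by
      rintro t ⟨ht, hz⟩
      rcases le_total t T with h7 | h7
      · rw [X1 t h7, Y1 t h7] at hz
        exact Or.inl ⟨⟨ht.1, h7⟩, hz⟩
      · rw [X2 t h7, Y2 t h7] at hz
        exact Or.inr ⟨hm2 t h7 ht.2, hz⟩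
    calc volume (zoneTimes ε (T + S) X Y) ≤ _ := (measure_mono hsub).trans (measure_union_le _ _)
      _ = volume (zoneTimes ε T x y) + volume (zoneTimes ε S x' y') := by
        rw [measure_preimage_add_right]
      _ ≤ ENNReal.ofReal (27 * d) + ENNReal.ofReal (27 * c) := add_le_add hv h5
      _ = ENNReal.ofReal (27 * (c + d)) := by
        rw [← ENNReal.ofReal_add (by positivity) (by positivity)]
        congr 1; ring
  · have hloc1 : ∀ t, t < T → U =ᶠ[𝓝 t] u := fun t ht => by
      filter_upwards [Iio_mem_nhds ht] with r hr using U1 r hr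
    have hloc2 : ∀ t, T < t → U =ᶠ[𝓝 t] fun r => u' (r - T) := fun t ht => by
      filter_upwards [Ioi_mem_nhds ht] with r hr using U2 r (le_of_lt hr)
    set J : Set ℝ := {t | t = T ∧ |Real.sin (x T)| ≤ 2 * ε ∧ |y T| ≤ 2 * ε} with hJ
    have hsub : zoneSwitchings ε (T + S) X Y U
        ⊆ J ∪ (fun t => t + T) '' zoneSwitchings ε S x' y' u' := by
      rintro t ⟨ht, hs, hz⟩
      rcases lt_trichotomy t T with h7 | h7 | h7
      · obtain ⟨e, he⟩ := hu t ⟨ht.1, h7⟩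
        exact absurd ⟨e, he.congr' ((hloc1 t h7).symm.filter_mono nhdsWithin_le_nhds)⟩ hs
      · rw [h7, X1 T le_rfl, Y1 T le_rfl] at hz
        exact Or.inl ⟨h7, hz⟩
      · rw [X2 t h7.le, Y2 t h7.le] at hz
        refine Or.inr ⟨t - T, ⟨⟨by linarith, by linarith [ht.2]⟩, ?_, hz⟩, by ring⟩
        rintro ⟨e, he⟩
        refine hs ⟨e, ?_⟩
        have h8 : Tendsto (fun r => r - T) (𝓝[≠] t) (𝓝[≠] (t - T)) := by
          refine tendsto_nhdsWithin_iff.2 ⟨?_, ?_⟩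
          · exact ((continuous_id.sub continuous_const).tendsto t).mono_left nhdsWithin_le_nhds
          · filter_upwards [self_mem_nhdsWithin] with r hr h9
            exact hr (by simpa using h9)
        exact (he.comp h8).congr' ((hloc2 t h7).symm.filter_mono nhdsWithin_le_nhds)
    have hcard := ENat.toENNReal_le.2 ((encard_le_encard hsub).trans (encard_union_le _ _))
    rw [ENat.toENNReal_add] at hcard
    have hJc : ((J.encard : ℕ∞) : ℝ≥0∞) ≤ ENNReal.ofReal d := by
      by_cases hz : |Real.sin (x T)| ≤ 2 * ε ∧ |y T| ≤ 2 * ε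
      · have h7 : J ⊆ {T} := fun t ht => ht.1
        have h8 := ENat.toENNReal_le.2 (encard_le_encard h7)
        rw [encard_singleton, ENat.toENNReal_one] at h8
        exact h8.trans (ENNReal.one_le_ofReal.2 (hj hz.1 hz.2))
      · have h7 : J = ∅ := eq_empty_of_forall_notMem fun t ht => hz ht.2
        simp [h7]
    have himg := ENat.toENNReal_le.2
      (encard_image_le (fun t => t + T) (zoneSwitchings ε S x' y' u'))
    calc _ ≤ _ := hcard
      _ ≤ ENNReal.ofReal d + ENNReal.ofReal c := add_le_add hJc (himg.trans h6)
      _ = ENNReal.ofReal (c + d) := by rw [← ENNReal.ofReal_add hd hc, add_comm]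

/-- A motion to the lower equilibrium, as a `Motion`. -/
theorem exists_motion (h : Damps ε c x₀ y₀) {p : Phase} (hp : ((x₀ : Real.Angle), y₀) = p) :
    ∃ m : Motion, m.IsDamping ε p ∧ m.DryFriction ε ∧
      volume {t ∈ Icc 0 m.T | m.state t ∈ standstill ε} ≤ ENNReal.ofReal (27 * c) ∧
      (({t ∈ m.switchings | m.state t ∈ closure (standstill ε)}.encard : ℕ∞) : ℝ≥0∞)
        ≤ ENNReal.ofReal c := by
  obtain ⟨T, x, y, u, ha, h1, h2, ⟨n, h3⟩, h4, h5, h6⟩ := h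
  have hc := ha.ctrl
  refine ⟨⟨T, x, y, u⟩, ⟨hc.le, hc.meas, hc.bound, fun t ht => ?_, hc.cont_vel, fun t ht => ?_, ?_, ?_⟩,
    fun t ht hn => ha.friction t ht fun h => hn ((mem_standstill_state _ t).2 h), ?_, ?_⟩
  · set Y : ℝ → ℝ := IccExtend hc.le ((Icc 0 T).domRestrict y) with hY
    have hYc : Continuous Y := (continuousOn_iff_continuous_domRestrict.1 hc.cont_vel).Icc_extend'
    have hYe : ∀ r ∈ Icc 0 T, Y r = y r := fun r hr => by rw [hY, IccExtend_of_mem _ _ hr]; rfl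
    have hd : HasDerivAt (fun r => x 0 + ∫ q in (0 : ℝ)..r, Y q) (Y t) t :=
      ((hYc.integral_hasStrictDerivAt 0 t).hasDerivAt).const_add _
    have he : ∀ r ∈ Icc 0 T, x r = x 0 + ∫ q in (0 : ℝ)..r, Y q := fun r hr => by
      have h7 : ∫ q in (0 : ℝ)..r, Y q = ∫ q in (0 : ℝ)..r, y q :=
        integral_congr fun q hq => hYe q (uIcc_subset_Icc hc.left_mem hr hq)
      rw [h7, ← hc.angle 0 hc.left_mem r hr]; ring
    rw [hYe t ht] at hd
    exact hd.hasDerivWithinAt.congr he (he t ht)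
  · have := hc.vel 0 hc.left_mem t ht
    simp only
    linarith
  · simp only [Motion.state, h1, h2, hp]
  · simp only [Motion.state, h3, h4]
    ext1
    · simp only
      rw [Real.Angle.intCast_mul_eq_zsmul, Real.Angle.coe_two_pi, smul_zero]
    · rfl
  · simp only [mem_standstill_state]; exact h5
  · refine le_trans (ENat.toENNReal_le.2 (encard_le_encard ?_)) h6
    rintro t ⟨ht, hz⟩
    refine ⟨ht.1, ht.2, ?_⟩
    have hcl : IsClosed {p : Phase | |p.1.sin| ≤ 2 * ε ∧ |p.2| ≤ 2 * ε} :=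
      (isClosed_le (Real.Angle.continuous_sin.comp continuous_fst).abs continuous_const).inter
        (isClosed_le continuous_snd.abs continuous_const)
    have h7 : closure (standstill ε) ⊆ {p : Phase | |p.1.sin| ≤ 2 * ε ∧ |p.2| ≤ 2 * ε} :=
      closure_minimal (fun p hp => ⟨hp.1.le, hp.2.le⟩) hcl
    simpa [Motion.state] using h7 hz

end Damps

/-! ### Runs of the feedback control -/

theorem feedback_of_not_zone {ε v w : ℝ} (hε : 0 < ε)
    (h : ¬(|Real.sin v| < 2 * ε ∧ |w| < 2 * ε)) : feedback ε v w = -1 := by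
  refine feedback_eq_neg_one hε ?_
  by_contra! hn
  obtain ⟨h1, h2⟩ := max_lt_iff.1 hn
  refine h ⟨?_, by linarith⟩
  have h3 : |Real.sin (v + Real.pi)| ≤ |v + Real.pi| := Real.abs_sin_le_abs
  rw [Real.sin_add_pi, abs_neg] at h3
  linarith

/-- A run: a motion with nonnegative velocity across the angles between `-π` and `π`, up to a
standstill or the upper equilibrium. -/
structure Run (ε x₀ y₀ T : ℝ) (x y u : ℝ → ℝ) : Prop where
  arc : Arc ε T x y u
  angle_zero : x 0 = x₀
  vel_zero : y 0 = y₀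
  vel_nonneg : ∀ t ∈ Icc 0 T, 0 ≤ y t
  angle_mem : ∀ t ∈ Icc 0 T, x t ∈ Icc (-Real.pi) Real.pi
  finish : x T = Real.pi ∨ y T = 0 ∧ -Real.sin (x T) + ε * feedback ε (x T) 0 ≤ 0
  volume_le : volume (zoneTimes ε T x y) ≤ ENNReal.ofReal 27
  no_switching : ∀ t ∈ Ioo 0 T, ∃ c, Tendsto u (𝓝[≠] t) (𝓝 c)
  energy_le : ∀ s ∈ Icc 0 T, ∀ t ∈ Icc 0 T, s ≤ t →
    en (x t) (y t) - en (x s) (y s) ≤ -ε * (x t - x s) + 4 * ε ^ 2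
  energy_le_of_far : -Real.pi + 9 / 5 * ε ≤ x₀ →
    en (x T) (y T) - en (x 0) (y 0) ≤ -ε * (x T - x 0)

namespace Follows

variable {ε T : ℝ} {x y : ℝ → ℝ}

theorem en_sub_of_far (h : Follows ε T x y) (hy : ∀ t ∈ Icc 0 T, 0 ≤ y t) {s t : ℝ}
    (hs : s ∈ Icc 0 T) (ht : t ∈ Icc 0 T) (hst : s ≤ t) (hf : -Real.pi + 9 / 5 * ε ≤ x s) :
    en (x t) (y t) - en (x s) (y s) = -ε * (x t - x s) := by
  have hc := h.ctrl
  rw [hc.angle s hs t ht, ← intervalIntegral.integral_const_mul]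
  refine (hc.energy_sub hs ht).trans (integral_congr fun r hr => ?_)
  rw [uIcc_of_le hst] at hr
  have hx := hc.angle_mono hy hs ⟨hs.1.trans hr.1, hr.2.trans ht.2⟩ hr.1
  rw [feedback_of_far hc.eps_pos (hf.trans hx)]
  ring

/-- The feedback can differ from friction only for angles up to `-π + 9 / 5 * ε`. Over that stretch
energy may be gained at rate `ε` instead of lost, a difference of at most `18 / 5 * ε²`. -/
theorem en_sub_le (h : Follows ε T x y) (hy : ∀ t ∈ Icc 0 T, 0 ≤ y t)
    (hx : ∀ t ∈ Icc 0 T, -Real.pi ≤ x t) {s t : ℝ}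
    (hs : s ∈ Icc 0 T) (ht : t ∈ Icc 0 T) (hst : s ≤ t) :
    en (x t) (y t) - en (x s) (y s) ≤ -ε * (x t - x s) + 4 * ε ^ 2 := by
  have hc := h.ctrl
  have hε := hc.eps_pos
  have hxs := hx s hs
  rcases le_total (-Real.pi + 9 / 5 * ε) (x s) with h1 | h1
  · rw [h.en_sub_of_far hy hs ht hst h1]
    nlinarith
  rcases le_total (-Real.pi + 9 / 5 * ε) (x t) with h2 | h2
  · obtain ⟨r, hr, hxr⟩ := intermediate_value_Icc hst
      (hc.cont_angle.mono (Icc_subset_Icc hs.1 ht.2)) ⟨h1, h2⟩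
    have hr' : r ∈ Icc 0 T := ⟨hs.1.trans hr.1, hr.2.trans ht.2⟩
    have e1 := h.en_sub_of_far hy hr' ht hr.2 hxr.ge
    have e2 := (abs_le.1 (hc.en_sub_mem hy hs hr' hr.1)).2
    rw [hxr] at e1 e2
    nlinarith
  · have e2 := (abs_le.1 (hc.en_sub_mem hy hs ht hst)).2
    nlinarith

end Follows

/-- The run is the feedback motion up to the first time at which the velocity returns to zero or the
angle reaches `π`. -/
theorem exists_run {ε : ℝ} (hε : 0 < ε) (hε1 : ε ≤ 1 / 100) {x₀ y₀ : ℝ}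
    (hx₀ : x₀ ∈ Ico (-Real.pi) Real.pi) (hy₀ : 0 ≤ y₀)
    (hst : 0 < y₀ ∨ 0 < -Real.sin x₀ + ε * feedback ε x₀ y₀) :
    ∃ (T : ℝ) (x y u : ℝ → ℝ), Run ε x₀ y₀ T x y u := by
  have hpi := Real.pi_pos
  -- A motion that has not ended covers at most the angle `2 π`; `residence_le` at scale `2 ε` with
  -- zone time `27` bounds its duration by `31 π / ε + 30 + 7 * 27 < H`.
  set H : ℝ := 31 * Real.pi / ε + 300 with hH
  have hH0 : 0 < H := by positivity
  obtain ⟨x, y, hf, hx0, hy0⟩ := exists_follows hε (by linarith) hH0 x₀ y₀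
  have hxc := hf.cont_angle
  have hyc := hf.cont_vel
  have hgc : Continuous fun t => feedback ε (x t) (y t) :=
    (continuous_feedback ε).comp (hxc.prodMk hyc)
  have hfc : Continuous fun t => -Real.sin (x t) + ε * feedback ε (x t) (y t) := by fun_prop
  -- the motion starts
  obtain ⟨d, hd0, hdH, hd⟩ : ∃ d > 0, d ≤ H ∧ ∀ t ∈ Ioc 0 d, 0 < y t ∧ x t < Real.pi := by
    have hxev : ∀ᶠ t in 𝓝 (0 : ℝ), x t < Real.pi :=
      hxc.continuousAt.eventually_lt_const (by rw [hx0]; exact hx₀.2)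
    rcases hst with h1 | h1
    · have hyev : ∀ᶠ t in 𝓝 (0 : ℝ), 0 < y t :=
        hyc.continuousAt.eventually_const_lt (by rwa [hy0])
      obtain ⟨e, he, H1⟩ := Metric.eventually_nhds_iff.1 (hyev.and hxev)
      refine ⟨min (e / 2) H, lt_min (by positivity) hH0, min_le_right _ _, fun t ht => H1 ?_⟩
      rw [Real.dist_eq, sub_zero, abs_of_pos ht.1]
      linarith [ht.2, min_le_left (e / 2) H]
    · have hfev : ∀ᶠ t in 𝓝 (0 : ℝ), 0 < -Real.sin (x t) + ε * feedback ε (x t) (y t) :=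
        hfc.continuousAt.eventually_const_lt (by simp only [hx0, hy0]; exact h1)
      obtain ⟨e, he, H1⟩ := Metric.eventually_nhds_iff.1 (hfev.and hxev)
      have habs : ∀ t, 0 ≤ t → t ≤ e / 2 → dist t 0 < e := fun t h2 h3 => by
        rw [Real.dist_eq, sub_zero, abs_of_nonneg h2]; linarith
      refine ⟨min (e / 2) H, lt_min (by positivity) hH0, min_le_right _ _, fun t ht =>
        ⟨?_, (H1 (habs t ht.1.le (ht.2.trans (min_le_left _ _)))).2⟩⟩
      have h2 : 0 < ∫ r in (0 : ℝ)..t, (-Real.sin (x r) + ε * feedback ε (x r) (y r)) :=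
        intervalIntegral_pos_of_pos_on (hfc.intervalIntegrable _ _) (fun r hr =>
          (H1 (habs r hr.1.le (hr.2.le.trans (ht.2.trans (min_le_left _ _))))).1) ht.1
      have h3 := hf.ctrl.vel 0 hf.ctrl.left_mem t ⟨ht.1.le, ht.2.trans (min_le_right _ _)⟩
      rw [hy0] at h3
      linarith
  -- the motion ends
  set F : Set ℝ := Icc d H ∩ {t | y t ≤ 0 ∨ Real.pi ≤ x t} with hF
  have hFc : IsClosed F := isClosed_Icc.inter
    ((isClosed_le hyc continuous_const).union (isClosed_le continuous_const hxc))
  have hclosed : IsClosed {t | 0 ≤ y t ∧ x t ≤ Real.pi} :=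
    (isClosed_le continuous_const hyc).inter (isClosed_le hxc continuous_const)
  have hext : ∀ b, 0 < b → (∀ t ∈ Ioo 0 b, 0 < y t ∧ x t < Real.pi) →
      ∀ t ∈ Icc 0 b, 0 ≤ y t ∧ x t ≤ Real.pi := fun b hb h t ht => by
    rw [← closure_Ioo hb.ne] at ht
    exact closure_minimal (show Ioo 0 b ⊆ {t | 0 ≤ y t ∧ x t ≤ Real.pi} from
      fun r hr => ⟨(h r hr).1.le, (h r hr).2.le⟩) hclosed ht
  have hlow : ∀ b, 0 ≤ b → b ≤ H → (∀ t ∈ Icc 0 b, 0 ≤ y t) → ∀ t ∈ Icc 0 b, -Real.pi ≤ x t :=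
    fun b hb0 hb h t ht => by
    have hc := hf.ctrl.mono hb0 le_rfl hb
    have := hc.angle_mono h hc.left_mem ht ht.1
    rw [hx0] at this
    exact hx₀.1.trans this
  have hFn : F.Nonempty := by
    by_contra hn
    rw [not_nonempty_iff_eq_empty] at hn
    have h1 : ∀ t ∈ Ioo 0 H, 0 < y t ∧ x t < Real.pi := by
      intro t ht
      rcases le_or_gt t d with h2 | h2
      · exact hd t ⟨ht.1, h2⟩
      · by_contra h3
        have : t ∈ F := ⟨⟨h2.le, ht.2.le⟩, by
          rcases not_and_or.1 h3 with h4 | h4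
          · exact Or.inl (not_lt.1 h4)
          · exact Or.inr (not_lt.1 h4)⟩
        rw [hn] at this
        exact this
    have h2 := hext H hH0 h1
    have h3 := hlow H hH0.le le_rfl fun t ht => (h2 t ht).1
    have hv := hf.volume_zone_le hε1 hH0.le le_rfl (fun t ht => (h1 t ht).1) (fun t ht => (h2 t ht).1)
      fun t ht => ⟨h3 t ht, (h2 t ht).2⟩
    have hres := hf.ctrl.residence_le (r := fun _ => 2 * ε) (r' := fun _ => 0) (fun _ _ => le_rfl)
      (contDiff_const (n := 1)).contDiffOn.absolutelyContinuousOnInterval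
      (fun t _ => hasDerivAt_const t _) (fun t _ => by simp)
      (Z := {t ∈ Icc 0 H | |Real.sin (x t)| < 2 * ε ∧ |y t| < 2 * ε})
      (Braked.measurableSet_zone hf.ctrl)
      (fun t ht h4 h5 => ⟨Ioo_subset_Icc_self ht, h5, h4⟩) (by norm_num : (0 : ℝ) ≤ 27)
      ((measure_mono inter_subset_left).trans hv)
    have h4 : ∫ t in (0 : ℝ)..H, |y t| = x H - x 0 := by
      rw [hf.ctrl.angle 0 hf.ctrl.left_mem H hf.ctrl.right_mem]
      refine integral_congr fun t ht => ?_
      rw [hf.ctrl.uIcc_eq] at ht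
      exact abs_of_nonneg (h2 t ht).1
    rw [intervalIntegral.integral_div, h4, hx0] at hres
    have h5 : (x H - x₀) / (2 * ε) ≤ Real.pi / ε := by
      rw [div_le_div_iff₀ (by positivity) hε]
      have := (h2 H hf.ctrl.right_mem).2
      nlinarith [hx₀.1]
    have h6 : 31 * Real.pi / ε = 31 * (Real.pi / ε) := by ring
    have h7 : H = 31 * (Real.pi / ε) + 300 := by rw [hH, h6]
    linarith
  have hFb : BddBelow F := ⟨d, fun r hr => hr.1.1⟩
  set T := sInf F with hT
  have hTF : T ∈ F := hFc.csInf_mem hFn hFb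
  have hT0 : 0 < T := hd0.trans_le hTF.1.1
  have hTH : T ≤ H := hTF.1.2
  have h1 : ∀ t ∈ Ioo 0 T, 0 < y t ∧ x t < Real.pi := by
    intro t ht
    rcases le_or_gt t d with h2 | h2
    · exact hd t ⟨ht.1, h2⟩
    · by_contra h3
      refine not_le.2 ht.2 (csInf_le hFb ⟨⟨h2.le, ht.2.le.trans hTH⟩, ?_⟩)
      rcases not_and_or.1 h3 with h4 | h4
      · exact Or.inl (not_lt.1 h4)
      · exact Or.inr (not_lt.1 h4)
  have h2 := hext T hT0 h1
  have hyT : ∀ t ∈ Icc 0 T, 0 ≤ y t := fun t ht => (h2 t ht).1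
  have h3 := hlow T hT0.le hTH hyT
  have hc := hf.ctrl.mono hT0.le le_rfl hTH
  have hf' : Follows ε T x y :=
    ⟨hxc, hyc, hc, fun t ht => hf.deriv_vel t ⟨ht.1, ht.2.trans_le hTH⟩⟩
  have hv := hf.volume_zone_le hε1 hT0.le hTH (fun t ht => (h1 t ht).1) hyT
    fun t ht => ⟨h3 t ht, (h2 t ht).2⟩
  -- the control
  set u : ℝ → ℝ := fun t => if y t = 0 ∧ 2 * ε ≤ |Real.sin (x t)| then 0 else feedback ε (x t) (y t)
    with hu
  have hum : Measurable u := by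
    refine Measurable.ite ?_ measurable_const hgc.measurable
    exact ((isClosed_eq hyc continuous_const).inter
      (isClosed_le continuous_const (Real.continuous_sin.comp hxc).abs)).measurableSet
  -- The value `0`, which friction prescribes at a standstill outside the zone, occurs on `[0, T]`
  -- at most at the two ends, since the velocity is positive between them.
  have hui : ∀ t ∈ Ioo 0 T, u t = feedback ε (x t) (y t) := fun t ht =>
    if_neg fun h => (h1 t ht).1.ne' h.1
  have hub : ∀ t, |u t| ≤ 1 := fun t => by
    simp only [hu]
    split_ifs
    · simp
    · exact abs_feedback_le _ _ _
  refine ⟨T, x, y, u, ⟨?_, fun t ht hz => ?_⟩, hx0, hy0, hyT, fun t ht => ⟨h3 t ht, (h2 t ht).2⟩, ?_,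
    hv, fun t ht => ⟨feedback ε (x t) (y t), ?_⟩, fun s hs t ht hst => hf'.en_sub_le hyT h3 hs ht hst,
    fun hfar => ?_⟩
  · exact hc.congr (fun _ _ => rfl) (fun _ _ => rfl) (fun t ht => (hui t ht).symm) hum
      fun t _ => hub t
  · rcases (hyT t ht).eq_or_lt with h4 | h4
    · have h5 : 2 * ε ≤ |Real.sin (x t)| := by
        by_contra! hn
        exact hz ⟨hn, by rw [← h4, abs_zero]; positivity⟩
      rw [hu]
      simp only
      rw [if_pos ⟨h4.symm, h5⟩, ← h4, Real.sign_zero, neg_zero]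
    · rw [hu]
      simp only
      rw [if_neg fun h => h4.ne' h.1, feedback_of_not_zone hε hz, Real.sign_of_pos h4]
  · rcases hTF.2 with h4 | h4
    · refine Or.inr ?_
      have hyT0 : y T = 0 := le_antisymm h4 (hyT T hc.right_mem)
      refine ⟨hyT0, ?_⟩
      -- A positive force at a standstill would mean a negative velocity just before it.
      by_contra! hpos
      have hpos' : 0 < -Real.sin (x T) + ε * feedback ε (x T) (y T) := by rw [hyT0]; exact hpos
      have hfev : ∀ᶠ t in 𝓝 T, 0 < -Real.sin (x t) + ε * feedback ε (x t) (y t) :=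
        hfc.continuousAt.eventually_const_lt hpos'
      obtain ⟨e, he, H1⟩ := Metric.eventually_nhds_iff.1 hfev
      set s := max (T / 2) (T - e / 2) with hs
      have hsT : s < T := max_lt (by linarith) (by linarith)
      have hs0 : 0 < s := lt_max_of_lt_left (by linarith)
      have h5 : 0 < ∫ r in s..T, (-Real.sin (x r) + ε * feedback ε (x r) (y r)) :=
        intervalIntegral_pos_of_pos_on (hfc.intervalIntegrable _ _) (fun r hr => H1 (by
          rw [Real.dist_eq, abs_sub_comm, abs_of_pos (by linarith [hr.2])]
          linarith [hr.1, le_max_right (T / 2) (T - e / 2)])) hsT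
      have h6 := hc.vel s ⟨hs0.le, hsT.le⟩ T hc.right_mem
      have h7 := (h1 s ⟨hs0, hsT⟩).1
      linarith
    · exact Or.inl (le_antisymm (h2 T hc.right_mem).2 h4)
  · have h4 : u =ᶠ[𝓝 t] fun t => feedback ε (x t) (y t) := by
      filter_upwards [Ioo_mem_nhds ht.1 ht.2] with r hr using hui r hr
    exact ((hgc.tendsto t).congr' h4.symm).mono_left nhdsWithin_le_nhds
  · rw [← hx0] at hfar
    exact (hf'.en_sub_of_far hyT hc.left_mem hc.right_mem hT0.le hfar).le

/-! ### Damping from an arbitrary state -/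

/-- A motion to the lower equilibrium inside the standstill zone. -/
theorem Damps.of_near {ε x₀ : ℝ} (hε : 0 < ε) (hε1 : ε ≤ 1 / 100) (h0 : -(19 / 10 * ε) ≤ x₀)
    (h1 : x₀ ≤ 0) : Damps ε 1 x₀ 0 := by
  have hpi := Real.pi_pos
  -- Half a cosine wave arrives at rest at time `π`. The control it needs is admissible: `ε u = (sin
  -- x - x) + x₀ / 2`, where `|x₀| ≤ 19 / 10 * ε` and the first term is cubic.
  set x : ℝ → ℝ := fun t => x₀ * (1 + Real.cos t) / 2 with hx
  set y : ℝ → ℝ := fun t => -x₀ * Real.sin t / 2 with hy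
  set u : ℝ → ℝ := fun t => (Real.sin (x t) - x₀ * Real.cos t / 2) / ε with hu
  have hxc : Continuous x := by fun_prop
  have hyc : Continuous y := by fun_prop
  have huc : Continuous u := by fun_prop
  have hxd : ∀ t, HasDerivAt x (y t) t := fun t =>
    ((((Real.hasDerivAt_cos t).const_add 1).const_mul x₀).div_const 2).congr_deriv (by
      simp only [hy]; ring)
  have hyd : ∀ t, HasDerivAt y (-Real.sin (x t) + ε * u t) t := fun t =>
    (((Real.hasDerivAt_sin t).const_mul (-x₀)).div_const 2).congr_deriv (by
      simp only [hu]; field_simp; ring)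
  have hxm : ∀ t, -(19 / 10 * ε) ≤ x t ∧ x t ≤ 0 := fun t => by
    have h2 := Real.neg_one_le_cos t
    have h3 := Real.cos_le_one t
    simp only [hx]
    constructor <;> nlinarith
  have hzone : ∀ t, |Real.sin (x t)| < 2 * ε ∧ |y t| < 2 * ε := fun t => by
    refine ⟨Real.abs_sin_le_abs.trans_lt (abs_lt.2 ⟨?_, ?_⟩), abs_lt.2 ⟨?_, ?_⟩⟩
    · linarith [(hxm t).1]
    · linarith [(hxm t).2]
    all_goals
      have h2 := Real.neg_one_le_sin t
      have h3 := Real.sin_le_one t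
      simp only [hy]
      nlinarith
  have hub : ∀ t, |u t| ≤ 1 := fun t => by
    obtain ⟨h2, h3⟩ := hxm t
    have h4 : x t ≤ Real.sin (x t) ∧ Real.sin (x t) ≤ x t + ε / 100 := by
      have e : Real.sin (-x t) = -Real.sin (x t) := Real.sin_neg _
      have h5 := Real.sin_le (x := -x t) (by linarith)
      refine ⟨by linarith, ?_⟩
      rcases h3.eq_or_lt with h6 | h6
      · rw [h6, Real.sin_zero]; positivity
      · have h7 := Real.sin_gt_sub_cube (x := -x t) (by linarith)
        have h8 : (-x t) ^ 3 ≤ (-x t) * (1 / 600) := by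
          have : (-x t) * (-x t) ≤ 1 / 25 * (1 / 25) := by gcongr <;> linarith
          nlinarith
        linarith
    simp only [hu]
    rw [abs_div, abs_of_pos hε, div_le_one hε, abs_le]
    have h9 : x t = x₀ / 2 + x₀ * Real.cos t / 2 := by simp only [hx]; ring
    constructor <;> linarith
  refine ⟨Real.pi, x, y, u, ⟨⟨hpi.le, hε, huc.measurable, fun t _ => hub t, hxc.continuousOn,
    hyc.continuousOn, fun s _ t _ => ?_, fun s _ t _ => ?_⟩, fun t _ hn => absurd (hzone t) hn⟩,
    by simp only [hx, Real.cos_zero]; ring, by simp [hy], ⟨0, by simp [hx]⟩, by simp [hy], ?_, ?_⟩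
  · exact (integral_eq_sub_of_hasDerivAt (fun r _ => hxd r) (hyc.intervalIntegrable _ _)).symm
  · exact (integral_eq_sub_of_hasDerivAt (fun r _ => hyd r)
      ((by fun_prop : Continuous fun r => -Real.sin (x r) + ε * u r).intervalIntegrable _ _)).symm
  · refine (measure_mono (fun t ht => ht.1 : zoneTimes ε Real.pi x y ⊆ Icc 0 Real.pi)).trans ?_
    rw [Real.volume_Icc]
    exact ENNReal.ofReal_le_ofReal (by linarith [Real.pi_le_four])
  · have h2 : zoneSwitchings ε Real.pi x y u = ∅ := eq_empty_of_forall_notMem fun t ht =>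
      ht.2.1 ⟨u t, (huc.tendsto t).mono_left nhdsWithin_le_nhds⟩
    simp [h2]

/-- Under the feedback the pendulum cannot remain at rest on the left half circle unless it is
already close to the lower equilibrium. This serves both to start a run and to locate its end. -/
theorem force_pos {ε v : ℝ} (hε : 0 < ε) (hε1 : ε ≤ 1 / 100) (h0 : -Real.pi ≤ v)
    (h1 : v < -(11 / 10 * ε)) : 0 < -Real.sin v + ε * feedback ε v 0 := by
  rcases le_total v (-Real.pi + 16 / 5 * ε) with h2 | h2
  · have := Follows.push hε hε1 h0 h2 le_rfl (by positivity)
    linarith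
  have h3 := Real.pi_gt_three
  have h4 : ∀ z, 11 / 10 * ε ≤ z → z ≤ 16 / 5 * ε → ε < Real.sin z := fun z hz hz1 => by
    have h5 := Real.sin_gt_sub_cube (x := z) (by linarith)
    have h6 : z ^ 3 ≤ z * (1 / 600) := by
      have : z * z ≤ 1 / 25 * (1 / 25) := by gcongr <;> linarith
      nlinarith
    linarith
  have h5 := (abs_le.1 (abs_feedback_le ε v 0)).1
  have h6 : ε < Real.sin (-v) := by
    rcases le_total (-v) (Real.pi / 2) with h7 | h7
    · exact (h4 _ le_rfl (by linarith)).trans_le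
        (Real.sin_le_sin_of_le_of_le_pi_div_two (by linarith) h7 (by linarith))
    · rw [← Real.sin_pi_sub]
      rcases le_total (Real.pi - -v) (16 / 5 * ε) with h8 | h8
      · exact h4 _ (by linarith) h8
      · exact (h4 _ (by linarith) le_rfl).trans_le
          (Real.sin_le_sin_of_le_of_le_pi_div_two (by linarith) (by linarith) h8)
  rw [Real.sin_neg] at h6
  nlinarith

/-- A node: a standstill between the equilibria or a passage through the upper equilibrium. -/
structure Node (x₀ y₀ : ℝ) : Prop where
  angle_mem : x₀ ∈ Icc (-Real.pi) 0
  vel_nonneg : 0 ≤ y₀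
  stop_or_up : y₀ = 0 ∨ x₀ = -Real.pi

theorem en_near_of_zone {ε v w : ℝ} (hε : 0 < ε) (hs : |Real.sin v| ≤ 2 * ε) (hw : |w| ≤ 2 * ε) :
    en v w ≤ 7 * ε ^ 2 ∨ |en v w - 2| ≤ 5 * ε ^ 2 := by
  have := energy_near_of_small (x := v) (y := w) (r := 21 / 10 * ε) (by linarith) (by linarith)
  have h2 : (0 : ℝ) < ε ^ 2 := by positivity
  rcases this with h | h
  · exact Or.inl (h.trans (by nlinarith))
  · exact Or.inr (h.trans (by nlinarith))

namespace Run

variable {ε x₀ y₀ T : ℝ} {x y u : ℝ → ℝ}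

theorem neg_le_angle (h : Run ε x₀ y₀ T x y u) (hε1 : ε ≤ 1 / 100) :
    -(11 / 10 * ε) ≤ x T := by
  have hε := h.arc.ctrl.eps_pos
  rcases h.finish with h1 | ⟨-, h1⟩
  · rw [h1]; linarith [Real.pi_pos]
  · by_contra! h2
    have := force_pos hε hε1 (h.angle_mem T h.arc.ctrl.right_mem).1 h2
    linarith

/-- A passage over the top is translated by `2 π`, and a standstill on the right is reflected; both
symmetries preserve energy and `Damps`. -/
theorem exists_node (h : Run ε x₀ y₀ T x y u) (hε1 : ε ≤ 1 / 100) :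
    ∃ x₁ y₁, Node x₁ y₁ ∧ en x₁ y₁ = en (x T) (y T) ∧
      ∀ c, Damps ε c x₁ y₁ → Damps ε c (x T) (y T) := by
  have hT := h.arc.ctrl.right_mem
  have hε := h.arc.ctrl.eps_pos
  have hpi := Real.pi_gt_three
  rcases h.finish with h1 | ⟨h1, -⟩
  · refine ⟨-Real.pi, y T, ⟨⟨le_rfl, by linarith⟩, h.vel_nonneg T hT, Or.inr rfl⟩, ?_,
      fun c hc => ?_⟩
    · rw [h1, en, en, Real.cos_neg]
    · have := hc.add_int_mul 1
      rw [h1]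
      convert this using 1
      push_cast; ring
  · rw [h1]
    rcases le_total (x T) 0 with h2 | h2
    · exact ⟨x T, 0, ⟨⟨by linarith [h.neg_le_angle hε1], h2⟩, le_rfl, Or.inl rfl⟩, rfl,
        fun c hc => hc⟩
    · refine ⟨-x T, 0, ⟨⟨by linarith [(h.angle_mem T hT).2], by linarith⟩, le_rfl, Or.inl rfl⟩, ?_,
        fun c hc => by simpa using hc.neg⟩
      rw [en, en, Real.cos_neg]

theorem damps (h : Run ε x₀ y₀ T x y u) {c : ℝ} (hc : 0 ≤ c) (hd : Damps ε c (x T) (y T)) :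
    Damps ε (c + 1) x₀ y₀ := by
  have := hd.append h.arc hc zero_le_one (by simpa using h.volume_le) h.no_switching
    fun _ _ => le_rfl
  rwa [h.angle_zero, h.vel_zero] at this

/-- In the closed zone the energy is at most `7 ε²` or within `5 ε²` of `2`, and along a run it
rises by at most `4 ε²`. The thresholds `11 = 7 + 4` and `9 = 5 + 4` therefore keep the whole run
outside. -/
theorem damps_of_not_zone (h : Run ε x₀ y₀ T x y u) {c : ℝ} (hc : 0 ≤ c)
    (h1 : 11 * ε ^ 2 < en (x T) (y T))
    (h2 : en x₀ y₀ < 2 - 9 * ε ^ 2 ∨ 2 + 9 * ε ^ 2 < en (x T) (y T))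
    (hd : Damps ε c (x T) (y T)) : Damps ε c x₀ y₀ := by
  have hε := h.arc.ctrl.eps_pos
  have hl := h.arc.ctrl.left_mem
  have hr := h.arc.ctrl.right_mem
  have hmono : ∀ s ∈ Icc 0 T, ∀ t ∈ Icc 0 T, s ≤ t → x s ≤ x t := fun s hs t ht hst =>
    h.arc.ctrl.angle_mono h.vel_nonneg hs ht hst
  have hz : ∀ t ∈ Icc 0 T, ¬(|Real.sin (x t)| ≤ 2 * ε ∧ |y t| ≤ 2 * ε) := fun t ht hz => by
    have e1 := h.energy_le 0 hl t ht ht.1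
    have e2 := h.energy_le t ht T hr ht.2
    have m1 := hmono 0 hl t ht ht.1
    have m2 := hmono t ht T hr ht.2
    rw [h.angle_zero, h.vel_zero] at e1
    rw [h.angle_zero] at m1
    have p1 : 0 ≤ ε * (x t - x₀) := mul_nonneg hε.le (by linarith)
    have p2 : 0 ≤ ε * (x T - x t) := mul_nonneg hε.le (by linarith)
    rcases en_near_of_zone hε hz.1 hz.2 with h3 | h3
    · linarith
    · obtain ⟨h4, h5⟩ := abs_le.1 h3
      rcases h2 with h2 | h2 <;> linarith
  have hzt : zoneTimes ε T x y = ∅ := eq_empty_of_forall_notMem fun t ht =>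
    hz t ht.1 ⟨ht.2.1.le, ht.2.2.le⟩
  have := hd.append h.arc hc le_rfl (by simp [hzt]) h.no_switching
    fun h3 h4 => absurd ⟨h3, h4⟩ (hz T hr)
  rwa [h.angle_zero, h.vel_zero, add_zero] at this

end Run

/-- Near or above the separatrix the next run starts far from the bottom. It therefore loses an
energy of order `ε`, enough to jump over the whole layer of width `18 ε²` around `2`. -/
theorem Node.le_neg_two {ε x₀ y₀ : ℝ} (h : Node x₀ y₀) (hε : 0 < ε) (hε1 : ε ≤ 1 / 100)
    (hE : 2 - 9 * ε ^ 2 ≤ en x₀ y₀) : x₀ ≤ -2 := by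
  rcases h.stop_or_up with h1 | h1
  · by_contra! h2
    have h3 : Real.cos (2 : ℝ) ≤ Real.cos (-x₀) :=
      Real.cos_le_cos_of_nonneg_of_le_pi (by linarith [h.angle_mem.2])
        (by linarith [Real.pi_gt_three]) (by linarith)
    have h4 : -(4 / 5) < Real.cos (2 : ℝ) := by
      have h5 : Real.cos (3 * Real.pi / 4) < Real.cos 2 :=
        Real.cos_lt_cos_of_nonneg_of_le_pi (by norm_num) (by linarith [Real.pi_pos])
          (by linarith [Real.pi_gt_three])
      have h6 : Real.cos (3 * Real.pi / 4) = -(√2 / 2) := by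
        rw [show 3 * Real.pi / 4 = Real.pi - Real.pi / 4 by ring, Real.cos_pi_sub,
          Real.cos_pi_div_four]
      have h7 : √2 < 3 / 2 := by rw [Real.sqrt_lt' (by norm_num)]; norm_num
      linarith
    rw [Real.cos_neg] at h3
    rw [en, h1] at hE
    nlinarith
  · rw [h1]; linarith [Real.pi_gt_three]

/-- From a node, the pendulum is damped at once or a run leads to a node of lower energy. -/
theorem Node.step {ε x₀ y₀ : ℝ} (h : Node x₀ y₀) (hε : 0 < ε) (hε1 : ε ≤ 1 / 100) :
    Damps ε 1 x₀ y₀ ∨ ∃ x₁ y₁, Node x₁ y₁ ∧ en x₁ y₁ ≤ en x₀ y₀ - 4 / 5 * ε ^ 2 ∧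
      (∀ c, 0 ≤ c → Damps ε c x₁ y₁ → Damps ε (c + 1) x₀ y₀) ∧
      (11 * ε ^ 2 < en x₁ y₁ → (en x₀ y₀ < 2 - 9 * ε ^ 2 ∨ 2 + 9 * ε ^ 2 < en x₁ y₁) →
        ∀ c, 0 ≤ c → Damps ε c x₁ y₁ → Damps ε c x₀ y₀) ∧
      (2 - 9 * ε ^ 2 ≤ en x₀ y₀ → en x₁ y₁ ≤ en x₀ y₀ - 19 * ε ^ 2) := by
  have hpi := Real.pi_gt_three
  -- Otherwise a run starts left of `-19 / 10 * ε` and ends right of `-11 / 10 * ε`; the difference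
  -- `4 / 5 * ε` gives the energy loss `4 / 5 * ε²`.
  by_cases hn : y₀ = 0 ∧ -(19 / 10 * ε) ≤ x₀
  · rw [hn.1]
    exact Or.inl (Damps.of_near hε hε1 hn.2 h.angle_mem.2)
  right
  have hx : x₀ < -(19 / 10 * ε) := by
    rcases h.stop_or_up with h1 | h1
    · exact not_le.1 fun h2 => hn ⟨h1, h2⟩
    · rw [h1]; linarith
  obtain ⟨T, x, y, u, hr⟩ := exists_run hε hε1 (x₀ := x₀) (y₀ := y₀)
    ⟨h.angle_mem.1, by linarith⟩ h.vel_nonneg (by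
      rcases h.vel_nonneg.eq_or_lt with h1 | h1
      · rw [← h1]; exact Or.inr (force_pos hε hε1 h.angle_mem.1 (by linarith))
      · exact Or.inl h1)
  obtain ⟨x₁, y₁, h1, h2, h3⟩ := hr.exists_node hε1
  have hxT := hr.neg_le_angle hε1
  have e1 := hr.energy_le 0 hr.arc.ctrl.left_mem T hr.arc.ctrl.right_mem hr.arc.ctrl.le
  have e2 := hr.energy_le_of_far
  rw [hr.angle_zero, hr.vel_zero] at e1 e2
  refine ⟨x₁, y₁, h1, ?_, fun c hc hd => hr.damps hc (h3 c hd), fun h4 h5 c hc hd => ?_,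
    fun hE => ?_⟩
  · rw [h2]
    rcases le_total (-Real.pi + 9 / 5 * ε) x₀ with h4 | h4
    · have := e2 h4
      nlinarith
    · nlinarith
  · rw [h2] at h4 h5
    exact hr.damps_of_not_zone hc h4 h5 (h3 c hd)
  · have h4 := h.le_neg_two hε hε1 hE
    rw [h2]
    nlinarith

/-- Induction along the nodes visited by a motion. -/
theorem Node.induction {ε : ℝ} (hε : 0 < ε) {P : ℝ → ℝ → Prop}
    (H : ∀ x₀ y₀, Node x₀ y₀ →
      (∀ x₁ y₁, Node x₁ y₁ → en x₁ y₁ ≤ en x₀ y₀ - 4 / 5 * ε ^ 2 → P x₁ y₁) → P x₀ y₀)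
    {x₀ y₀ : ℝ} (h : Node x₀ y₀) : P x₀ y₀ := by
  have key : ∀ n : ℕ, ∀ x₀ y₀, Node x₀ y₀ → en x₀ y₀ < 4 / 5 * ε ^ 2 * n → P x₀ y₀ := by
    intro n
    induction n with
    | zero =>
      intro x₀ y₀ _ hE
      have := en_nonneg x₀ y₀
      simp at hE
      linarith
    | succ n ih =>
      intro x₀ y₀ h hE
      refine H x₀ y₀ h fun x₁ y₁ h1 hE1 => ih x₁ y₁ h1 ?_
      push_cast at hE
      linarith
  obtain ⟨n, hn⟩ := exists_nat_gt (en x₀ y₀ / (4 / 5 * ε ^ 2))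
  exact key n x₀ y₀ h (by rwa [div_lt_iff₀' (by positivity)] at hn)

/-- Every run is charged one unit, and each loses at least `4 / 5 * ε²`. The bound is useful only
for energies of order `ε²`. -/
theorem Node.damps_of_low {ε : ℝ} (hε : 0 < ε) (hε1 : ε ≤ 1 / 100) {x₀ y₀ : ℝ} (h : Node x₀ y₀) :
    Damps ε (1 + en x₀ y₀ / (4 / 5 * ε ^ 2)) x₀ y₀ := by
  refine Node.induction hε (P := fun x₀ y₀ => Damps ε (1 + en x₀ y₀ / (4 / 5 * ε ^ 2)) x₀ y₀)
    (fun x₀ y₀ h ih => ?_) h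
  have h0 := en_nonneg x₀ y₀
  rcases h.step hε hε1 with h1 | ⟨x₁, y₁, h1, h2, h3, -, -⟩
  · exact h1.mono (by have : 0 ≤ en x₀ y₀ / (4 / 5 * ε ^ 2) := by positivity
                      linarith)
  · have h4 := en_nonneg x₁ y₁
    refine (h3 _ (by positivity) (ih x₁ y₁ h1 h2)).mono ?_
    have h5 : en x₁ y₁ / (4 / 5 * ε ^ 2) ≤ (en x₀ y₀ - 4 / 5 * ε ^ 2) / (4 / 5 * ε ^ 2) := by
      gcongr
    rw [sub_div, div_self (by positivity)] at h5
    linarith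

/-- Runs ending above `12 ε²` are free. The run that first ends below costs 1, and the remainder at
most `1 + 12 / (4 / 5) = 16`. -/
theorem Node.damps_of_lt {ε : ℝ} (hε : 0 < ε) (hε1 : ε ≤ 1 / 100) {x₀ y₀ : ℝ} (h : Node x₀ y₀)
    (hE : en x₀ y₀ < 2 - 9 * ε ^ 2) : Damps ε 17 x₀ y₀ := by
  have h2 : (0 : ℝ) < ε ^ 2 := by positivity
  have hlow : ∀ x₁ y₁, Node x₁ y₁ → en x₁ y₁ ≤ 12 * ε ^ 2 → Damps ε 16 x₁ y₁ :=
    fun x₁ y₁ h1 hE => (h1.damps_of_low hε hε1).mono (by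
      have : en x₁ y₁ / (4 / 5 * ε ^ 2) ≤ 15 := by
        rw [div_le_iff₀ (by positivity)]; linarith
      linarith)
  refine Node.induction hε (P := fun x₀ y₀ => en x₀ y₀ < 2 - 9 * ε ^ 2 → Damps ε 17 x₀ y₀)
    (fun x₀ y₀ h ih hE => ?_) h hE
  rcases h.step hε hε1 with h1 | ⟨x₁, y₁, h1, h3, h4, h5, -⟩
  · exact h1.mono (by norm_num)
  · rcases le_or_gt (en x₁ y₁) (12 * ε ^ 2) with h6 | h6
    · exact (h4 16 (by norm_num) (hlow x₁ y₁ h1 h6)).mono (by norm_num)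
    · exact h5 (by linarith) (Or.inl hE) 17 (by norm_num) (ih x₁ y₁ h1 h3 (by linarith))

/-- Runs ending above `2 + 9 ε²` are free. One run enters the layer or jumps over it, and at most
one more leaves it downwards, since it loses at least `19 ε²`; together `17 + 1 + 1`. -/
theorem Node.damps {ε : ℝ} (hε : 0 < ε) (hε1 : ε ≤ 1 / 100) {x₀ y₀ : ℝ} (h : Node x₀ y₀) :
    Damps ε 19 x₀ y₀ := by
  have h2 : (0 : ℝ) < ε ^ 2 := by positivity
  have hmid : ∀ x₀ y₀, Node x₀ y₀ → en x₀ y₀ ≤ 2 + 9 * ε ^ 2 → Damps ε 18 x₀ y₀ := by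
    intro x₀ y₀ h hE
    rcases lt_or_ge (en x₀ y₀) (2 - 9 * ε ^ 2) with h0 | h0
    · exact (h.damps_of_lt hε hε1 h0).mono (by norm_num)
    rcases h.step hε hε1 with h1 | ⟨x₁, y₁, h1, -, h4, -, h5⟩
    · exact h1.mono (by norm_num)
    · exact (h4 17 (by norm_num) (h1.damps_of_lt hε hε1 (by linarith [h5 h0]))).mono (by norm_num)
  refine Node.induction hε (fun x₀ y₀ h ih => ?_) h
  rcases h.step hε hε1 with h1 | ⟨x₁, y₁, h1, h3, h4, h5, -⟩
  · exact h1.mono (by norm_num)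
  · rcases le_or_gt (en x₁ y₁) (2 + 9 * ε ^ 2) with h6 | h6
    · exact (h4 18 (by norm_num) (hmid x₁ y₁ h1 h6)).mono (by norm_num)
    · exact h5 (by nlinarith) (Or.inr h6) 19 (by norm_num) (ih x₁ y₁ h1 h3)

/-! ### Existence of quasioptimal controls. -/

theorem exists_int_add_mem (x : ℝ) : ∃ (k : ℤ) (x₀ : ℝ), x₀ ∈ Ico (-Real.pi) Real.pi ∧
    x₀ + k * (2 * Real.pi) = x := by
  refine ⟨toIcoDiv Real.two_pi_pos (-Real.pi) x, toIcoMod Real.two_pi_pos (-Real.pi) x, ?_, ?_⟩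
  · have := toIcoMod_mem_Ico Real.two_pi_pos (-Real.pi) x
    rwa [show -Real.pi + 2 * Real.pi = Real.pi by ring] at this
  · have := toIcoMod_add_toIcoDiv_zsmul Real.two_pi_pos (-Real.pi) x
    rwa [zsmul_eq_mul] at this

theorem damps {ε : ℝ} (hε : 0 < ε) (hε1 : ε ≤ 1 / 100) (x₀ y₀ : ℝ) : Damps ε 20 x₀ y₀ := by
  have hnonneg : ∀ x₀ y₀, 0 ≤ y₀ → Damps ε 20 x₀ y₀ := by
    intro x y₀ hy
    obtain ⟨k, x₀, hx₀, rfl⟩ := exists_int_add_mem x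
    refine Damps.add_int_mul ?_ k
    rcases hy.eq_or_lt with rfl | hy
    · rcases le_total x₀ 0 with h1 | h1
      · exact (Node.damps hε hε1 ⟨⟨hx₀.1, h1⟩, le_rfl, Or.inl rfl⟩).mono (by norm_num)
      · have := Node.damps hε hε1 (x₀ := -x₀) (y₀ := 0)
          ⟨⟨by linarith [hx₀.2], by linarith⟩, le_rfl, Or.inl rfl⟩
        simpa using this.neg.mono (by norm_num : (19 : ℝ) ≤ 20)
    · obtain ⟨T, x, y, u, hr⟩ := exists_run hε hε1 hx₀ hy.le (Or.inl hy)
      obtain ⟨x₁, y₁, h1, -, h3⟩ := hr.exists_node hε1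
      exact (hr.damps (by norm_num) (h3 19 (h1.damps hε hε1))).mono (by norm_num)
  rcases le_total 0 y₀ with h | h
  · exact hnonneg x₀ y₀ h
  · simpa using (hnonneg (-x₀) (-y₀) (by linarith)).neg

theorem exists_isQuasioptimal : ∃ m : ℝ → Phase → Motion, IsQuasioptimal m := by
  have key : ∀ (ε : ℝ) (p : Phase), ∃ m : Motion, 0 < ε → ε ≤ 1 / 100 →
      m.IsDamping ε p ∧ m.DryFriction ε ∧
      volume {t ∈ Icc 0 m.T | m.state t ∈ standstill ε} ≤ ENNReal.ofReal (27 * 20) ∧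
      (({t ∈ m.switchings | m.state t ∈ closure (standstill ε)}.encard : ℕ∞) : ℝ≥0∞)
        ≤ ENNReal.ofReal 20 := by
    intro ε p
    by_cases h : 0 < ε ∧ ε ≤ 1 / 100
    · obtain ⟨θ, hθ⟩ := QuotientAddGroup.mk_surjective p.1
      obtain ⟨m, hm⟩ := (damps h.1 h.2 θ p.2).exists_motion (p := p) (Prod.ext hθ rfl)
      exact ⟨m, fun _ _ => hm⟩
    · exact ⟨⟨0, 0, 0, 0⟩, fun h1 h2 => absurd ⟨h1, h2⟩ h⟩
  choose m hm using key
  have hev : ∀ᶠ ε : ℝ in 𝓝[>] 0, 0 < ε ∧ ε ≤ 1 / 100 := by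
    filter_upwards [Ioc_mem_nhdsGT (show (0 : ℝ) < 1 / 100 by norm_num)] with ε h using h
  refine ⟨m, hev.mono fun ε h p => (hm ε p h.1 h.2).1, hev.mono fun ε h p => (hm ε p h.1 h.2).2.1,
    27 * 20, hev.mono fun ε h p => ?_⟩
  -- The constructed motions obey bounds independent of `ε`, stronger than the logarithmic ones.
  have hlog : 1 ≤ Real.log (1 / ε) := by
    rw [Real.le_log_iff_exp_le (by have := h.1; positivity), le_div_iff₀ h.1]
    nlinarith [Real.exp_one_lt_d9, h.1, h.2]
  obtain ⟨-, -, h3, h4⟩ := hm ε p h.1 h.2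
  exact ⟨h3.trans (ENNReal.ofReal_le_ofReal (by linarith)),
    h4.trans (ENNReal.ofReal_le_ofReal (by linarith))⟩

end Pendulum

end

theorem mainTheorem6 :
    (∃ m : ℝ → Pendulum.Phase → Pendulum.Motion, Pendulum.IsQuasioptimal m) ∧
    ∀ m : ℝ → Pendulum.Phase → Pendulum.Motion, Pendulum.IsQuasioptimal m →
      Tendsto (fun ε : ℝ => ENNReal.ofReal ε * Pendulum.switchingNumber m ε) (𝓝[>] 0)
        (𝓝 (ENNReal.ofReal (∫ x in (0 : ℝ)..Real.pi, Real.sin x / (2 * x)))) ∧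
      ∀ (K : Set Pendulum.Phase) (E : ℝ), IsCompact K → IsGreatest (Pendulum.energy '' K) E →
        Tendsto (fun ε : ℝ => ENNReal.ofReal ε * Pendulum.dampingTime m K ε) (𝓝[>] 0)
          (𝓝 (ENNReal.ofReal (Pendulum.tau E))) :=
  ⟨Pendulum.exists_isQuasioptimal, fun _ hm => ⟨Pendulum.tendsto_switchingNumber hm,
    fun _ _ _ hE => Pendulum.tendsto_dampingTime hm hE⟩⟩
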